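/- Graphs are finite, undirected and loopless and may contain parallel edges. A $k$-edge-colored graph is a graph $G=(V,E)$ with a map $c\colon E\to[k]$; write $E_i=c^{-1}(i)$. A set $F\subseteq E$ is \emph{properly colored} if any two distinct edges of $F$ sharing an endpoint have different colors, and it is a \emph{forest with bundles} if its support graph (the simple graph obtained from $F$ by replacing each class of parallel edges by a single edge) is a forest. In the Maximum-size Properly Colored Forest with Bundles problem one looks for a properly colored forest with bundles $F\subseteq E$ of maximum size $|F|$; let $\mathrm{OPT}(G)$ be this maximum. \textbf{Theorem.} There is a single algorithm (a program for a random access machine whose arithmetic operations are addition and truncated subtraction, counted at unit cost), running in time polynomial in $|V|+|E|$, which for every $k$ and every $k$-edge-colored graph $G=(V,E)$ returns a set $F\subseteq E$ such that, for some choice of a maximum matching $M_i\subseteq E_i$ for each color $i\in[k]$, $F$ is a maximum-size forest with bundles contained in $M_1\cup\dots\cup M_k$. The set $F$ is a properly colored forest with bundles satisfying $|F|\ge\tfrac34\,\mathrm{OPT}(G)$ if $k=2$, and a properly colored forest with bundles satisfying $|F|\ge\tfrac12\,\mathrm{OPT}(G)$ if $k=3$. Moreover, for $k=2$ and $k=3$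 these guarantees hold for every choice of the maximum matchings $M_i\subseteq E_i$ and of the maximum-size forest with bundles $F\subseteq M_1\cup\dots\cup M_k$. -/

import Mathlib

/-- A loopless undirected multigraph with vertex set `V` and edge set `E`, together with an
edge-coloring with `k` colors.  Edge `e` joins `fst e` and `snd e`; the order of the two
endpoints is irrelevant to all notions below. -/
structure EdgeColoredGraph (V : Type*) (E : Type*) (k : ℕ) where
  fst : E → V
  snd : E → V
  fst_ne_snd : ∀ e, fst e ≠ snd e
  color : E → Fin k

namespace EdgeColoredGraph

variable {V : Type*} {E : Type*} {k : ℕ}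

/-- `v` is an endpoint of `e`. -/
def Incident (G : EdgeColoredGraph V E k) (e : E) (v : V) : Prop :=
  G.fst e = v ∨ G.snd e = v

/-- `e` has endpoints `u` and `v`. -/
def Joins (G : EdgeColoredGraph V E k) (e : E) (u v : V) : Prop :=
  (G.fst e = u ∧ G.snd e = v) ∨ (G.fst e = v ∧ G.snd e = u)

/-- The support graph of `F`: every bundle of parallel edges of `F` becomes a single edge. -/
def supp (G : EdgeColoredGraph V E k) (F : Finset E) : SimpleGraph V :=
  SimpleGraph.fromRel fun u v => ∃ e ∈ F, G.Joins e u v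

/-- `F` is a forest with bundles: its support graph is a forest. -/
def IsForestWithBundles (G : EdgeColoredGraph V E k) (F : Finset E) : Prop :=
  (G.supp F).IsAcyclic

/-- Any two distinct adjacent edges of `F` have distinct colors.  Parallel edges are adjacent. -/
def IsProperlyColored (G : EdgeColoredGraph V E k) (F : Finset E) : Prop :=
  ∀ e ∈ F, ∀ f ∈ F, e ≠ f → (∃ v, G.Incident e v ∧ G.Incident f v) → G.color e ≠ G.color f

/-- Every vertex is an endpoint of at most one edge of `M`. -/
def IsMatching (G : EdgeColoredGraph V E k) (M : Finset E) : Prop :=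
  ∀ v, ∀ e ∈ M, ∀ f ∈ M, G.Incident e v → G.Incident f v → e = f

/-- The set of edges of color `i`. -/
def colorClass [Fintype E] (G : EdgeColoredGraph V E k) (i : Fin k) : Finset E :=
  Finset.univ.filter fun e => G.color e = i

/-- `M` is a maximum-size matching contained in `A`. -/
def IsMaximumMatchingIn (G : EdgeColoredGraph V E k) (A M : Finset E) : Prop :=
  M ⊆ A ∧ G.IsMatching M ∧ ∀ N ⊆ A, G.IsMatching N → N.card ≤ M.card

/-- `F` is a maximum-size forest with bundles contained in `A`. -/
def IsMaximumForestWithBundlesIn (G : EdgeColoredGraph V E k) (A F : Finset E) : Prop :=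
  F ⊆ A ∧ G.IsForestWithBundles F ∧ ∀ H ⊆ A, G.IsForestWithBundles H → H.card ≤ F.card

/-- `F` is a possible result of the following procedure: choose a maximum matching in each color
class, then choose a maximum-size forest with bundles in the union of these matchings. -/
def IsMatchingUnionOutput [Fintype E] [DecidableEq E] (G : EdgeColoredGraph V E k)
    (F : Finset E) : Prop :=
  ∃ M : Fin k → Finset E, (∀ i, G.IsMaximumMatchingIn (G.colorClass i) (M i)) ∧
    G.IsMaximumForestWithBundlesIn (Finset.univ.biUnion M) F

/-- `F` is a properly colored forest with bundles whose size is at least `α` times the size of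
every (hence of a maximum-size) properly colored forest with bundles. -/
def IsApproxSolution (G : EdgeColoredGraph V E k) (α : ℚ) (F : Finset E) : Prop :=
  (G.IsProperlyColored F ∧ G.IsForestWithBundles F) ∧
    ∀ O : Finset E, G.IsProperlyColored O → G.IsForestWithBundles O →
      α * (O.card : ℚ) ≤ (F.card : ℚ)

end EdgeColoredGraph

/-!
A random access machine with structured control flow.  Its storage consists of arrays of natural
numbers, of which a program mentions only finitely many by name.  The arithmetic operations are
addition and truncated subtraction (no multiplication), so that in `t` steps the bit lengths of
the stored numbers grow by `O(t)` only: running times are polynomially related to those of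
Turing machines.
-/
namespace Ram

/-- `s a i` is the content of cell `i` of array `a`. -/
abbrev Store := ℕ → ℕ → ℕ

/-- Arithmetic expressions; `read a i` is the content of cell `i` of array `a`. -/
inductive Expr where
  | const (c : ℕ)
  | read (a : ℕ) (i : Expr)
  | add (x y : Expr)
  | sub (x y : Expr)

/-- The value of an expression. -/
def Expr.eval (s : Store) : Expr → ℕ
  | .const c => c
  | .read a i => s a (i.eval s)
  | .add x y => x.eval s + y.eval s
  | .sub x y => x.eval s - y.eval s

/-- The number of elementary steps needed to evaluate an expression. -/
def Expr.cost : Expr → ℕ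
  | .const _ => 1
  | .read _ i => i.cost + 1
  | .add x y => x.cost + y.cost + 1
  | .sub x y => x.cost + y.cost + 1

/-- Programs: `write a i x` stores `x` in cell `i` of array `a`; `branch b p q` runs `p` if
`b ≠ 0` and `q` otherwise; `loop b p` runs `p` as long as `b ≠ 0`. -/
inductive Program where
  | skip
  | write (a : ℕ) (i x : Expr)
  | seq (p q : Program)
  | branch (b : Expr) (p q : Program)
  | loop (b : Expr) (p : Program)

/-- The store after writing `x` to cell `i` of array `a`. -/
def Store.write (s : Store) (a i x : ℕ) : Store :=
  Function.update s a (Function.update (s a) i x)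

/-- `Exec p s t s'`: started in the store `s`, the program `p` halts in the store `s'` after
exactly `t` elementary steps. -/
inductive Exec : Program → Store → ℕ → Store → Prop
  | skip (s : Store) : Exec .skip s 1 s
  | write (a : ℕ) (i x : Expr) (s : Store) :
      Exec (.write a i x) s (i.cost + x.cost + 1) (s.write a (i.eval s) (x.eval s))
  | seq {p q : Program} {s s' s'' : Store} {t t' : ℕ} :
      Exec p s t s' → Exec q s' t' s'' → Exec (.seq p q) s (t + t') s''
  | branch_true {b : Expr} {p q : Program} {s s' : Store} {t : ℕ} :
      b.eval s ≠ 0 → Exec p s t s' → Exec (.branch b p q) s (b.cost + t + 1) s'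
  | branch_false {b : Expr} {p q : Program} {s s' : Store} {t : ℕ} :
      b.eval s = 0 → Exec q s t s' → Exec (.branch b p q) s (b.cost + t + 1) s'
  | loop_true {b : Expr} {p : Program} {s s' s'' : Store} {t t' : ℕ} :
      b.eval s ≠ 0 → Exec p s t s' → Exec (.loop b p) s' t' s'' →
        Exec (.loop b p) s (b.cost + t + t' + 1) s''
  | loop_false {b : Expr} {p : Program} {s : Store} :
      b.eval s = 0 → Exec (.loop b p) s (b.cost + 1) s

end Ram

namespace EdgeColoredGraph

/-- The initial store for a graph with vertices `0, …, n - 1`, edges `0, …, m - 1` and colors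
`0, …, k - 1`.  Array `0` starts with `n, m, k`; cell `j` of the arrays `1`, `2`, `3` contains the
two endpoints and the color of edge `j`; all other cells are `0`. -/
def inputStore {n m k : ℕ} (G : EdgeColoredGraph (Fin n) (Fin m) k) : Ram.Store := fun a j =>
  match a with
  | 0 => if j = 0 then n else if j = 1 then m else if j = 2 then k else 0
  | 1 => if h : j < m then (G.fst ⟨j, h⟩ : ℕ) else 0
  | 2 => if h : j < m then (G.snd ⟨j, h⟩ : ℕ) else 0
  | 3 => if h : j < m then (G.color ⟨j, h⟩ : ℕ) else 0
  | _ => 0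

/-- On input `G`, the program `P` halts after at most `T` steps and returns the edge set `F`:
after halting, the first `m` cells of array `4` contain the indicator vector of `F`. -/
def ReturnsWithin {n m k : ℕ} (P : Ram.Program) (G : EdgeColoredGraph (Fin n) (Fin m) k)
    (T : ℕ) (F : Finset (Fin m)) : Prop :=
  ∃ (t : ℕ) (s : Ram.Store), t ≤ T ∧ Ram.Exec P G.inputStore t s ∧
    ∀ j : Fin m, s 4 j = if j ∈ F then 1 else 0

end EdgeColoredGraph

/-! Approximation. Let A be the union of the chosen maximum matchings. A properly colored set meets
every color class in a matching, so |A| bounds the size of every properly colored set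
(`IsProperlyColored.card_le`), and it suffices to compare |F| with |A|. By maximality F connects the
endpoints of every edge of A, so the comparison can be made in each connected component of the
support of F. A component with c vertices contains at least c - 1 edges of F and at most ⌊c/2⌋ edges
of each of the k matchings. If c = 2, then F contains the whole bundle, so nothing is lost. If c ≥
3, then k⌊c/2⌋ / (c - 1) is at most 4/3 for k = 2 and at most 2 for k = 3, the worst case being c =
4 (`IsMaximumForestWithBundlesIn.mul_card_le`).

Maximum matchings are found by Edmonds' blossom method. A blossom is represented only by its vertex
set together with the fact that it is factor-critical: deleting any one vertex leaves a set with a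
perfect matching. An edge between two blossoms of the search forest starts two walks towards the
roots. If the walks meet, everything visited merges into one factor-critical set
(`SearchForest.merge`); if they end at different roots, a larger matching exists
(`SearchForest.exists_larger`). A forest that cannot be extended proves optimality by the easy half
of the Tutte–Berge formula (`SearchForest.card_le`).

The search only decides whether the matching can be enlarged and never traces an augmenting path.
The larger matching comes from self-reduction: edges outside M are deleted as long as a larger
matching survives, after which the remaining ones are forced and can be read off
(`isMatching_exchange`).

The forest is found by Kruskal's algorithm on whole bundles, by decreasing multiplicity. Its
optimality follows by comparing, at each multiplicity threshold, the numbers of bundles in two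
forests (`isMaximumForestWithBundlesIn_of_spanned`).

For the running time, all programs are written with counting loops whose bounds lie in array 0,
which is never modified by them. This gives a polynomial bound by structural recursion (`Cmd.exec`),
and correctness is proved with loop invariants (`Cmd.run_loop`). -/

set_option linter.unusedSectionVars false

/-! ### Perfect matchings of vertex sets and alternating chains -/

namespace EdgeColoredGraph

section Matching

variable {V E : Type*} {k : ℕ}

theorem Joins.symm {G : EdgeColoredGraph V E k} {e : E} {u v : V} (h : G.Joins e u v) :
    G.Joins e v u := Or.symm h

theorem Joins.incident_iff {G : EdgeColoredGraph V E k} {e : E} {u v w : V} (h : G.Joins e u v) :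
    G.Incident e w ↔ w = u ∨ w = v := by
  unfold Joins Incident at *; grind

variable [DecidableEq V] [DecidableEq E] (G : EdgeColoredGraph V E k)

/-- The set of vertices covered by `N`. -/
def cover (N : Finset E) : Finset V := N.biUnion fun e => {G.fst e, G.snd e}

theorem mem_cover {N : Finset E} {v : V} : v ∈ G.cover N ↔ ∃ e ∈ N, G.Incident e v := by
  simp [cover, Incident, eq_comm]

variable {G}

theorem IsMatching.card_cover {N : Finset E} (hN : G.IsMatching N) :
    (G.cover N).card = 2 * N.card := by
  rw [cover, Finset.card_biUnion]
  · rw [Finset.sum_congr rfl fun e _ => Finset.card_pair (G.fst_ne_snd e)]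
    simp [mul_comm]
  · intro e he f hf hef
    change Disjoint _ _
    rw [Finset.disjoint_left]
    intro v hv hv'
    exact hef (hN v e he f hf (by simpa [Incident, eq_comm] using hv)
      (by simpa [Incident, eq_comm] using hv'))

theorem IsMatching.subset {N N' : Finset E} (hN : G.IsMatching N) (h : N' ⊆ N) :
    G.IsMatching N' :=
  fun v e he f hf => hN v e (h he) f (h hf)

theorem IsMatching.union {N N' : Finset E} (hN : G.IsMatching N) (hN' : G.IsMatching N')
    (h : ∀ v ∈ G.cover N, v ∉ G.cover N') : G.IsMatching (N ∪ N') := by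
  intro v e he f hf hev hfv
  have := h v
  simp only [mem_cover] at this
  rcases Finset.mem_union.1 he with he | he <;> rcases Finset.mem_union.1 hf with hf | hf
  · exact hN v e he f hf hev hfv
  · exact absurd ⟨f, hf, hfv⟩ (this ⟨e, he, hev⟩)
  · exact absurd ⟨e, he, hev⟩ (this ⟨f, hf, hfv⟩)
  · exact hN' v e he f hf hev hfv

variable (G) in
/-- Some matching contained in `H` covers exactly the vertices in `Z`. -/
def PerfectOn (H : Finset E) (Z : Finset V) : Prop :=
  ∃ N ⊆ H, G.IsMatching N ∧ G.cover N = Z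

variable {H : Finset E}

theorem perfectOn_empty : G.PerfectOn H ∅ :=
  ⟨∅, by simp, by simp [IsMatching], by simp [cover]⟩

theorem perfectOn_pair {e : E} {u v : V} (he : e ∈ H) (h : G.Joins e u v) :
    G.PerfectOn H {u, v} := by
  refine ⟨{e}, by simpa using he, by simp +contextual [IsMatching], ?_⟩
  ext w
  simp [mem_cover, h.incident_iff]

theorem PerfectOn.union {Z W Y : Finset V} (hZ : G.PerfectOn H Z) (hW : G.PerfectOn H W)
    (hd : ∀ v ∈ Z, v ∉ W) (hY : ∀ v, v ∈ Y ↔ v ∈ Z ∨ v ∈ W) : G.PerfectOn H Y := by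
  obtain ⟨N, hNH, hN, rfl⟩ := hZ
  obtain ⟨N', hNH', hN', rfl⟩ := hW
  refine ⟨N ∪ N', Finset.union_subset hNH hNH', hN.union hN' hd, ?_⟩
  ext v
  rw [hY, mem_cover, mem_cover, mem_cover]
  grind

theorem PerfectOn.even_card {Z : Finset V} (hZ : G.PerfectOn H Z) : Even Z.card := by
  obtain ⟨N, -, hN, rfl⟩ := hZ
  exact ⟨N.card, by rw [hN.card_cover]; ring⟩

/-- The facts about a partial alternating chain with vertex set `Z` from `x` to a vertex `p`
outside `Z` that allow to shift uncovered vertices along it. -/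
structure IsChain (G : EdgeColoredGraph V E k) (H : Finset E) (even : V → Prop) (Z : Finset V)
    (x p : V) : Prop where
  notMem : p ∉ Z
  start : x ∈ Z ∨ (Z = ∅ ∧ x = p)
  full : G.PerfectOn H Z
  shift : G.PerfectOn H ((insert p Z).erase x)
  shift_even : ∀ v ∈ Z, even v → G.PerfectOn H ((insert p Z).erase v)
  shift_odd : ∀ v ∈ Z, ¬ even v → v ≠ x ∧ G.PerfectOn H ((Z.erase x).erase v)

theorem isChain_nil (even : V → Prop) (x : V) : IsChain G H even ∅ x x :=
  ⟨by simp, by simp, perfectOn_empty, by simpa using perfectOn_empty, by simp, by simp⟩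

/-- Here K is the blossom containing the end p of the chain, b its base, e the matching edge from b
to the odd vertex y, and f the edge from y to its parent q. As K is factor-critical, it can absorb
the vacancy at p, at b, or at any other vertex; each of the required perfect matchings is glued from
one of Z, one of K minus a vertex, and one of the pairs {b, y}, {y, q}. -/
theorem IsChain.snoc {even : V → Prop} {Z K : Finset V} {x p b y q : V} {e f : E}
    (h : IsChain G H even Z x p) (hK : ∀ v ∈ K, G.PerfectOn H (K.erase v)) (hp : p ∈ K)
    (hb : b ∈ K) (hKeven : ∀ v ∈ K, even v) (hy : ¬ even y)
    (he : e ∈ H) (hby : G.Joins e b y) (hf : f ∈ H) (hyq : G.Joins f y q)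
    (hKZ : ∀ v ∈ K, v ∉ Z) (hyZ : y ∉ Z) (hqZ : q ∉ Z) (hqK : q ∉ K) (hyq' : q ≠ y) :
    IsChain G H even (insert y (K ∪ Z)) x q := by
  have hyK : y ∉ K := fun hyK => hy (hKeven y hyK)
  have hyx : y ≠ x := by
    rintro rfl
    rcases h.start with h | ⟨-, rfl⟩
    · exact hyZ h
    · exact hyK hp
  have hKb := (hK b hb).union (perfectOn_pair he hby) (Y := insert y K) (by grind) (by grind)
  have hZK := h.shift.union (hK p hp) (Y := (K ∪ Z).erase x) (by grind)
    (by have := h.start; grind)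
  have hpair := perfectOn_pair hf hyq
  -- The start x can lie in the new blossom only in the first step, when the chain is still empty.
  have hxK : x ∈ K → x = p ∧ Z = ∅ := by
    intro hx
    rcases h.start with h | ⟨h, h'⟩
    · exact absurd h (hKZ x hx)
    · exact ⟨h', h⟩
  have hxmem : x ∈ K ∪ Z := by
    rcases h.start with h | ⟨-, rfl⟩
    · simp [h]
    · simp [hp]
  refine ⟨by grind, by grind, h.full.union hKb (by grind) (by grind),
    hZK.union hpair (by grind) (by grind), fun v hv hev => ?_, fun v hv hev => ?_⟩
  · have hvy : v ≠ y := by rintro rfl; exact hy hev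
    by_cases hvK : v ∈ K
    · exact (h.full.union (hK v hvK) (Y := (K ∪ Z).erase v) (by grind) (by grind)).union hpair
        (by grind) (by grind)
    · have hvZ : v ∈ Z := by grind
      exact ((h.shift_even v hvZ hev).union (hK p hp) (Y := (K ∪ Z).erase v)
        (by grind) (by grind)).union hpair (by grind) (by grind)
  · by_cases hvy : v = y
    · subst hvy
      refine ⟨hyx, ?_⟩
      convert hZK using 1
      grind
    · have hvZ : v ∈ Z := by grind
      obtain ⟨h1, h2⟩ := h.shift_odd v hvZ hev
      refine ⟨h1, h2.union hKb (by grind) ?_⟩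
      have hxK' : x ∉ K := by
        intro hx
        rw [(hxK hx).2] at hvZ
        simp at hvZ
      grind

/-- Two disjoint chains ending in a factor-critical set, together with an edge joining their
starting points, form a factor-critical set. -/
theorem IsChain.factorCritical {even : V → Prop} {U W L : Finset V} {x y p q : V} {e : E}
    (hU : IsChain G H even U x p) (hW : IsChain G H even W y q)
    (hL : ∀ v ∈ L, G.PerfectOn H (L.erase v)) (hp : p ∈ L) (hq : q ∈ L)
    (he : e ∈ H) (hxy : G.Joins e x y) (hUW : ∀ v ∈ U, v ∉ W) (hUL : ∀ v ∈ U, v ∉ L)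
    (hWL : ∀ v ∈ W, v ∉ L) :
    ∀ v ∈ U ∪ W ∪ L, G.PerfectOn H ((U ∪ W ∪ L).erase v) := by
  have key : ∀ {U W : Finset V} {x y p q : V} (_ : IsChain G H even U x p)
      (_ : IsChain G H even W y q) (_ : G.Joins e x y) (_ : p ∈ L) (_ : q ∈ L)
      (_ : ∀ v ∈ U, v ∉ W) (_ : ∀ v ∈ U, v ∉ L) (_ : ∀ v ∈ W, v ∉ L),
      ∀ v ∈ U, G.PerfectOn H ((U ∪ W ∪ L).erase v) := by
    intro U W x y p q hU hW hxy hp hq hUW hUL hWL v hv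
    -- For even v, the vacancy moves along U from v to p and is filled inside L, while W is matched
    -- in itself. For odd v, the matching of U without v and x is completed by the edge xy, and the
    -- vacancy this creates at y moves along W into L.
    by_cases hev : even v
    · exact ((hU.shift_even v hv hev).union (hL p hp) (Y := (U ∪ L).erase v) (by grind)
        (by grind)).union hW.full (by grind) (by grind)
    · obtain ⟨h1, h2⟩ := hU.shift_odd v hv hev
      have hxU : x ∈ U := by
        rcases hU.start with h | ⟨h, -⟩
        · exact h
        · simp [h] at hv
      have hy := hW.start
      have hWL' := hW.shift.union (hL q hq) (Y := (W ∪ L).erase y) (by grind) (by grind)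
      have hxy' : x ≠ y := by rcases hy with hy | ⟨-, rfl⟩ <;> grind
      exact (h2.union (perfectOn_pair he hxy) (Y := insert y (U.erase v)) (by grind)
        (by grind)).union hWL' (by grind) (by grind)
  intro v hv
  simp only [Finset.mem_union] at hv
  rcases hv with (hv | hv) | hv
  · exact key hU hW hxy hp hq hUW hUL hWL v hv
  · rw [Finset.union_comm U W]
    exact key hW hU hxy.symm hq hp (fun v h h' => hUW v h' h) hWL hUL v hv
  · clear key
    exact ((hL v hv).union hU.full (Y := (U ∪ L).erase v) (by grind) (by grind)).union hW.full
      (by grind) (by grind)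

/-- Two disjoint chains ending in disjoint factor-critical sets, together with an edge joining
their starting points, have a perfect matching. -/
theorem IsChain.perfectOn {even : V → Prop} {U W L L' : Finset V} {x y p q : V} {e : E}
    (hU : IsChain G H even U x p) (hW : IsChain G H even W y q)
    (hL : ∀ v ∈ L, G.PerfectOn H (L.erase v)) (hL' : ∀ v ∈ L', G.PerfectOn H (L'.erase v))
    (hp : p ∈ L) (hq : q ∈ L') (he : e ∈ H) (hxy : G.Joins e x y) (hUW : ∀ v ∈ U, v ∉ W)
    (hUL : ∀ v ∈ U, v ∉ L) (hUL' : ∀ v ∈ U, v ∉ L') (hWL : ∀ v ∈ W, v ∉ L)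
    (hWL' : ∀ v ∈ W, v ∉ L') (hLL' : ∀ v ∈ L, v ∉ L') :
    G.PerfectOn H (U ∪ W ∪ (L ∪ L')) := by
  have hx := hU.start
  have hy := hW.start
  have h1 := hU.shift.union (hL p hp) (Y := (U ∪ L).erase x) (by grind) (by grind)
  have h2 := hW.shift.union (hL' q hq) (Y := (W ∪ L').erase y) (by grind) (by grind)
  exact (h1.union h2 (Y := ((U ∪ L).erase x) ∪ ((W ∪ L').erase y)) (by grind) (by grind)).union
    (perfectOn_pair he hxy) (by grind) (by grind)

end Matching

end EdgeColoredGraph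

/-! ### The alternating search forest and walks towards its roots -/

namespace EdgeColoredGraph

section Search

variable {V E : Type*} [DecidableEq V] [DecidableEq E] {k : ℕ} {G : EdgeColoredGraph V E k}
  {vs : Finset V} {H M : Finset E} {mate base par base' par' : V → V} {st dep st' dep' : V → ℕ}

/-- `mate` maps every vertex covered by `M` to its partner and fixes all other vertices. -/
structure IsMate (G : EdgeColoredGraph V E k) (vs : Finset V) (M : Finset E) (mate : V → V) :
    Prop where
  mem : ∀ v ∈ vs, mate v ∈ vs
  invol : ∀ v ∈ vs, mate (mate v) = v
  joins : ∀ v ∈ vs, mate v ≠ v → ∃ e ∈ M, G.Joins e v (mate v)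
  of_mem : ∀ e ∈ M, mate (G.fst e) = G.snd e ∧ mate (G.snd e) = G.fst e

/-- The vertices with base `b`. -/
def baseClass (vs : Finset V) (base : V → V) (b : V) : Finset V := vs.filter (base · = b)

theorem mem_baseClass {b v : V} : v ∈ baseClass vs base b ↔ v ∈ vs ∧ base v = b := by
  simp [baseClass]

/-- The invariant of the search for an augmenting path: an alternating forest of blossoms.
A vertex has status `1` if it lies in a blossom, status `2` if it is an odd vertex of the forest,
and status `0` if it is outside of the forest. -/
structure SearchForest (G : EdgeColoredGraph V E k) (vs : Finset V) (H : Finset E)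
    (mate base par : V → V) (st dep : V → ℕ) : Prop where
  st_cases : ∀ v ∈ vs, st v = 0 ∨ st v = 1 ∨ st v = 2
  exposed : ∀ v ∈ vs, mate v = v → st v = 1 ∧ base v = v ∧ dep v = 0
  base_mem : ∀ v ∈ vs, base v ∈ vs
  base_base : ∀ v ∈ vs, base (base v) = base v
  st_base : ∀ v ∈ vs, st v = 1 → st (base v) = 1
  base_of_ne : ∀ v ∈ vs, st v ≠ 1 → base v = v
  critical : ∀ b ∈ vs, base b = b → st b = 1 → ∀ v ∈ baseClass vs base b,
    G.PerfectOn H ((baseClass vs base b).erase v)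
  mate_closed : ∀ v ∈ vs, base v ≠ v → base (mate v) = base v
  odd : ∀ y ∈ vs, st y = 2 → st (mate y) = 1 ∧ base (mate y) = mate y ∧ par y ∈ vs ∧
    st (par y) = 1 ∧ (∃ e ∈ H, G.Joins e y (par y)) ∧ dep (base (par y)) < dep (mate y)
  mate_base : ∀ v ∈ vs, st v = 1 → base v = v → mate v ≠ v → st (mate v) = 2
  free : ∀ v ∈ vs, st v = 0 → st (mate v) = 0

/-- At the start every exposed vertex is a blossom of its own, and deleting its only vertex leaves
the empty set. All other vertices are outside of the forest. -/
theorem SearchForest.init (hM : IsMate G vs M mate) (hbase : ∀ v ∈ vs, base v = v)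
    (hst : ∀ v ∈ vs, st v = if mate v = v then 1 else 0) (hdep : ∀ v ∈ vs, dep v = 0) :
    SearchForest G vs H mate base par st dep := by
  have hmem := hM.mem
  have hinv := hM.invol
  refine ⟨by grind, by grind, by grind, by grind, by grind, by grind, ?_, by grind, by grind,
    by grind, by grind⟩
  intro b hb _ _ v hv
  have h1 : (baseClass vs base b).erase v = ∅ := by
    ext w
    simp only [Finset.mem_erase, mem_baseClass, Finset.notMem_empty]
    rw [mem_baseClass] at hv
    grind
  rw [h1]
  exact perfectOn_empty

theorem SearchForest.st_of_base (h : SearchForest G vs H mate base par st dep) {v : V}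
    (hv : v ∈ vs) (hs : st (base v) = 1) : st v = 1 := by
  by_contra hne
  rw [h.base_of_ne v hv hne] at hs
  exact hne hs

/-- Extending the forest by an edge to a vertex outside of it and the matching edge there. -/
theorem SearchForest.grow (hM : IsMate G vs M mate)
    (h : SearchForest G vs H mate base par st dep) {x y : V} {e : E} (he : e ∈ H)
    (hxy : G.Joins e x y) (hx : x ∈ vs) (hy : y ∈ vs) (hsx : st x = 1) (hsy : st y = 0)
    (hst' : ∀ v ∈ vs, st' v = if v = mate y then 1 else if v = y then 2 else st v)
    (hpar' : ∀ v ∈ vs, par' v = if v = y then x else par v)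
    (hdep' : ∀ v ∈ vs, dep' v = if v = mate y then dep (base x) + 1 else dep v) :
    SearchForest G vs H mate base par' st' dep' := by
  have hmem := hM.mem
  have hinv := hM.invol
  have hmy : mate y ≠ y := by
    intro h'
    have := h.exposed y hy h'
    omega
  have hsm : st (mate y) = 0 := h.free y hy hsy
  have hby : base y = y := h.base_of_ne y hy (by omega)
  have hbm : base (mate y) = mate y := h.base_of_ne _ (hmem y hy) (by omega)
  have hinj : ∀ v ∈ vs, mate v = y → v = mate y := by
    intro v hv hvy
    rw [← hvy, hinv v hv]
  have hinj' : ∀ v ∈ vs, mate v = mate y → v = y := by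
    intro v hv hvy
    rw [← hinv v hv, hvy, hinv y hy]
  have hbv : ∀ v ∈ vs, base v = mate y → v = mate y := by
    intro v hv hvy
    by_contra hne
    have h1 : st v ≠ 1 := fun h1 => by
      have := h.st_base v hv h1
      rw [hvy] at this
      omega
    exact hne ((h.base_of_ne v hv h1).symm.trans hvy)
  have hst1 : ∀ v ∈ vs, st v = 1 → st' v = 1 := by
    intro v hv h1
    have := hst' v hv
    grind
  refine ⟨?_, ?_, h.base_mem, h.base_base, ?_, ?_, ?_, h.mate_closed, ?_, ?_, ?_⟩
  · intro v hv
    have := h.st_cases v hv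
    have := hst' v hv
    grind
  · intro v hv hvm
    obtain ⟨h1, h2, h3⟩ := h.exposed v hv hvm
    refine ⟨hst1 v hv h1, h2, ?_⟩
    rw [hdep' v hv, if_neg]
    · exact h3
    · rintro rfl
      omega
  · intro v hv h1
    rw [hst' v hv] at h1
    split_ifs at h1 with h2 h3
    · rw [h2, hbm, hst' _ (hmem y hy), if_pos rfl]
    · omega
    · exact hst1 _ (h.base_mem v hv) (h.st_base v hv h1)
  · intro v hv h1
    refine h.base_of_ne v hv fun h2 => h1 (hst1 v hv h2)
  · intro b hb hbb hsb
    by_cases hbm' : b = mate y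
    · intro v hv
      have h1 : (baseClass vs base b).erase v = ∅ := by
        ext w
        simp only [Finset.mem_erase, mem_baseClass, Finset.notMem_empty]
        rw [mem_baseClass] at hv
        grind
      rw [h1]
      exact perfectOn_empty
    · refine h.critical b hb hbb ?_
      rw [hst' b hb] at hsb
      grind
  · intro z hz hsz
    by_cases hzy : z = y
    · subst hzy
      refine ⟨by rw [hst' _ (hmem z hz), if_pos rfl], hbm, ?_⟩
      rw [hpar' z hz, if_pos rfl]
      refine ⟨hx, hst1 x hx hsx, ⟨e, he, hxy.symm⟩, ?_⟩
      rw [hdep' _ (hmem z hz), if_pos rfl, hdep' _ (h.base_mem x hx), if_neg]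
      · omega
      · intro h'
        have := h.st_base x hx hsx
        rw [h'] at this
        omega
    · have hsz' : st z = 2 := by
        rw [hst' z hz] at hsz
        grind
      obtain ⟨h1, h2, h3, h4, h5, h6⟩ := h.odd z hz hsz'
      rw [hpar' z hz, if_neg hzy]
      refine ⟨hst1 _ (hmem z hz) h1, h2, h3, hst1 _ h3 h4, h5, ?_⟩
      have h7 := h.st_base _ h3 h4
      rw [hdep' _ (h.base_mem _ h3), hdep' _ (hmem z hz), if_neg, if_neg]
      · exact h6
      · intro h'
        rw [h'] at h1
        omega
      · intro h'
        rw [h'] at h7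
        omega
  · intro v hv h1 h2 h3
    by_cases hvm : v = mate y
    · rw [hvm, hinv y hy, hst' y hy, if_neg hmy.symm, if_pos rfl]
    · have h4 : st v = 1 := by
        rw [hst' v hv] at h1
        grind
      have h5 := h.mate_base v hv h4 h2 h3
      rw [hst' _ (hmem v hv), if_neg (fun h' => by rw [h'] at h5; omega),
        if_neg (fun h' => by rw [h'] at h5; omega), h5]
  · intro v hv h1
    rw [hst' v hv] at h1
    split_ifs at h1 with h2 h3
    have := h.free v hv h1
    rw [hst' _ (hmem v hv), if_neg fun h' => h3 (hinj' v hv h'),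
      if_neg fun h' => h2 (hinj v hv h'), this]

/-- The vertex sets visited by two walks towards the roots of a search forest, started in `x` and
`y` and having reached `p` and `q`. -/
structure SearchWalk (G : EdgeColoredGraph V E k) (vs : Finset V) (H : Finset E)
    (mate base : V → V) (st dep : V → ℕ) (x y p q : V) (U W : Finset V) : Prop where
  left : IsChain G H (st · = 1) U x p
  right : IsChain G H (st · = 1) W y q
  disj : ∀ v ∈ U, v ∉ W
  left_closed : ∀ v ∈ U, v ∈ vs ∧ st v ≠ 0 ∧ mate v ≠ v ∧ mate v ∈ U ∧
    ∀ w ∈ vs, base w = base v → w ∈ U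
  right_closed : ∀ v ∈ W, v ∈ vs ∧ st v ≠ 0 ∧ mate v ≠ v ∧ mate v ∈ W ∧
    ∀ w ∈ vs, base w = base v → w ∈ W
  left_mem : p ∈ vs
  right_mem : q ∈ vs
  st_left : st p = 1
  st_right : st q = 1
  depth : ∀ v, v ∈ U ∨ v ∈ W → st v = 1 →
    dep (base p) ≤ dep (base v) ∧ dep (base q) ≤ dep (base v)
  base_ne : ∀ v, v ∈ U ∨ v ∈ W → base v ≠ base p ∧ base v ≠ base q

theorem SearchWalk.symm {x y p q : V} {U W : Finset V}
    (h : SearchWalk G vs H mate base st dep x y p q U W) :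
    SearchWalk G vs H mate base st dep y x q p W U :=
  ⟨h.right, h.left, fun v hv hv' => h.disj v hv' hv, h.right_closed, h.left_closed, h.right_mem,
    h.left_mem, h.st_right, h.st_left, fun v hv hs => (h.depth v hv.symm hs).symm,
    fun v hv => (h.base_ne v hv.symm).symm⟩

theorem searchWalk_init {x y : V} (hx : x ∈ vs) (hy : y ∈ vs) (hsx : st x = 1) (hsy : st y = 1) :
    SearchWalk G vs H mate base st dep x y x y ∅ ∅ :=
  ⟨isChain_nil _ x, isChain_nil _ y, by simp, by simp, by simp, hx, hy, hsx, hsy, by simp,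
    by simp⟩

/-- The vertices visited when walking from `p` to the parent of its blossom. -/
def visited (vs : Finset V) (mate base : V → V) (p : V) : Finset V :=
  insert (mate (base p)) (baseClass vs base (base p))

/-- What one step visits is a union of base classes: the blossom of p and the singleton class of its
odd mate. Hence the program can record visited vertices by marking two bases only. -/
theorem SearchForest.mem_visited (hM : IsMate G vs M mate)
    (h : SearchForest G vs H mate base par st dep) {p v : V} (hp : p ∈ vs) (hs : st p = 1)
    (hroot : mate (base p) ≠ base p) (hv : v ∈ vs) :
    v ∈ visited vs mate base p ↔ base v = base p ∨ base v = mate (base p) := by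
  have hb := h.base_mem p hp
  have h2 := h.mate_base _ hb (h.st_base p hp hs) (h.base_base p hp) hroot
  have h3 : base (mate (base p)) = mate (base p) :=
    h.base_of_ne _ (hM.mem _ hb) (by omega)
  rw [visited, Finset.mem_insert, mem_baseClass]
  refine ⟨?_, ?_⟩
  · rintro (rfl | h')
    · exact Or.inr h3
    · exact Or.inl h'.2
  · rintro (h' | h')
    · exact Or.inr ⟨hv, h'⟩
    · left
      by_cases hs : st v = 1
      · have := h.st_base v hv hs
        rw [h'] at this
        omega
      · rwa [h.base_of_ne v hv hs] at h'

/-- The mate of a non-root base is odd, and its parent lies in a blossom of strictly smaller depth,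
which is impossible at depth 0. -/
theorem SearchForest.root_of_dep_eq_zero (hM : IsMate G vs M mate)
    (h : SearchForest G vs H mate base par st dep) {p : V} (hp : p ∈ vs) (hs : st p = 1)
    (hd : dep (base p) = 0) : mate (base p) = base p := by
  by_contra hroot
  have hb := h.base_mem p hp
  have h2 := h.mate_base _ hb (h.st_base p hp hs) (h.base_base p hp) hroot
  have h3 := h.odd _ (hM.mem _ hb) h2
  rw [hM.invol _ hb] at h3
  omega

/-- The walk whose current blossom is at least as deep as the other one moves on. This keeps both
current depths below or equal to the depths of all visited blossoms, so neither walk can enter a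
blossom that was visited before; the chains therefore stay disjoint until the walks reach a common
blossom. -/
theorem SearchWalk.step (hM : IsMate G vs M mate) (hMH : M ⊆ H)
    (h : SearchForest G vs H mate base par st dep) {x y p q : V} {U W : Finset V}
    (hw : SearchWalk G vs H mate base st dep x y p q U W) (hpq : base p ≠ base q)
    (hdep : dep (base q) ≤ dep (base p)) (hroot : mate (base p) ≠ base p) :
    SearchWalk G vs H mate base st dep x y (par (mate (base p))) q
      (visited vs mate base p ∪ U) W := by
  have hp := hw.left_mem
  have hb := h.base_mem p hp
  have hbb := h.base_base p hp
  have hsb := h.st_base p hp hw.st_left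
  have hy := hM.mem _ hb
  have hsy := h.mate_base _ hb hsb hbb hroot
  have hby : base (mate (base p)) = mate (base p) := h.base_of_ne _ hy (by omega)
  obtain ⟨-, -, hq', hsq', ⟨f, hf, hfj⟩, hd⟩ := h.odd _ hy hsy
  rw [hM.invol _ hb] at hd
  obtain ⟨e, he, hej⟩ := hM.joins _ hb hroot
  have hsK : ∀ v ∈ baseClass vs base (base p), st v = 1 := by
    intro v hv
    rw [mem_baseClass] at hv
    exact h.st_of_base hv.1 (by rw [hv.2, hsb])
  have hsbq' := h.st_base _ hq' hsq'
  -- A visited parent blossom would be at least as deep as that of p, but depth drops strictly from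
  -- p to its parent.
  have hq'UW : ∀ v, v ∈ U ∨ v ∈ W → base v ≠ base (par (mate (base p))) := by
    intro v hv hbv
    have hmem : par (mate (base p)) ∈ U ∨ par (mate (base p)) ∈ W := by
      rcases hv with hv | hv
      · exact Or.inl ((hw.left_closed v hv).2.2.2.2 _ hq' hbv.symm)
      · exact Or.inr ((hw.right_closed v hv).2.2.2.2 _ hq' hbv.symm)
    have := (hw.depth _ hmem hsq').1
    omega
  have hyU : mate (base p) ∉ U := fun hyU => by
    have h1 := (hw.left_closed _ hyU).2.2.2.1
    rw [hM.invol _ hb] at h1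
    exact (hw.base_ne _ (Or.inl h1)).1 hbb
  have hyW : mate (base p) ∉ W := fun hyW => by
    have h1 := (hw.right_closed _ hyW).2.2.2.1
    rw [hM.invol _ hb] at h1
    exact (hw.base_ne _ (Or.inr h1)).1 hbb
  have hKU : ∀ v ∈ baseClass vs base (base p), v ∉ U := by
    intro v hv hvU
    rw [mem_baseClass] at hv
    exact (hw.base_ne v (Or.inl hvU)).1 hv.2
  have hKW : ∀ v ∈ baseClass vs base (base p), v ∉ W := by
    intro v hv hvW
    rw [mem_baseClass] at hv
    exact (hw.base_ne v (Or.inr hvW)).1 hv.2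
  have hset : visited vs mate base p ∪ U
      = insert (mate (base p)) (baseClass vs base (base p) ∪ U) := by
    simp [visited]
  rw [hset]
  refine ⟨?_, hw.right, ?_, ?_, hw.right_closed, hq', hw.right_mem, hsq', hw.st_right, ?_, ?_⟩
  · refine hw.left.snoc (h.critical _ hb hbb hsb) (mem_baseClass.2 ⟨hp, rfl⟩)
      (mem_baseClass.2 ⟨hb, hbb⟩) hsK (by omega) (hMH he) hej hf hfj hKU hyU
      (fun h' => hq'UW _ (Or.inl h') rfl) ?_ ?_
    · rw [mem_baseClass]
      rintro ⟨-, h'⟩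
      rw [h'] at hd
      omega
    · intro h'
      rw [h'] at hsq'
      omega
  · intro v hv
    simp only [Finset.mem_insert, Finset.mem_union] at hv
    rcases hv with rfl | hv | hv
    · exact hyW
    · exact hKW v hv
    · exact hw.disj v hv
  · intro v hv
    simp only [Finset.mem_insert, Finset.mem_union] at hv
    rcases hv with rfl | hv | hv
    · refine ⟨hy, by omega, fun h' => ?_, ?_, ?_⟩
      · rw [hM.invol _ hb] at h'
        exact hroot h'.symm
      · rw [hM.invol _ hb]
        simp [mem_baseClass, hb, hbb]
      · intro w hwv hbw
        rw [hby] at hbw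
        have := (h.mem_visited hM hp hw.st_left hroot hwv).2 (Or.inr hbw)
        rw [visited] at this
        grind
    · have hv' := mem_baseClass.1 hv
      have hsv := hsK v hv
      by_cases hvb : v = base p
      · subst hvb
        refine ⟨hb, by omega, hroot, by simp, fun w hwv hbw => ?_⟩
        simp [mem_baseClass, hwv, hbw, hbb]
      · have hne : base v ≠ v := by rw [hv'.2]; exact fun h => hvb h.symm
        refine ⟨hv'.1, by omega, fun h' => hne (h.exposed v hv'.1 h').2.1, ?_, ?_⟩
        · have := h.mate_closed v hv'.1 hne
          simp [mem_baseClass, hM.mem v hv'.1, this, hv'.2]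
        · intro w hwv hbw
          simp [mem_baseClass, hwv, hbw, hv'.2]
    · obtain ⟨h1, h2, h3, h4, h5⟩ := hw.left_closed v hv
      exact ⟨h1, h2, h3, by simp [h4], fun w hwv hbw => by simp [h5 w hwv hbw]⟩
  · intro v hv hsv
    simp only [Finset.mem_insert, Finset.mem_union] at hv
    rcases hv with (rfl | hv | hv) | hv
    · omega
    · rw [(mem_baseClass.1 hv).2]
      exact ⟨hd.le, hdep⟩
    · have := hw.depth v (Or.inl hv) hsv
      omega
    · have := hw.depth v (Or.inr hv) hsv
      omega
  · intro v hv
    simp only [Finset.mem_insert, Finset.mem_union] at hv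
    rcases hv with (rfl | hv | hv) | hv
    · rw [hby]
      refine ⟨fun h' => ?_, fun h' => ?_⟩
      · rw [← h'] at hsbq'
        omega
      · have := h.st_base q hw.right_mem hw.st_right
        rw [← h'] at this
        omega
    · rw [(mem_baseClass.1 hv).2]
      exact ⟨fun h' => by rw [← h'] at hd; omega, hpq⟩
    · exact ⟨hq'UW v (Or.inl hv), (hw.base_ne v (Or.inl hv)).2⟩
    · exact ⟨hq'UW v (Or.inr hv), (hw.base_ne v (Or.inr hv)).2⟩

end Search

end EdgeColoredGraph

/-! ### Shrinking, augmentation, and the certificate of optimality -/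

namespace EdgeColoredGraph

section SearchSteps

variable {V E : Type*} [DecidableEq V] [DecidableEq E] {k : ℕ} {G : EdgeColoredGraph V E k}
  {vs : Finset V} {H M : Finset E} {mate base par base' par' : V → V} {st dep st' dep' : V → ℕ}

/-- Shrinking a blossom. -/
theorem SearchForest.merge (hM : IsMate G vs M mate)
    (h : SearchForest G vs H mate base par st dep) {x y p q l : V} {U W : Finset V} {e : E}
    (hw : SearchWalk G vs H mate base st dep x y p q U W) (he : e ∈ H) (hxy : G.Joins e x y)
    (hp : base p = l) (hq : base q = l)
    (hbase' : ∀ v ∈ vs, base' v = if v ∈ U ∪ W then l else base v)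
    (hst' : ∀ v ∈ vs, st' v = if v ∈ U ∪ W then 1 else st v) :
    SearchForest G vs H mate base' par st' dep := by
  have hmem := hM.mem
  have hinv := hM.invol
  have hl : l ∈ vs := hp ▸ h.base_mem p hw.left_mem
  have hbl : base l = l := by rw [← hp, h.base_base p hw.left_mem]
  have hsl : st l = 1 := by rw [← hp]; exact h.st_base p hw.left_mem hw.st_left
  have hcl : ∀ v ∈ U ∪ W, v ∈ vs ∧ st v ≠ 0 ∧ mate v ≠ v ∧ mate v ∈ U ∪ W ∧
      ∀ w ∈ vs, base w = base v → w ∈ U ∪ W := by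
    intro v hv
    have h1 := hw.left_closed v
    have h2 := hw.right_closed v
    grind
  have hne : ∀ v ∈ U ∪ W, base v ≠ l := by
    intro v hv
    rw [← hp]
    exact (hw.base_ne v (Finset.mem_union.1 hv)).1
  -- This is why depths need no update: a parent pointer into an absorbed blossom now leads to the
  -- base l, which is no deeper than that blossom was.
  have hdl : ∀ v ∈ U ∪ W, st v = 1 → dep l ≤ dep (base v) := by
    intro v hv hs
    rw [← hp]
    exact (hw.depth v (Finset.mem_union.1 hv) hs).1
  have hlUW : l ∉ U ∪ W := fun hl' => hne l hl' hbl
  have hmate : ∀ v ∈ vs, v ∉ U ∪ W → mate v ∉ U ∪ W := by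
    intro v hv hvU hmv
    have := (hcl _ hmv).2.2.2.1
    rw [hinv v hv] at this
    exact hvU this
  have hbaseUW : ∀ v ∈ vs, v ∉ U ∪ W → base v ∉ U ∪ W := by
    intro v hv hvU hbv
    exact hvU ((hcl _ hbv).2.2.2.2 v hv (h.base_base v hv).symm)
  have hin : ∀ v ∈ vs, v ∈ U ∪ W → base' v = l ∧ st' v = 1 := by
    intro v hv hvU
    rw [hbase' v hv, hst' v hv, if_pos hvU, if_pos hvU]
    exact ⟨rfl, rfl⟩
  have hout : ∀ v ∈ vs, v ∉ U ∪ W → base' v = base v ∧ st' v = st v := by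
    intro v hv hvU
    rw [hbase' v hv, hst' v hv, if_neg hvU, if_neg hvU]
    exact ⟨rfl, rfl⟩
  clear hbase' hst'
  obtain ⟨hbl', hsl'⟩ := hout l hl hlUW
  rw [hbl] at hbl'
  rw [hsl] at hsl'
  refine ⟨?_, ?_, ?_, ?_, ?_, ?_, ?_, ?_, ?_, ?_, ?_⟩
  · intro v hv
    by_cases hvU : v ∈ U ∪ W
    · exact Or.inr (Or.inl (hin v hv hvU).2)
    · rw [(hout v hv hvU).2]
      exact h.st_cases v hv
  · intro v hv hvm
    have hvU : v ∉ U ∪ W := fun hvU => (hcl v hvU).2.2.1 hvm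
    rw [(hout v hv hvU).1, (hout v hv hvU).2]
    exact h.exposed v hv hvm
  · intro v hv
    by_cases hvU : v ∈ U ∪ W
    · rw [(hin v hv hvU).1]
      exact hl
    · rw [(hout v hv hvU).1]
      exact h.base_mem v hv
  · intro v hv
    by_cases hvU : v ∈ U ∪ W
    · rw [(hin v hv hvU).1, hbl']
    · rw [(hout v hv hvU).1, (hout _ (h.base_mem v hv) (hbaseUW v hv hvU)).1, h.base_base v hv]
  · intro v hv hs
    by_cases hvU : v ∈ U ∪ W
    · rw [(hin v hv hvU).1, hsl']
    · rw [(hout v hv hvU).2] at hs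
      rw [(hout v hv hvU).1, (hout _ (h.base_mem v hv) (hbaseUW v hv hvU)).2]
      exact h.st_base v hv hs
  · intro v hv hs
    by_cases hvU : v ∈ U ∪ W
    · exact absurd (hin v hv hvU).2 hs
    · rw [(hout v hv hvU).2] at hs
      rw [(hout v hv hvU).1]
      exact h.base_of_ne v hv hs
  · intro b hb hbb hs
    by_cases hbU : b ∈ U ∪ W
    · rw [(hin b hb hbU).1] at hbb
      exact absurd (hbb ▸ hbU) hlUW
    rw [(hout b hb hbU).1] at hbb
    rw [(hout b hb hbU).2] at hs
    by_cases hbl : b = l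
    · have hset : baseClass vs base' b = U ∪ W ∪ baseClass vs base l := by
        ext v
        rw [mem_baseClass, Finset.mem_union, mem_baseClass]
        by_cases hvU : v ∈ U ∪ W
        · simp only [hvU, true_or, iff_true]
          exact ⟨(hcl v hvU).1, by rw [(hin v (hcl v hvU).1 hvU).1, hbl]⟩
        · simp only [hvU, false_or, hbl]
          refine and_congr_right fun hv => ?_
          rw [(hout v hv hvU).1]
      rw [hset]
      refine hw.left.factorCritical hw.right (h.critical l hl (hbl ▸ hbb) hsl)
        (mem_baseClass.2 ⟨hw.left_mem, hp⟩) (mem_baseClass.2 ⟨hw.right_mem, hq⟩) he hxy hw.disj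
        ?_ ?_
      · intro v hv hv'
        exact hne v (Finset.mem_union_left _ hv) (mem_baseClass.1 hv').2
      · intro v hv hv'
        exact hne v (Finset.mem_union_right _ hv) (mem_baseClass.1 hv').2
    · have hset : baseClass vs base' b = baseClass vs base b := by
        ext v
        rw [mem_baseClass, mem_baseClass]
        refine and_congr_right fun hv => ?_
        by_cases hvU : v ∈ U ∪ W
        · rw [(hin v hv hvU).1]
          refine ⟨fun h' => absurd h'.symm hbl, fun h' => ?_⟩
          exact absurd ((hcl v hvU).2.2.2.2 b hb (by rw [hbb, h'])) hbU
        · rw [(hout v hv hvU).1]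
      rw [hset]
      exact h.critical b hb hbb hs
  · intro v hv hbv
    by_cases hvU : v ∈ U ∪ W
    · rw [(hin v hv hvU).1, (hin _ (hmem v hv) (hcl v hvU).2.2.2.1).1]
    · rw [(hout v hv hvU).1] at hbv
      rw [(hout v hv hvU).1, (hout _ (hmem v hv) (hmate v hv hvU)).1]
      exact h.mate_closed v hv hbv
  · intro y hy hsy
    have hyU : y ∉ U ∪ W := fun hyU => by
      rw [(hin y hy hyU).2] at hsy
      omega
    rw [(hout y hy hyU).2] at hsy
    obtain ⟨h1, h2, h3, h4, h5, h6⟩ := h.odd y hy hsy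
    rw [(hout _ (hmem y hy) (hmate y hy hyU)).1, (hout _ (hmem y hy) (hmate y hy hyU)).2]
    refine ⟨h1, h2, h3, ?_, h5, ?_⟩
    · by_cases hpU : par y ∈ U ∪ W
      · exact (hin _ h3 hpU).2
      · rw [(hout _ h3 hpU).2, h4]
    · by_cases hpU : par y ∈ U ∪ W
      · rw [(hin _ h3 hpU).1]
        exact (hdl _ hpU h4).trans_lt h6
      · rw [(hout _ h3 hpU).1]
        exact h6
  · intro v hv hs hbv hmv
    by_cases hvU : v ∈ U ∪ W
    · rw [(hin v hv hvU).1] at hbv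
      exact absurd (hbv ▸ hvU) hlUW
    · rw [(hout v hv hvU).1] at hbv
      rw [(hout v hv hvU).2] at hs
      rw [(hout _ (hmem v hv) (hmate v hv hvU)).2]
      exact h.mate_base v hv hs hbv hmv
  · intro v hv hs
    by_cases hvU : v ∈ U ∪ W
    · rw [(hin v hv hvU).2] at hs
      omega
    · rw [(hout v hv hvU).2] at hs
      rw [(hout _ (hmem v hv) (hmate v hv hvU)).2]
      exact h.free v hv hs

theorem IsMate.mem_cover (hM : IsMate G vs M mate) {v : V} (hv : v ∈ vs) :
    v ∈ G.cover M ↔ mate v ≠ v := by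
  rw [EdgeColoredGraph.mem_cover]
  constructor
  · rintro ⟨e, he, hev⟩ hmv
    obtain ⟨h1, h2⟩ := hM.of_mem e he
    rcases hev with rfl | rfl
    · exact G.fst_ne_snd e (hmv.symm.trans h1)
    · exact G.fst_ne_snd e (h2.symm.trans hmv)
  · intro h
    obtain ⟨e, he, hj⟩ := hM.joins v hv h
    exact ⟨e, he, hj.incident_iff.2 (Or.inl rfl)⟩

theorem cover_subset (hH : ∀ e ∈ H, G.fst e ∈ vs ∧ G.snd e ∈ vs) {N : Finset E} (hN : N ⊆ H) :
    G.cover N ⊆ vs := by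
  intro v hv
  obtain ⟨e, he, rfl | rfl⟩ := (EdgeColoredGraph.mem_cover G).1 hv
  · exact (hH e (hN he)).1
  · exact (hH e (hN he)).2

/-- Walks from adjacent vertices to different roots yield a larger matching. -/
theorem SearchForest.exists_larger (hM : IsMate G vs M mate) (hMM : G.IsMatching M) (hMH : M ⊆ H)
    (hH : ∀ e ∈ H, G.fst e ∈ vs ∧ G.snd e ∈ vs)
    (h : SearchForest G vs H mate base par st dep) {x y p q : V} {U W : Finset V} {e : E}
    (hw : SearchWalk G vs H mate base st dep x y p q U W) (he : e ∈ H) (hxy : G.Joins e x y)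
    (hp : mate (base p) = base p) (hq : mate (base q) = base q) (hpq : base p ≠ base q) :
    ∃ N ⊆ H, G.IsMatching N ∧ M.card < N.card := by
  have hpm := h.base_mem p hw.left_mem
  have hqm := h.base_mem q hw.right_mem
  have hsp := h.st_base p hw.left_mem hw.st_left
  have hsq := h.st_base q hw.right_mem hw.st_right
  have hbp := h.base_base p hw.left_mem
  have hbq := h.base_base q hw.right_mem
  have hne : ∀ v ∈ U ∪ W, v ∉ baseClass vs base (base p) ∧ v ∉ baseClass vs base (base q) := by
    intro v hv
    have := hw.base_ne v (Finset.mem_union.1 hv)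
    exact ⟨fun h' => this.1 (mem_baseClass.1 h').2, fun h' => this.2 (mem_baseClass.1 h').2⟩
  obtain ⟨N, hNH, hN, hNc⟩ := hw.left.perfectOn hw.right (h.critical _ hpm hbp hsp)
    (h.critical _ hqm hbq hsq) (mem_baseClass.2 ⟨hw.left_mem, rfl⟩)
    (mem_baseClass.2 ⟨hw.right_mem, rfl⟩) he hxy hw.disj
    (fun v hv => (hne v (Finset.mem_union_left _ hv)).1)
    (fun v hv => (hne v (Finset.mem_union_left _ hv)).2)
    (fun v hv => (hne v (Finset.mem_union_right _ hv)).1)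
    (fun v hv => (hne v (Finset.mem_union_right _ hv)).2)
    (fun v hv hv' => hpq ((mem_baseClass.1 hv).2.symm.trans (mem_baseClass.1 hv').2))
  -- Z is closed under `mate`, so M splits into edges inside Z and edges disjoint from Z; only the
  -- former are replaced by N.
  set Z := U ∪ W ∪ (baseClass vs base (base p) ∪ baseClass vs base (base q)) with hZ
  have hZvs : Z ⊆ vs := hNc ▸ cover_subset hH hNH
  have hclass : ∀ b v, mate b = b → v ∈ baseClass vs base b → mate v ∈ baseClass vs base b := by
    intro b v hb hv
    have hv' := mem_baseClass.1 hv
    by_cases hvb : base v = v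
    · obtain rfl : v = b := hvb.symm.trans hv'.2
      rwa [hb]
    · exact mem_baseClass.2 ⟨hM.mem v hv'.1, by rw [h.mate_closed v hv'.1 hvb, hv'.2]⟩
  have hZm : ∀ v ∈ Z, mate v ∈ Z := by
    intro v hv
    simp only [hZ, Finset.mem_union] at hv ⊢
    rcases hv with (hv | hv) | hv | hv
    · exact Or.inl (Or.inl (hw.left_closed v hv).2.2.2.1)
    · exact Or.inl (Or.inr (hw.right_closed v hv).2.2.2.1)
    · exact Or.inr (Or.inl (hclass _ v hp hv))
    · exact Or.inr (Or.inr (hclass _ v hq hv))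
  set M' := M.filter (G.fst · ∉ Z) with hM'
  have hM'Z : ∀ f ∈ M', ∀ v, G.Incident f v → v ∉ Z := by
    intro f hf v hfv hvZ
    obtain ⟨hfM, hfZ⟩ := Finset.mem_filter.1 hf
    rcases hfv with rfl | rfl
    · exact hfZ hvZ
    · have := hZm _ hvZ
      rw [(hM.of_mem f hfM).2] at this
      exact hfZ this
  have hdisj : ∀ v ∈ G.cover N, v ∉ G.cover M' := by
    intro v hv hv'
    obtain ⟨f, hf, hfv⟩ := (EdgeColoredGraph.mem_cover G).1 hv'
    exact hM'Z f hf v hfv (hNc ▸ hv)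
  have hNM : G.IsMatching (N ∪ M') := hN.union (hMM.subset (Finset.filter_subset _ _)) hdisj
  refine ⟨N ∪ M', Finset.union_subset hNH ((Finset.filter_subset _ _).trans hMH), hNM, ?_⟩
  -- The new matching still covers everything that M covers and in addition the two exposed roots,
  -- so it has at least one edge more.
  have hsub : insert (base p) (insert (base q) (G.cover M)) ⊆ G.cover (N ∪ M') := by
    intro v hv
    have hcov : v ∈ Z → v ∈ G.cover (N ∪ M') := by
      intro hvZ
      rw [← hNc, EdgeColoredGraph.mem_cover] at hvZ
      obtain ⟨f, hf, hfv⟩ := hvZ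
      exact (EdgeColoredGraph.mem_cover G).2 ⟨f, Finset.mem_union_left _ hf, hfv⟩
    simp only [Finset.mem_insert] at hv
    rcases hv with rfl | rfl | hv
    · exact hcov (by simp [hZ, mem_baseClass, hpm, hbp])
    · exact hcov (by simp [hZ, mem_baseClass, hqm, hbq])
    · by_cases hvZ : v ∈ Z
      · exact hcov hvZ
      · obtain ⟨f, hf, hfv⟩ := (EdgeColoredGraph.mem_cover G).1 hv
        refine (EdgeColoredGraph.mem_cover G).2 ⟨f, Finset.mem_union_right _ ?_, hfv⟩
        refine Finset.mem_filter.2 ⟨hf, fun hfZ => ?_⟩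
        rcases hfv with rfl | rfl
        · exact hvZ hfZ
        · have := hZm _ hfZ
          rw [(hM.of_mem f hf).1] at this
          exact hvZ this
  have hcard := Finset.card_le_card hsub
  rw [Finset.card_insert_of_notMem, Finset.card_insert_of_notMem, hMM.card_cover,
    hNM.card_cover] at hcard
  · omega
  · rw [hM.mem_cover hqm]
    exact fun h' => h' hq
  · rw [Finset.mem_insert, hM.mem_cover hpm]
    rintro (h' | h')
    · exact hpq h'
    · exact h' hp

/-- A search forest that cannot be extended certifies that the matching is maximum. -/
theorem SearchForest.card_le (hM : IsMate G vs M mate) (hMM : G.IsMatching M) (hMH : M ⊆ H)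
    (hH : ∀ e ∈ H, G.fst e ∈ vs ∧ G.snd e ∈ vs)
    (h : SearchForest G vs H mate base par st dep)
    (hstuck : ∀ e ∈ H, ∀ x y, G.Joins e x y → st x = 1 →
      st y ≠ 0 ∧ (st y = 1 → base x = base y)) {N : Finset E} (hN : G.IsMatching N)
    (hNH : N ⊆ H) : N.card ≤ M.card := by
  set B := vs.filter fun b => base b = b ∧ st b = 1 with hB
  set O := vs.filter fun y => st y = 2 with hO
  have hMvs := cover_subset hH hMH
  have hNvs := cover_subset hH hNH
  -- Exposed vertices and mates of odd vertices are distinct blossom bases. Together with `hupper`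
  -- this compares the numbers of vertices left exposed by M and by N.
  have hlower : (vs \ G.cover M).card + O.card ≤ B.card := by
    have himg : (O.image mate).card = O.card := by
      refine Finset.card_image_of_injOn fun y hy y' hy' hyy' => ?_
      rw [← hM.invol y (Finset.mem_filter.1 hy).1, hyy',
        hM.invol y' (Finset.mem_filter.1 hy').1]
    rw [← himg, ← Finset.card_union_of_disjoint]
    · refine Finset.card_le_card fun v hv => ?_
      rcases Finset.mem_union.1 hv with hv | hv
      · obtain ⟨hv1, hv2⟩ := Finset.mem_sdiff.1 hv
        rw [hM.mem_cover hv1, not_not] at hv2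
        have := h.exposed v hv1 hv2
        exact Finset.mem_filter.2 ⟨hv1, this.2.1, this.1⟩
      · obtain ⟨y, hy, rfl⟩ := Finset.mem_image.1 hv
        obtain ⟨hy1, hy2⟩ := Finset.mem_filter.1 hy
        have := h.odd y hy1 hy2
        exact Finset.mem_filter.2 ⟨hM.mem y hy1, this.2.1, this.1⟩
    · rw [Finset.disjoint_left]
      intro v hv hv'
      obtain ⟨y, hy, rfl⟩ := Finset.mem_image.1 hv'
      obtain ⟨hy1, hy2⟩ := Finset.mem_filter.1 hy
      obtain ⟨hv1, hv2⟩ := Finset.mem_sdiff.1 hv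
      rw [hM.mem_cover hv1, not_not, hM.invol y hy1] at hv2
      have := (h.odd y hy1 hy2).1
      rw [← hv2] at this
      omega
  -- A blossom has an odd number of vertices, so N either misses one of them or has an edge leaving
  -- the blossom. By `hstuck` such an edge ends in an odd vertex of the forest.
  have hex : ∀ b ∈ B, ∃ w, w ∈ (vs \ G.cover N) ∪ O ∧
      ((w ∉ G.cover N ∧ base w = b) ∨
        (st w = 2 ∧ ∃ e ∈ N, ∃ v ∈ baseClass vs base b, G.Joins e v w)) := by
    intro b hb
    obtain ⟨hb1, hb2, hb3⟩ := Finset.mem_filter.1 hb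
    by_contra hcon
    push Not at hcon
    have hbc : b ∈ baseClass vs base b := mem_baseClass.2 ⟨hb1, hb2⟩
    have hcov : ∀ v ∈ baseClass vs base b, v ∈ G.cover N := by
      intro v hv
      obtain ⟨hv1, hv2⟩ := mem_baseClass.1 hv
      by_contra hvN
      exact (hcon v (by simp [hv1, hvN])).1 hvN hv2
    have hout : ∀ e ∈ N, ∀ v w, G.Joins e v w → v ∈ baseClass vs base b →
        w ∈ baseClass vs base b := by
      intro e he v w hvw hv
      obtain ⟨hv1, hv2⟩ := mem_baseClass.1 hv
      have hw : w ∈ vs := by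
        have := hH e (hNH he)
        rcases hvw with ⟨-, h'⟩ | ⟨h', -⟩
        · exact h' ▸ this.2
        · exact h' ▸ this.1
      have hsv := h.st_of_base hv1 (by rw [hv2, hb3])
      obtain ⟨h1, h2⟩ := hstuck e (hNH he) v w hvw hsv
      rcases h.st_cases w hw with h3 | h3 | h3
      · exact absurd h3 h1
      · exact mem_baseClass.2 ⟨hw, by rw [← h2 h3, hv2]⟩
      · exact absurd hvw ((hcon w (by simp [hO, hw, h3])).2 h3 e he v hv)
    have hPM : G.PerfectOn H (baseClass vs base b) := by
      refine ⟨N.filter (G.fst · ∈ baseClass vs base b), (Finset.filter_subset _ _).trans hNH,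
        hN.subset (Finset.filter_subset _ _), ?_⟩
      ext v
      rw [EdgeColoredGraph.mem_cover]
      constructor
      · rintro ⟨e, he, rfl | rfl⟩
        · exact (Finset.mem_filter.1 he).2
        · exact hout e (Finset.mem_filter.1 he).1 _ _ (Or.inl ⟨rfl, rfl⟩)
            (Finset.mem_filter.1 he).2
      · intro hv
        obtain ⟨e, he, hev⟩ := (EdgeColoredGraph.mem_cover G).1 (hcov v hv)
        refine ⟨e, Finset.mem_filter.2 ⟨he, ?_⟩, hev⟩
        rcases hev with rfl | rfl
        · exact hv
        · exact hout e he _ _ (Or.inr ⟨rfl, rfl⟩) hv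
    -- Otherwise N matches the blossom within itself, so its size is even; but factor-criticality
    -- makes it even after deleting b.
    have h1 := hPM.even_card
    have h2 := (h.critical b hb1 hb2 hb3 b hbc).even_card
    have h3 := Finset.card_erase_add_one hbc
    rw [← h3] at h1
    exact (Nat.not_even_iff_odd.2 h2.add_one) h1
  choose! f hf1 hf2 using hex
  -- The chosen witnesses are distinct: a missed vertex determines its blossom, and an odd vertex
  -- has at most one N-edge and thus at most one N-neighbor.
  have hupper : B.card ≤ (vs \ G.cover N).card + O.card := by
    refine le_trans ?_ (Finset.card_union_le _ _)
    refine Finset.card_le_card_of_injOn f hf1 ?_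
    intro b hb b' hb' hbb'
    have h1 := hf2 b hb
    have h2 := hf2 b' hb'
    rw [← hbb'] at h2
    have hcov : ∀ {e v w}, e ∈ N → G.Joins e v w → w ∈ G.cover N := fun he hj =>
      (EdgeColoredGraph.mem_cover G).2 ⟨_, he, hj.incident_iff.2 (Or.inr rfl)⟩
    rcases h1 with ⟨h1, h1'⟩ | ⟨h1, e, he, v, hv, hj⟩ <;>
      rcases h2 with ⟨h2, h2'⟩ | ⟨h2, e', he', v', hv', hj'⟩
    · exact h1'.symm.trans h2'
    · exact absurd (hcov he' hj') h1
    · exact absurd (hcov he hj) h2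
    · have hee : e = e' := hN (f b) e he e' he' (hj.incident_iff.2 (Or.inr rfl))
        (hj'.incident_iff.2 (Or.inr rfl))
      subst hee
      have hvv : v = v' := by
        unfold Joins at hj hj'
        have := G.fst_ne_snd e
        grind
      subst hvv
      exact (mem_baseClass.1 hv).2.symm.trans (mem_baseClass.1 hv').2
  have h1 := Finset.card_sdiff_add_card_eq_card hMvs
  have h2 := Finset.card_sdiff_add_card_eq_card hNvs
  rw [hMM.card_cover] at h1
  rw [hN.card_cover] at h2
  omega

/-- The number of steps by which the search forest can still be extended is at most this. -/
def potential (vs : Finset V) (base : V → V) (st : V → ℕ) : ℕ :=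
  (vs.filter (st · = 0)).card + (vs.filter fun v => base v = v).card

theorem potential_le : potential vs base st ≤ 2 * vs.card := by
  have h1 := Finset.card_filter_le vs (st · = 0)
  have h2 := Finset.card_filter_le vs (fun v => base v = v)
  unfold potential
  omega

theorem potential_grow {y : V} (hy : y ∈ vs) (hsy : st y = 0) (hsy' : st' y ≠ 0)
    (hst' : ∀ v ∈ vs, st' v = 0 → st v = 0) :
    potential vs base st' < potential vs base st := by
  refine Nat.add_lt_add_right (Finset.card_lt_card ?_) _
  rw [Finset.ssubset_iff_of_subset]
  · exact ⟨y, by simp [hy, hsy], by simp [hsy']⟩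
  · intro v hv
    simp only [Finset.mem_filter] at hv ⊢
    exact ⟨hv.1, hst' v hv.1 hv.2⟩

/-- The absorbed base b stops being its own base, and no vertex becomes one because the new base l
is outside of Z. -/
theorem potential_merge {b l : V} {Z : Finset V} (hb : b ∈ Z) (hbvs : b ∈ vs) (hbb : base b = b)
    (hl : l ∉ Z) (hbase' : ∀ v ∈ vs, base' v = if v ∈ Z then l else base v)
    (hst' : ∀ v ∈ vs, st' v = if v ∈ Z then 1 else st v) :
    potential vs base' st' < potential vs base st := by
  refine Nat.add_lt_add_of_le_of_lt (Finset.card_le_card ?_) (Finset.card_lt_card ?_)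
  · intro v hv
    simp only [Finset.mem_filter] at hv ⊢
    have := hst' v hv.1
    grind
  · rw [Finset.ssubset_iff_of_subset]
    · refine ⟨b, by simp [hbb, hbvs], ?_⟩
      have := hbase' b hbvs
      grind
    · intro v hv
      simp only [Finset.mem_filter] at hv ⊢
      have := hbase' v hv.1
      grind

end SearchSteps

end EdgeColoredGraph

/-! ### Programs with counting loops: semantics, running time, invariants -/

namespace Ram

theorem Store.write_self (s : Store) (a i x : ℕ) :
    s.write a i x a = Function.update (s a) i x := by
  simp [Store.write]

theorem Store.write_of_ne (s : Store) {a b : ℕ} (i x : ℕ) (h : b ≠ a) :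
    s.write a i x b = s b := by
  simp [Store.write, h]

attribute [simp] Expr.eval Store.write_self Store.write_of_ne

/-- The value of a scalar, stored in cell `0` of its own array. -/
abbrev Expr.var (a : ℕ) : Expr := .read a (.const 0)

/-- Truth values are represented by `1` and `0`. -/
def Expr.not (x : Expr) : Expr := .sub (.const 1) x

def Expr.le (x y : Expr) : Expr := .not (.sub x y)

def Expr.eq (x y : Expr) : Expr := .not (.add (.sub x y) (.sub y x))

def Expr.and (x y : Expr) : Expr := .not (.add (.not x) (.not y))

@[simp] theorem Expr.eval_not (s : Store) (x : Expr) :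
    x.not.eval s = if x.eval s = 0 then 1 else 0 := by
  simp only [Expr.not, Expr.eval]; split_ifs <;> omega

@[simp] theorem Expr.eval_le (s : Store) (x y : Expr) :
    (x.le y).eval s = if x.eval s ≤ y.eval s then 1 else 0 := by
  simp only [Expr.le, Expr.eval_not, Expr.eval, Nat.sub_eq_zero_iff_le]

@[simp] theorem Expr.eval_eq (s : Store) (x y : Expr) :
    (x.eq y).eval s = if x.eval s = y.eval s then 1 else 0 := by
  simp only [Expr.eq, Expr.eval_not, Expr.eval]
  exact if_congr (by omega) rfl rfl

@[simp] theorem Expr.eval_and (s : Store) (x y : Expr) :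
    (x.and y).eval s = if x.eval s ≠ 0 ∧ y.eval s ≠ 0 then 1 else 0 := by
  simp only [Expr.and, Expr.eval_not, Expr.eval]; split_ifs <;> simp_all

/-- Programs all of whose loops are counting loops: `loop c b p` runs `p` with the values
`0, 1, …` of the counter in cell `0` of array `c`, as many times as cell `b` of array `0` says. -/
inductive Cmd where
  | skip
  | write (a : ℕ) (i x : Expr)
  | seq (p q : Cmd)
  | ite (b : Expr) (p q : Cmd)
  | loop (c b : ℕ) (p : Cmd)

namespace Cmd

/-- The store before the `i`-th iteration of a counting loop with body `f`. -/
def iterate (f : Store → Store) (c : ℕ) (s : Store) : ℕ → Store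
  | 0 => s.write c 0 0
  | i + 1 => (f (iterate f c s i)).write c 0 (i + 1)

/-- The store after running a program. -/
def run : Cmd → Store → Store
  | skip, s => s
  | write a i x, s => s.write a (i.eval s) (x.eval s)
  | seq p q, s => q.run (p.run s)
  | ite b p q, s => if b.eval s ≠ 0 then p.run s else q.run s
  | loop c b p, s => iterate p.run c s (s 0 b)

/-- The arrays to which a program writes. -/
def writes : Cmd → List ℕ
  | skip => []
  | write a _ _ => [a]
  | seq p q => p.writes ++ q.writes
  | ite _ p q => p.writes ++ q.writes
  | loop c _ p => c :: p.writes

/-- Loop bounds and active loop counters are not written to. -/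
def WF : Cmd → Prop
  | skip => True
  | write a _ _ => a ≠ 0
  | seq p q => p.WF ∧ q.WF
  | ite _ p q => p.WF ∧ q.WF
  | loop c _ p => c ≠ 0 ∧ c ∉ p.writes ∧ p.WF

/-- The translation to programs of the random access machine. -/
def compile : Cmd → Program
  | skip => .skip
  | write a i x => .write a i x
  | seq p q => .seq p.compile q.compile
  | ite b p q => .branch b p.compile q.compile
  | loop c b p => .seq (.write c (.const 0) (.const 0))
      (.loop (.sub (.read 0 (.const b)) (.var c))
        (.seq p.compile (.write c (.const 0) (.add (.var c) (.const 1)))))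

/-- A bound on the running time in terms of a bound on the contents of array `0`. -/
noncomputable def time : Cmd → Polynomial ℕ
  | skip => 1
  | write _ i x => .C (i.cost + x.cost + 1)
  | seq p q => p.time + q.time
  | ite b p q => .C (b.cost + 1) + p.time + q.time
  | loop _ _ p => 9 + .X * (p.time + 12)

theorem iterate_of_ne {f : Store → Store} {c a : ℕ} {s : Store} (hac : a ≠ c)
    (hf : ∀ s, f s a = s a) (i : ℕ) : iterate f c s i a = s a := by
  induction i with
  | zero => simp [iterate, hac]
  | succ i ih => simp [iterate, hac, hf, ih]

theorem iterate_counter {f : Store → Store} {c : ℕ} {s : Store} (i : ℕ) :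
    iterate f c s i c 0 = i := by
  cases i <;> simp [iterate]

theorem run_of_notMem {p : Cmd} {a : ℕ} (h : a ∉ p.writes) (s : Store) : p.run s a = s a := by
  induction p generalizing s with
  | skip => rfl
  | write b i x => simp_all [writes, run]
  | seq p q hp hq => simp_all [writes, run]
  | ite b p q hp hq =>
    simp only [writes, List.mem_append, not_or] at h
    simp only [run]
    split_ifs
    exacts [hp h.1 s, hq h.2 s]
  | loop c b p hp =>
    simp only [writes, List.mem_cons, not_or] at h
    exact iterate_of_ne h.1 (hp h.2) _

theorem WF.zero_notMem_writes {p : Cmd} (h : p.WF) : 0 ∉ p.writes := by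
  induction p with
  | skip => simp [writes]
  | write b i x => simp_all [writes, WF, eq_comm]
  | seq p q hp hq => simp_all [writes, WF]
  | ite b p q hp hq => simp_all [writes, WF]
  | loop c b p hp => simp_all [writes, WF, eq_comm]

/-- A well-formed program never writes to array 0, so one K bounds the number of iterations of all
its loops at every nesting depth, whatever the other arrays contain. Counters are protected in the
same way, which makes the translated `loop` run exactly as often as prescribed. -/
theorem exec {p : Cmd} (h : p.WF) {K : ℕ} {s : Store} (hs : ∀ b, s 0 b ≤ K) :
    ∃ t ≤ p.time.eval K, Exec p.compile s t (p.run s) := by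
  induction p generalizing s with
  | skip => exact ⟨1, by simp [time], .skip s⟩
  | write b i x => exact ⟨_, by simp [time], .write b i x s⟩
  | seq p q hp hq =>
    obtain ⟨t, ht, hp⟩ := hp h.1 hs
    obtain ⟨t', ht', hq⟩ := hq h.2 (s := p.run s)
      (by rwa [run_of_notMem h.1.zero_notMem_writes])
    exact ⟨_, by simpa [time] using add_le_add ht ht', .seq hp hq⟩
  | ite b p q hp hq =>
    by_cases hb : b.eval s = 0
    · obtain ⟨t, ht, hq⟩ := hq h.2 hs
      have := Exec.branch_false (p := p.compile) hb hq
      refine ⟨_, ?_, by simpa [run, compile, hb] using this⟩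
      simp only [time, Polynomial.eval_add, Polynomial.eval_C]
      omega
    · obtain ⟨t, ht, hp⟩ := hp h.1 hs
      have := Exec.branch_true (q := q.compile) hb hp
      refine ⟨_, ?_, by simpa [run, compile, hb] using this⟩
      simp only [time, Polynomial.eval_add, Polynomial.eval_C]
      omega
  | loop c b p hp =>
    obtain ⟨hc, hcp, hwf⟩ := h
    have h0 : ∀ i, iterate p.run c s i 0 = s 0 :=
      iterate_of_ne hc.symm (run_of_notMem hwf.zero_notMem_writes)
    -- Evaluating the guard costs 5, and leaving the loop 6. Each iteration adds 12 to the body: 6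
    -- for guard and branching and 6 for the increment. Initializing the counter costs another 3,
    -- whence the 9 in `time`.
    have key : ∀ r i, i + r = s 0 b → ∃ t ≤ 6 + r * (p.time.eval K + 12),
        Exec (.loop (.sub (.read 0 (.const b)) (.var c))
          (.seq p.compile (.write c (.const 0) (.add (.var c) (.const 1)))))
          (iterate p.run c s i) t (iterate p.run c s (s 0 b)) := by
      intro r
      induction r with
      | zero =>
        intro i hi
        obtain rfl : i = s 0 b := hi
        refine ⟨_, ?_, Exec.loop_false ?_⟩
        · simp [Expr.cost]
        · simp [iterate_counter, h0]
      | succ r ih =>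
        intro i hi
        obtain ⟨t', ht', hr⟩ := ih (i + 1) (by omega)
        obtain ⟨t, ht, hb⟩ := hp hwf (s := iterate p.run c s i) (by rwa [h0])
        have hw := Exec.write c (.const 0) (.add (.var c) (.const 1))
          (p.run (iterate p.run c s i))
        simp only [Expr.eval, run_of_notMem hcp, iterate_counter] at hw
        refine ⟨_, ?_, .loop_true ?_ (.seq hb hw) hr⟩
        · simp only [Expr.cost]
          rw [add_mul]
          omega
        · simp only [Expr.eval, iterate_counter, h0]
          omega
    obtain ⟨t, ht, he⟩ := key (s 0 b) 0 (by omega)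
    refine ⟨_, ?_, .seq (.write c (.const 0) (.const 0) s) he⟩
    have := Nat.mul_le_mul_right (p.time.eval K + 12) (hs b)
    simp only [time, Expr.cost, Polynomial.eval_add, Polynomial.eval_mul, Polynomial.eval_X,
      Polynomial.eval_ofNat]
    omega

/-- Proving properties of counting loops by means of an invariant. -/
theorem run_loop {c b : ℕ} {p : Cmd} (I : ℕ → Store → Prop) {s : Store}
    (h0 : I 0 (s.write c 0 0))
    (hstep : ∀ i s', i < s 0 b → s' c 0 = i → (∀ a ∉ (loop c b p).writes, s' a = s a) →
      I i s' → I (i + 1) ((p.run s').write c 0 (i + 1))) :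
    I (s 0 b) ((loop c b p).run s) := by
  have key : ∀ i ≤ s 0 b, I i (iterate p.run c s i) := by
    intro i
    induction i with
    | zero => exact fun _ => h0
    | succ i ih =>
      intro hi
      refine hstep i _ hi (iterate_counter i) (fun a ha => ?_) (ih (by omega))
      simp only [writes, List.mem_cons, not_or] at ha
      exact iterate_of_ne ha.1 (run_of_notMem ha.2) i
  exact key _ le_rfl

end Cmd

end Ram

-- Names of the arrays

notation "EFST" => 1
notation "ESND" => 2
notation "ECOL" => 3
notation "OUT" => 4
notation "UNION" => 5
notation "ACT" => 6
notation "MAT" => 7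
notation "SUB" => 8
notation "NEW" => 9
notation "MATE" => 10
notation "BASE" => 11
notation "STAT" => 12
notation "PAR" => 13
notation "DEP" => 14
notation "MARK" => 15
notation "XX" => 16
notation "YY" => 17
notation "PP" => 18
notation "QQ" => 19
notation "LL" => 20
notation "AUG" => 21
notation "MULT" => 22
notation "COMP" => 23

/-! ### The search program: walking towards the roots -/

namespace Ram.Cmd

open EdgeColoredGraph

/-- Move the walk at the scalar `p` to the parent of its blossom. -/
def climb (p : ℕ) : Cmd :=
  .ite (.eq (.read MATE (.read BASE (.var p))) (.read BASE (.var p))) .skip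
  (.seq (.write MARK (.read BASE (.var p)) (.const 1))
  (.seq (.write MARK (.read MATE (.read BASE (.var p))) (.const 1))
  (.write p (.const 0) (.read PAR (.read MATE (.read BASE (.var p)))))))

/-- Follow the walks from both ends of an edge until they meet or reach two roots. -/
def walk : Cmd :=
  .loop 30 2 (.ite (.eq (.read BASE (.var PP)) (.read BASE (.var QQ))) .skip
    (.ite (.le (.read DEP (.read BASE (.var QQ))) (.read DEP (.read BASE (.var PP))))
      (climb PP) (climb QQ)))

def clearMarks : Cmd := .loop 31 0 (.write MARK (.var 31) (.const 0))

def shrink : Cmd :=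
  .seq (.write LL (.const 0) (.read BASE (.var PP)))
  (.loop 32 0 (.ite (.read MARK (.read BASE (.var 32)))
    (.seq (.write BASE (.var 32) (.var LL)) (.write STAT (.var 32) (.const 1))) .skip))

/-- Treat an edge between two different blossoms. -/
def blossom : Cmd :=
  .seq clearMarks
  (.seq (.write PP (.const 0) (.var XX))
  (.seq (.write QQ (.const 0) (.var YY))
  (.seq walk
  (.ite (.eq (.read BASE (.var PP)) (.read BASE (.var QQ))) shrink
    (.write AUG (.const 0) (.const 1))))))

def grow : Cmd :=
  .seq (.write STAT (.var YY) (.const 2))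
  (.seq (.write STAT (.read MATE (.var YY)) (.const 1))
  (.seq (.write PAR (.var YY) (.var XX))
  (.write DEP (.read MATE (.var YY)) (.add (.read DEP (.read BASE (.var XX))) (.const 1)))))

/-- Try to extend the search forest by an edge. -/
def extend : Cmd :=
  .ite (.and (.not (.var AUG)) (.eq (.read STAT (.var XX)) (.const 1)))
    (.ite (.not (.read STAT (.var YY))) grow
      (.ite (.and (.eq (.read STAT (.var YY)) (.const 1))
        (.not (.eq (.read BASE (.var XX)) (.read BASE (.var YY))))) blossom .skip))
    .skip

theorem run_clearMarks (s : Store) : ∀ v < s 0 0, clearMarks.run s MARK v = 0 := by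
  refine run_loop (c := 31) (b := 0) (fun i s' => ∀ v < i, s' MARK v = 0) (by simp) ?_
  intro i s' hi hc _ hI v hv
  simp only [run, Expr.eval, hc]
  simp only [Store.write_self, Store.write_of_ne, ne_eq, Nat.reduceEqDiff,
    not_false_eq_true, Function.update_apply]
  have := hI v
  grind

variable {k : ℕ} {G : EdgeColoredGraph ℕ ℕ k} {n : ℕ} {H M : Finset ℕ}

theorem run_climb {p : ℕ} {s : Store} (h : s MATE (s BASE (s p 0)) ≠ s BASE (s p 0))
    (hp : p ≠ MARK ∧ p ≠ MATE ∧ p ≠ BASE ∧ p ≠ PAR) :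
    (climb p).run s = ((s.write MARK (s BASE (s p 0)) 1).write MARK
      (s MATE (s BASE (s p 0))) 1).write p 0 (s PAR (s MATE (s BASE (s p 0)))) := by
  simp [climb, run, h, hp]

/-- Every round before the end visits at least one new vertex, and only n vertices exist. So the
available 2n + 1 rounds suffice to reach a common blossom or two roots. -/
theorem run_walk {s : Store} (hn2 : s 0 2 = 2 * n + 1)
    (hM : IsMate G (Finset.range n) M (s MATE)) (hMH : M ⊆ H)
    (h : SearchForest G (Finset.range n) H (s MATE) (s BASE) (s PAR) (s STAT) (s DEP))
    (hx : s PP 0 ∈ Finset.range n) (hy : s QQ 0 ∈ Finset.range n) (hsx : s STAT (s PP 0) = 1)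
    (hsy : s STAT (s QQ 0) = 1) (hmark : ∀ v < n, s MARK v = 0) :
    ∃ U W : Finset ℕ, SearchWalk G (Finset.range n) H (s MATE) (s BASE) (s STAT) (s DEP)
        (s PP 0) (s QQ 0) (walk.run s PP 0) (walk.run s QQ 0) U W ∧
      (∀ v ∈ Finset.range n, walk.run s MARK (s BASE v) ≠ 0 ↔ v ∈ U ∪ W) ∧
      (s BASE (walk.run s PP 0) = s BASE (walk.run s QQ 0) ∨
        s MATE (s BASE (walk.run s PP 0)) = s BASE (walk.run s PP 0) ∧
        s MATE (s BASE (walk.run s QQ 0)) = s BASE (walk.run s QQ 0)) := by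
  have key := run_loop (c := 30) (b := 2)
    (p := .ite (.eq (.read BASE (.var PP)) (.read BASE (.var QQ))) .skip
    (.ite (.le (.read DEP (.read BASE (.var QQ))) (.read DEP (.read BASE (.var PP))))
      (climb PP) (climb QQ))) (s := s)
    (fun i s' => ∃ U W : Finset ℕ, SearchWalk G (Finset.range n) H (s MATE) (s BASE) (s STAT)
        (s DEP) (s PP 0) (s QQ 0) (s' PP 0) (s' QQ 0) U W ∧
      (∀ v ∈ Finset.range n, s' MARK (s BASE v) ≠ 0 ↔ v ∈ U ∪ W) ∧
      ((s BASE (s' PP 0) = s BASE (s' QQ 0) ∨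
        s MATE (s BASE (s' PP 0)) = s BASE (s' PP 0) ∧
        s MATE (s BASE (s' QQ 0)) = s BASE (s' QQ 0)) ∨ i ≤ (U ∪ W).card)) ?_ ?_
  · obtain ⟨U, W, hw, hm, hd⟩ := key
    refine ⟨U, W, hw, hm, hd.resolve_right ?_⟩
    have hsub : U ∪ W ⊆ Finset.range n := by
      intro v hv
      rcases Finset.mem_union.1 hv with hv | hv
      · exact (hw.left_closed v hv).1
      · exact (hw.right_closed v hv).1
    have := Finset.card_le_card hsub
    rw [Finset.card_range] at this
    omega
  · refine ⟨∅, ∅, by simpa using searchWalk_init hx hy hsx hsy, fun v hv => ?_, by simp⟩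
    simp [hmark _ (Finset.mem_range.1 (h.base_mem v hv))]
  · rintro i s' - hc hfr ⟨U, W, hw, hm, hd⟩
    have hMATE : s' MATE = s MATE := hfr _ (by decide)
    have hBASE : s' BASE = s BASE := hfr _ (by decide)
    have hPAR : s' PAR = s PAR := hfr _ (by decide)
    have hDEP : s' DEP = s DEP := hfr _ (by decide)
    by_cases hpq : s BASE (s' PP 0) = s BASE (s' QQ 0)
    · refine ⟨U, W, ?_⟩
      simp only [run, Expr.eval_eq, Expr.eval, hBASE, hpq]
      simpa [hpq] using ⟨hw, by simpa using hm⟩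
    by_cases hroots : s MATE (s BASE (s' PP 0)) = s BASE (s' PP 0) ∧
        s MATE (s BASE (s' QQ 0)) = s BASE (s' QQ 0)
    · refine ⟨U, W, ?_⟩
      have hrun : ∀ b : Expr, (Cmd.ite b (climb PP) (climb QQ)).run s' = s' := by
        intro b
        simp [run, climb, hBASE, hMATE, hroots]
      have : (Cmd.ite (.eq (.read BASE (.var PP)) (.read BASE (.var QQ))) .skip
        (.ite (.le (.read DEP (.read BASE (.var QQ))) (.read DEP (.read BASE (.var PP))))
          (climb PP) (climb QQ))).run s' = s' := by
        rw [run, hrun]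
        simp [run]
      rw [this]
      simpa [hroots] using ⟨hw, by simpa using hm⟩
    have hcard : i ≤ (U ∪ W).card := by tauto
    have hb := h.base_mem _ hw.left_mem
    have hb' := h.base_mem _ hw.right_mem
    have mark_iff : ∀ (p : ℕ) (Z : Finset ℕ) (m : ℕ → ℕ), p ∈ Finset.range n → s STAT p = 1 →
        s MATE (s BASE p) ≠ s BASE p →
        (∀ v ∈ Finset.range n, m (s BASE v) ≠ 0 ↔ v ∈ Z) → ∀ v ∈ Finset.range n,
          Function.update (Function.update m (s BASE p) 1) (s MATE (s BASE p)) 1 (s BASE v) ≠ 0 ↔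
          v ∈ visited (Finset.range n) (s MATE) (s BASE) p ∪ Z := by
      intro p Z m hp hs hroot hm v hv
      rw [Finset.mem_union, h.mem_visited hM hp hs hroot hv, ← hm v hv,
        Function.update_apply, Function.update_apply]
      grind
    have hvis : ∀ (p : ℕ), p ∈ visited (Finset.range n) (s MATE) (s BASE) p ∨
        p ∉ Finset.range n := by
      intro p
      simp only [visited, Finset.mem_insert, mem_baseClass]
      tauto
    by_cases hdep : s DEP (s BASE (s' QQ 0)) ≤ s DEP (s BASE (s' PP 0))
    · have hroot : s MATE (s BASE (s' PP 0)) ≠ s BASE (s' PP 0) := by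
        intro hroot
        -- If the deeper walk stands at a root, both depths are 0, so the other walk stands at a
        -- root too and the walks are already finished.
        refine hroots ⟨hroot, h.root_of_dep_eq_zero hM hw.right_mem hw.st_right ?_⟩
        have := (h.exposed _ hb hroot).2.2
        omega
      have hrun := run_climb (p := PP) (s := s') (by rwa [hMATE, hBASE]) (by decide)
      refine ⟨visited (Finset.range n) (s MATE) (s BASE) (s' PP 0) ∪ U, W, ?_⟩
      have hstep := hw.step hM hMH h hpq hdep hroot
      simp only [run, Expr.eval_eq, Expr.eval_le, Expr.eval, hBASE, hDEP, hpq, hdep, if_true,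
        if_false, ne_eq, one_ne_zero, not_false_eq_true, not_true_eq_false, hrun, hMATE, hPAR]
      simp only [Store.write_self, Store.write_of_ne, ne_eq,
        Nat.reduceEqDiff, not_false_eq_true, Function.update_self]
      refine ⟨hstep, ?_, Or.inr ?_⟩
      · rw [Finset.union_assoc]
        exact mark_iff _ _ _ hw.left_mem hw.st_left hroot hm
      · have hnot : s' PP 0 ∉ U ∪ W := fun h' =>
          (hw.base_ne _ (Finset.mem_union.1 h')).1 rfl
        have hlt : (U ∪ W).card <
            (visited (Finset.range n) (s MATE) (s BASE) (s' PP 0) ∪ U ∪ W).card := by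
          refine Finset.card_lt_card ?_
          rw [Finset.union_assoc, Finset.ssubset_iff_of_subset Finset.subset_union_right]
          exact ⟨_, Finset.mem_union_left _ ((hvis _).resolve_right (not_not.2 hw.left_mem)),
            hnot⟩
        omega
    · have hroot : s MATE (s BASE (s' QQ 0)) ≠ s BASE (s' QQ 0) := by
        intro hroot
        have := (h.exposed _ hb' hroot).2.2
        omega
      have hrun := run_climb (p := QQ) (s := s') (by rwa [hMATE, hBASE]) (by decide)
      refine ⟨U, visited (Finset.range n) (s MATE) (s BASE) (s' QQ 0) ∪ W, ?_⟩
      have hstep := (hw.symm.step hM hMH h (Ne.symm hpq) (by omega) hroot).symm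
      simp only [run, Expr.eval_eq, Expr.eval_le, Expr.eval, hBASE, hDEP, hpq, hdep,
        if_false, ne_eq, not_true_eq_false, hrun, hMATE, hPAR]
      simp only [Store.write_self, Store.write_of_ne, ne_eq,
        Nat.reduceEqDiff, not_false_eq_true, Function.update_self]
      refine ⟨hstep, ?_, Or.inr ?_⟩
      · rw [Finset.union_left_comm]
        exact mark_iff _ _ _ hw.right_mem hw.st_right hroot hm
      · have hnot : s' QQ 0 ∉ U ∪ W := fun h' =>
          (hw.base_ne _ (Finset.mem_union.1 h')).2 rfl
        have hlt : (U ∪ W).card <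
            (U ∪ (visited (Finset.range n) (s MATE) (s BASE) (s' QQ 0) ∪ W)).card := by
          refine Finset.card_lt_card ?_
          rw [Finset.union_left_comm, Finset.ssubset_iff_of_subset Finset.subset_union_right]
          exact ⟨_, Finset.mem_union_left _ ((hvis _).resolve_right (not_not.2 hw.right_mem)),
            hnot⟩
        omega

end Ram.Cmd

/-! ### The search program: treating one edge -/

namespace Ram.Cmd

open EdgeColoredGraph

variable {k : ℕ} {G : EdgeColoredGraph ℕ ℕ k} {n : ℕ} {H M : Finset ℕ}

/-- Overwriting `BASE` in place is harmless: the iteration for i reads the base of i only, which no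
earlier iteration has changed, and the new base was saved in `LL` beforehand. -/
theorem run_shrink {s : Store} {v : ℕ} (hv : v < s 0 0) :
    shrink.run s BASE v =
      (if s MARK (s BASE v) ≠ 0 then s BASE (s PP 0) else s BASE v) ∧
    shrink.run s STAT v = (if s MARK (s BASE v) ≠ 0 then 1 else s STAT v) := by
  have key := run_loop (c := 32) (b := 0)
    (p := .ite (.read MARK (.read BASE (.var 32)))
    (.seq (.write BASE (.var 32) (.var LL)) (.write STAT (.var 32) (.const 1))) .skip)
    (s := s.write LL 0 (s BASE (s PP 0)))
    (fun i s' => ∀ v, s' BASE v =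
      (if v < i ∧ s MARK (s BASE v) ≠ 0 then s BASE (s PP 0) else s BASE v) ∧
      s' STAT v = (if v < i ∧ s MARK (s BASE v) ≠ 0 then 1 else s STAT v)) ?_ ?_
  · have := key v
    simp only [Store.write_of_ne, ne_eq, OfNat.zero_ne_ofNat,
      not_false_eq_true, hv, true_and] at this
    exact this
  · intro v
    simp
  · intro i s' hi hc hfr hI v
    have hMARK : s' MARK = s MARK := by
      rw [hfr MARK (by decide)]
      simp
    have hLL : s' LL 0 = s BASE (s PP 0) := by
      rw [hfr LL (by decide)]
      simp
    have hIi := (hI i).1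
    rw [if_neg (by omega)] at hIi
    have hIv := hI v
    simp only [run, Expr.eval, hc, hMARK, hIi]
    by_cases hm : s MARK (s BASE i) = 0
    · simp only [hm, ne_eq, not_true_eq_false, if_false, Store.write_of_ne, Nat.reduceEqDiff,
        not_false_eq_true]
      grind
    · simp only [hm, ne_eq, not_false_eq_true, if_true, Store.write_of_ne, Store.write_self,
        Nat.reduceEqDiff, hc, hLL, Function.update_apply]
      grind

/-- The state of the search program. -/
structure SearchOK (G : EdgeColoredGraph ℕ ℕ k) (n : ℕ) (H M : Finset ℕ) (s : Store) : Prop where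
  isMate : IsMate G (Finset.range n) M (s MATE)
  forest : SearchForest G (Finset.range n) H (s MATE) (s BASE) (s PAR) (s STAT) (s DEP)
  larger : s AUG 0 ≠ 0 → ∃ N ⊆ H, G.IsMatching N ∧ M.card < N.card

/-- The search has finished, or the edge from `x` to `y` does not allow to extend the forest. -/
def Settled (s : Store) (x y : ℕ) : Prop :=
  s AUG 0 ≠ 0 ∨ (s STAT x = 1 → s STAT y ≠ 0 ∧ (s STAT y = 1 → s BASE x = s BASE y))

/-- The extra unit pays for the one step that raises the flag `AUG` without changing the forest. -/
def remaining (n : ℕ) (s : Store) : ℕ :=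
  potential (Finset.range n) (s BASE) (s STAT) + if s AUG 0 = 0 then 1 else 0

/-- The arrays in which the progress of the search is visible agree. -/
def SameSearch (s s' : Store) : Prop := s' BASE = s BASE ∧ s' STAT = s STAT ∧ s' AUG = s AUG

/-- If the walks meet, merging uses up at least one base. If they do not, they have reached
different roots, and setting `AUG` uses up the extra unit of `remaining`; the truth of the flag is
`SearchForest.exists_larger`. -/
theorem run_blossom {s : Store} (hn : s 0 0 = n) (hn2 : s 0 2 = 2 * n + 1)
    (hMM : G.IsMatching M) (hMH : M ⊆ H)
    (hH : ∀ e ∈ H, G.fst e ∈ Finset.range n ∧ G.snd e ∈ Finset.range n)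
    (h : SearchOK G n H M s) {e : ℕ} (he : e ∈ H) (hxy : G.Joins e (s XX 0) (s YY 0))
    (hx : s XX 0 ∈ Finset.range n) (hy : s YY 0 ∈ Finset.range n) (hA : s AUG 0 = 0)
    (hsx : s STAT (s XX 0) = 1) (hsy : s STAT (s YY 0) = 1)
    (hb : s BASE (s XX 0) ≠ s BASE (s YY 0)) :
    SearchOK G n H M (blossom.run s) ∧ remaining n (blossom.run s) < remaining n s := by
  set s1 := ((clearMarks.run s).write PP 0 (s XX 0)).write QQ 0 (s YY 0) with hs1
  have hfr1 : ∀ a ∉ [31, MARK, PP, QQ], s1 a = s a := by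
    intro a ha
    simp only [List.mem_cons, List.not_mem_nil, or_false, not_or] at ha
    rw [hs1, Store.write_of_ne _ _ _ (by tauto), Store.write_of_ne _ _ _ (by tauto),
      run_of_notMem]
    simp only [clearMarks, writes, List.mem_cons, List.not_mem_nil, or_false, not_or]
    tauto
  have hPP : s1 PP 0 = s XX 0 := by simp [hs1]
  have hQQ : s1 QQ 0 = s YY 0 := by simp [hs1]
  have hmark : ∀ v < n, s1 MARK v = 0 := by
    intro v hv
    have := run_clearMarks s v (by omega)
    simpa [hs1] using this
  have hrun : blossom.run s = (Cmd.ite (.eq (.read BASE (.var PP)) (.read BASE (.var QQ))) shrink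
      (.write AUG (.const 0) (.const 1))).run (walk.run s1) := by
    have h1 : clearMarks.run s XX = s XX := run_of_notMem (by decide) s
    have h2 : clearMarks.run s YY = s YY := run_of_notMem (by decide) s
    simp [blossom, run, hs1, h1, h2]
  have hw := run_walk (s := s1) (n := n) (G := G) (H := H) (M := M)
    (by rw [hfr1 _ (by decide), hn2])
    (by rw [hfr1 MATE (by decide)]; exact h.isMate) hMH
    (by
      rw [hfr1 MATE (by decide), hfr1 BASE (by decide), hfr1 PAR (by decide),
        hfr1 STAT (by decide), hfr1 DEP (by decide)]
      exact h.forest)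
    (by rwa [hPP]) (by rwa [hQQ])
    (by rw [hfr1 STAT (by decide), hPP, hsx]) (by rw [hfr1 STAT (by decide), hQQ, hsy]) hmark
  rw [hfr1 MATE (by decide), hfr1 BASE (by decide), hfr1 STAT (by decide),
    hfr1 DEP (by decide), hPP, hQQ] at hw
  have hfr : ∀ a ∉ [31, MARK, PP, QQ, 30], walk.run s1 a = s a := by
    intro a ha
    rw [run_of_notMem, hfr1]
    · simp only [List.mem_cons, List.not_mem_nil, or_false, not_or] at ha ⊢
      tauto
    · simp only [walk, climb, writes, List.mem_cons, List.mem_append, List.not_mem_nil, or_false,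
        not_or] at ha ⊢
      tauto
  rw [hrun]
  set s2 := walk.run s1 with hs2
  obtain ⟨U, W, hw, hm, hd⟩ := hw
  have hM2 : s2 MATE = s MATE := hfr _ (by decide)
  have hB2 : s2 BASE = s BASE := hfr _ (by decide)
  have hS2 : s2 STAT = s STAT := hfr _ (by decide)
  have hP2 : s2 PAR = s PAR := hfr _ (by decide)
  have hD2 : s2 DEP = s DEP := hfr _ (by decide)
  have hA2 : s2 AUG = s AUG := hfr _ (by decide)
  have hn' : s2 0 0 = n := by rw [hfr 0 (by decide), hn]
  by_cases hpq : s BASE (s2 PP 0) = s BASE (s2 QQ 0)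
  · have hr : (Cmd.ite (.eq (.read BASE (.var PP)) (.read BASE (.var QQ))) shrink
        (.write AUG (.const 0) (.const 1))).run s2 = shrink.run s2 := by
      simp [run, hB2, hpq]
    rw [hr]
    have hfs : ∀ a ∉ [LL, 32, BASE, STAT], shrink.run s2 a = s2 a := by
      intro a ha
      exact run_of_notMem ha s2
    have hbase' : ∀ v ∈ Finset.range n,
        shrink.run s2 BASE v = if v ∈ U ∪ W then s BASE (s2 PP 0) else s BASE v := by
      intro v hv
      rw [(run_shrink (by simpa [hn'] using hv)).1, hB2]
      exact if_congr (hm v hv) rfl rfl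
    have hstat' : ∀ v ∈ Finset.range n,
        shrink.run s2 STAT v = if v ∈ U ∪ W then 1 else s STAT v := by
      intro v hv
      rw [(run_shrink (by simpa [hn'] using hv)).2, hB2, hS2]
      exact if_congr (hm v hv) rfl rfl
    refine ⟨⟨?_, ?_, ?_⟩, ?_⟩
    · rw [hfs MATE (by decide), hM2]
      exact h.isMate
    · rw [hfs MATE (by decide), hM2, hfs PAR (by decide), hP2, hfs DEP (by decide), hD2]
      exact h.forest.merge h.isMate hw he hxy rfl hpq.symm hbase' hstat'
    · rw [hfs AUG (by decide), hA2]
      exact h.larger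
    · have hnot : s BASE (s2 PP 0) ∉ U ∪ W := by
        intro h'
        exact (hw.base_ne _ (Finset.mem_union.1 h')).1 (h.forest.base_base _ hw.left_mem)
      -- At least one walk has moved, because the two walks started in different blossoms and ended
      -- in the same one. The base of its starting blossom is absorbed.
      have hex : ∃ b ∈ U ∪ W, b ∈ Finset.range n ∧ s BASE b = b := by
        rcases hw.left.start with hxU | ⟨-, hxp⟩
        · have h1 := h.forest.base_mem _ hx
          have h2 := h.forest.base_base _ hx
          exact ⟨_, Finset.mem_union_left _ ((hw.left_closed _ hxU).2.2.2.2 _ h1 h2), h1, h2⟩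
        · rcases hw.right.start with hyW | ⟨-, hyq⟩
          · have h1 := h.forest.base_mem _ hy
            have h2 := h.forest.base_base _ hy
            exact ⟨_, Finset.mem_union_right _ ((hw.right_closed _ hyW).2.2.2.2 _ h1 h2), h1, h2⟩
          · rw [← hxp, ← hyq] at hpq
            exact absurd hpq hb
      obtain ⟨b, hbU, hbn, hbb⟩ := hex
      have := potential_merge hbU hbn hbb hnot hbase' hstat'
      simp only [remaining, hfs AUG (by decide), hA2]
      omega
  · have hr : (Cmd.ite (.eq (.read BASE (.var PP)) (.read BASE (.var QQ))) shrink
        (.write AUG (.const 0) (.const 1))).run s2 = s2.write AUG 0 1 := by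
      simp [run, hB2, hpq]
    rw [hr]
    obtain ⟨hrp, hrq⟩ := hd.resolve_left hpq
    refine ⟨⟨?_, ?_, fun _ => ?_⟩, ?_⟩
    · simpa [hM2] using h.isMate
    · simpa [hM2, hB2, hP2, hS2, hD2] using h.forest
    · exact h.forest.exists_larger h.isMate hMM hMH hH hw he hxy hrp hrq hpq
    · simp [remaining, hB2, hS2, hA]

/-- The dichotomy drives the whole search: on a settled edge nothing relevant changes, and on any
other edge the potential drops. -/
theorem run_extend {s : Store} (hn : s 0 0 = n) (hn2 : s 0 2 = 2 * n + 1)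
    (hMM : G.IsMatching M) (hMH : M ⊆ H)
    (hH : ∀ e ∈ H, G.fst e ∈ Finset.range n ∧ G.snd e ∈ Finset.range n)
    (h : SearchOK G n H M s) {e : ℕ} (he : e ∈ H) (hxy : G.Joins e (s XX 0) (s YY 0)) :
    SearchOK G n H M (extend.run s) ∧
      (Settled s (s XX 0) (s YY 0) → SameSearch s (extend.run s)) ∧
      (¬ Settled s (s XX 0) (s YY 0) → remaining n (extend.run s) < remaining n s) := by
  have hx : s XX 0 ∈ Finset.range n := by
    rcases hxy with h1 | h1
    · exact h1.1 ▸ (hH e he).1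
    · exact h1.2 ▸ (hH e he).2
  have hy : s YY 0 ∈ Finset.range n := by
    rcases hxy with h1 | h1
    · exact h1.2 ▸ (hH e he).2
    · exact h1.1 ▸ (hH e he).1
  by_cases hset : Settled s (s XX 0) (s YY 0)
  · have hrun : extend.run s = s := by
      rcases hset with hA | hset
      · simp [extend, run, hA]
      · by_cases hsx : s STAT (s XX 0) = 1
        · obtain ⟨h1, h2⟩ := hset hsx
          by_cases hsy : s STAT (s YY 0) = 1
          · simp [extend, run, hsy, h2 hsy]
          · simp [extend, run, h1, hsy]
        · simp [extend, run, hsx]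
    rw [hrun]
    exact ⟨h, fun _ => ⟨rfl, rfl, rfl⟩, fun h' => absurd hset h'⟩
  · have hset' := hset
    simp only [Settled, not_or, not_not, Classical.not_imp, not_and_or] at hset'
    obtain ⟨hA, hsx, hsy⟩ := hset'
    suffices hsuff : SearchOK G n H M (extend.run s) ∧
        remaining n (extend.run s) < remaining n s from
      ⟨hsuff.1, fun h' => absurd h' hset, fun _ => hsuff.2⟩
    by_cases hsy0 : s STAT (s YY 0) = 0
    · have hrun : extend.run s = grow.run s := by
        simp [extend, run, hA, hsx, hsy0]
      have hfr : ∀ a ∉ [STAT, PAR, DEP], grow.run s a = s a := by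
        intro a ha
        refine run_of_notMem ?_ s
        simp only [grow, writes, List.mem_append, List.mem_cons, List.not_mem_nil, or_false,
          not_or] at ha ⊢
        tauto
      have hmy : s MATE (s YY 0) ≠ s YY 0 := by
        intro h'
        have := (h.forest.exposed _ hy h').1
        omega
      have hst' : ∀ v ∈ Finset.range n, grow.run s STAT v =
          if v = s MATE (s YY 0) then 1 else if v = s YY 0 then 2 else s STAT v := by
        intro v _
        simp [grow, run, Function.update_apply]
      have hpar' : ∀ v ∈ Finset.range n, grow.run s PAR v =
          if v = s YY 0 then s XX 0 else s PAR v := by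
        intro v _
        simp [grow, run, Function.update_apply]
      have hdep' : ∀ v ∈ Finset.range n, grow.run s DEP v =
          if v = s MATE (s YY 0) then s DEP (s BASE (s XX 0)) + 1 else s DEP v := by
        intro v _
        simp [grow, run, Function.update_apply]
      rw [hrun]
      refine ⟨⟨?_, ?_, ?_⟩, ?_⟩
      · rw [hfr MATE (by decide)]
        exact h.isMate
      · rw [hfr MATE (by decide), hfr BASE (by decide)]
        exact h.forest.grow h.isMate he hxy hx hy hsx hsy0 hst' hpar' hdep'
      · rw [hfr AUG (by decide)]
        exact h.larger
      · simp only [remaining, hfr AUG (by decide), hfr BASE (by decide)]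
        have := potential_grow (vs := Finset.range n) (base := s BASE) hy hsy0
          (st' := grow.run s STAT) (by rw [hst' _ hy, if_neg (Ne.symm hmy), if_pos rfl]; omega)
          (by
            intro v hv h0
            rw [hst' v hv] at h0
            split_ifs at h0
            exact h0)
        omega
    · obtain ⟨hsy1, hb⟩ := hsy.resolve_left hsy0
      have hrun : extend.run s = blossom.run s := by
        simp [extend, run, hA, hsx, hsy1, hb]
      rw [hrun]
      exact run_blossom hn hn2 hMM hMH hH h he hxy hx hy hA hsx hsy1 hb

end Ram.Cmd

/-! ### The search program: initialization and repeated sweeps -/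

namespace EdgeColoredGraph

theorem isMate_empty {V E : Type*} {k : ℕ} {G : EdgeColoredGraph V E k} {vs : Finset V}
    {mate : V → V} (h : ∀ v ∈ vs, mate v = v) : IsMate G vs ∅ mate :=
  ⟨fun v hv => by rwa [h v hv], fun v hv => by rw [h v hv, h v hv],
    fun v hv h' => absurd (h v hv) h', by simp⟩

theorem IsMate.insert {V E : Type*} [DecidableEq V] [DecidableEq E] {k : ℕ}
    {G : EdgeColoredGraph V E k} {vs : Finset V} {M : Finset E} {mate : V → V}
    (h : IsMate G vs M mate) {e : E} (heM : e ∉ M) (hM : G.IsMatching (insert e M))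
    (h1 : G.fst e ∈ vs) (h2 : G.snd e ∈ vs) :
    IsMate G vs (insert e M)
      (Function.update (Function.update mate (G.fst e) (G.snd e)) (G.snd e) (G.fst e)) := by
  have hne := G.fst_ne_snd e
  have hfix : ∀ v ∈ vs, G.Incident e v → mate v = v := by
    intro v hv hev
    by_contra hmv
    obtain ⟨f, hf, hj⟩ := h.joins v hv hmv
    have := hM v e (by simp) f (by simp [hf]) hev (hj.incident_iff.2 (Or.inl rfl))
    exact heM (this ▸ hf)
  have hf := hfix _ h1 (Or.inl rfl)
  have hs := hfix _ h2 (Or.inr rfl)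
  have hmem := h.mem
  have hinv := h.invol
  refine ⟨?_, ?_, ?_, ?_⟩
  · intro v hv
    simp only [Function.update_apply]
    grind
  · intro v hv
    simp only [Function.update_apply]
    grind
  · intro v hv hmv
    simp only [Function.update_apply] at hmv ⊢
    split_ifs at hmv ⊢ with h3 h4
    · exact ⟨e, by simp, Or.inr ⟨rfl, h3.symm⟩⟩
    · exact ⟨e, by simp, Or.inl ⟨h4.symm, rfl⟩⟩
    · obtain ⟨g, hg, hj⟩ := h.joins v hv hmv
      exact ⟨g, by simp [hg], hj⟩
  · intro g hg
    simp only [Function.update_apply]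
    rcases Finset.mem_insert.1 hg with rfl | hg'
    · simp [hne]
    · have h3 : ∀ v, G.Incident e v → ¬ G.Incident g v := by
        intro v hev hgv
        exact heM ((hM v e (by simp) g hg hev hgv) ▸ hg')
      have h4 := h3 _ (Or.inl rfl)
      have h5 := h3 _ (Or.inr rfl)
      simp only [Incident, not_or] at h4 h5
      have := h.of_mem g hg'
      simp only [h4, h5, if_false, this, and_self]

end EdgeColoredGraph

namespace Ram

/-- The store encodes the graph with vertices `0, …, n - 1` and edges `0, …, m - 1`. -/
structure Encodes {k : ℕ} (G : EdgeColoredGraph ℕ ℕ k) (n m : ℕ) (s : Store) : Prop where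
  vertices : s 0 0 = n
  edges : s 0 1 = m
  rounds : s 0 2 = 2 * n + 1
  fst : ∀ e < m, s EFST e = G.fst e
  snd : ∀ e < m, s ESND e = G.snd e
  fst_lt : ∀ e < m, G.fst e < n
  snd_lt : ∀ e < m, G.snd e < n

theorem Encodes.of_eq {k : ℕ} {G : EdgeColoredGraph ℕ ℕ k} {n m : ℕ} {s s' : Store}
    (h : Encodes G n m s) (h0 : s' 0 = s 0)
    (h1 : s' EFST = s EFST) (h2 : s' ESND = s ESND) : Encodes G n m s' :=
  ⟨by rw [h0, h.vertices], by rw [h0, h.edges], by rw [h0, h.rounds], by rw [h1]; exact h.fst,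
    by rw [h2]; exact h.snd, h.fst_lt, h.snd_lt⟩

/-- The set with the given indicator vector of length `m`. -/
def mask (m : ℕ) (a : ℕ → ℕ) : Finset ℕ := (Finset.range m).filter (a · ≠ 0)

theorem mem_mask {m e : ℕ} {a : ℕ → ℕ} : e ∈ mask m a ↔ e < m ∧ a e ≠ 0 := by
  simp [mask]

namespace Cmd

open EdgeColoredGraph

def initMate : Cmd :=
  .seq (.loop 33 0 (.seq (.write MATE (.var 33) (.var 33))
    (.seq (.write BASE (.var 33) (.var 33)) (.write DEP (.var 33) (.const 0)))))
  (.seq (.loop 34 1 (.ite (.read MAT (.var 34))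
    (.seq (.write MATE (.read EFST (.var 34)) (.read ESND (.var 34)))
      (.write MATE (.read ESND (.var 34)) (.read EFST (.var 34)))) .skip))
  (.seq (.loop 35 0 (.write STAT (.var 35) (.eq (.read MATE (.var 35)) (.var 35))))
  (.write AUG (.const 0) (.const 0))))

def scanEdge : Cmd :=
  .ite (.read SUB (.var 36))
    (.seq (.write XX (.const 0) (.read EFST (.var 36)))
    (.seq (.write YY (.const 0) (.read ESND (.var 36)))
    (.seq extend
    (.seq (.write XX (.const 0) (.read ESND (.var 36)))
    (.seq (.write YY (.const 0) (.read EFST (.var 36))) extend)))))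
    .skip

def sweep : Cmd := .loop 36 1 scanEdge

/-- Decide whether the matching `MAT` is not maximum in the set `SUB`. -/
def search : Cmd := .seq initMate (.loop 37 2 sweep)

variable {k : ℕ} {G : EdgeColoredGraph ℕ ℕ k} {n m : ℕ} {H M : Finset ℕ}

theorem run_initMate {s : Store} (hG : Encodes G n m s) (hMM : G.IsMatching (mask m (s MAT))) :
    SearchOK G n H (mask m (s MAT)) (initMate.run s) := by
  have h1 := run_loop (c := 33) (b := 0) (s := s) (p := .seq (.write MATE (.var 33) (.var 33))
    (.seq (.write BASE (.var 33) (.var 33)) (.write DEP (.var 33) (.const 0))))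
    (fun i s' => ∀ v < i, s' MATE v = v ∧ s' BASE v = v ∧ s' DEP v = 0) (by simp) (by
      intro i s' hi hc _ hI v hv
      have := hI v
      simp [run, hc, Function.update_apply]
      grind)
  rw [hG.vertices] at h1
  set s1 := (Cmd.loop 33 0 (.seq (.write MATE (.var 33) (.var 33))
    (.seq (.write BASE (.var 33) (.var 33)) (.write DEP (.var 33) (.const 0))))).run s with hs1
  have hfr1 : ∀ a ∉ [33, MATE, BASE, DEP], s1 a = s a := by
    intro a ha
    exact run_of_notMem ha s
  have h2 := run_loop (c := 34) (b := 1) (s := s1) (p := .ite (.read MAT (.var 34))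
    (.seq (.write MATE (.read EFST (.var 34)) (.read ESND (.var 34)))
      (.write MATE (.read ESND (.var 34)) (.read EFST (.var 34)))) .skip)
    (fun i s' => IsMate G (Finset.range n) ((mask m (s MAT)).filter (· < i)) (s' MATE)) (by
      simp only [Nat.not_lt_zero, Finset.filter_false, Store.write_of_ne, ne_eq,
        Nat.reduceEqDiff, not_false_eq_true]
      exact isMate_empty fun v hv => (h1 v (Finset.mem_range.1 hv)).1) (by
      intro i s' hi hc hfr hI
      rw [hfr1 0 (by decide), hG.edges] at hi
      have hMAT : s' MAT = s MAT := by rw [hfr _ (by decide), hfr1 _ (by decide)]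
      have hF : s' EFST i = G.fst i := by
        rw [hfr _ (by decide), hfr1 _ (by decide), hG.fst i hi]
      have hS : s' ESND i = G.snd i := by
        rw [hfr _ (by decide), hfr1 _ (by decide), hG.snd i hi]
      by_cases him : s MAT i = 0
      · have hset : (mask m (s MAT)).filter (· < i + 1) = (mask m (s MAT)).filter (· < i) := by
          ext e
          simp only [Finset.mem_filter, mem_mask]
          grind
        rw [hset]
        simpa [run, hc, hMAT, him] using hI
      · have hset : (mask m (s MAT)).filter (· < i + 1) =
            insert i ((mask m (s MAT)).filter (· < i)) := by
          ext e
          simp only [Finset.mem_filter, mem_mask, Finset.mem_insert]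
          grind
        have := hI.insert (e := i) (by simp)
          (hset ▸ hMM.subset (Finset.filter_subset _ _)) (by simpa using hG.fst_lt i hi)
          (by simpa using hG.snd_lt i hi)
        rw [hset]
        simpa [run, hc, hMAT, him, hF, hS] using this)
  rw [hfr1 0 (by decide), hG.edges, Finset.filter_true_of_mem
    (fun e he => (mem_mask.1 he).1)] at h2
  set s2 := (Cmd.loop 34 1 (.ite (.read MAT (.var 34))
    (.seq (.write MATE (.read EFST (.var 34)) (.read ESND (.var 34)))
      (.write MATE (.read ESND (.var 34)) (.read EFST (.var 34)))) .skip)).run s1 with hs2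
  have hfr2 : ∀ a ∉ [34, MATE], s2 a = s1 a := by
    intro a ha
    refine run_of_notMem ?_ s1
    simp only [writes, List.mem_append, List.mem_cons, List.not_mem_nil, or_false,
      not_or] at ha ⊢
    tauto
  have h3 := run_loop (c := 35) (b := 0) (s := s2)
    (p := .write STAT (.var 35) (.eq (.read MATE (.var 35)) (.var 35)))
    (fun i s' => ∀ v < i, s' STAT v = if s2 MATE v = v then 1 else 0) (by simp) (by
      intro i s' hi hc hfr hI v hv
      have hM' : s' MATE = s2 MATE := hfr _ (by decide)
      have := hI v
      simp [run, hc, Function.update_apply, hM']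
      grind)
  rw [hfr2 0 (by decide), hfr1 0 (by decide), hG.vertices] at h3
  set s3 := (Cmd.loop 35 0
    (.write STAT (.var 35) (.eq (.read MATE (.var 35)) (.var 35)))).run s2 with hs3
  have hfr3 : ∀ a ∉ [35, STAT], s3 a = s2 a := by
    intro a ha
    exact run_of_notMem ha s2
  have hrun : initMate.run s = s3.write AUG 0 0 := rfl
  rw [hrun]
  have hB : s3 BASE = s1 BASE := by rw [hfr3 _ (by decide), hfr2 _ (by decide)]
  have hD : s3 DEP = s1 DEP := by rw [hfr3 _ (by decide), hfr2 _ (by decide)]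
  have hM3 : s3 MATE = s2 MATE := hfr3 _ (by decide)
  refine ⟨?_, ?_, ?_⟩
  · simpa [hM3] using h2
  · simp only [Store.write_of_ne, ne_eq, Nat.reduceEqDiff, not_false_eq_true, hM3, hB, hD]
    exact SearchForest.init h2 (fun v hv => (h1 v (Finset.mem_range.1 hv)).2.1)
      (fun v hv => h3 v (Finset.mem_range.1 hv)) (fun v hv => (h1 v (Finset.mem_range.1 hv)).2.2)
  · simp

theorem Settled.of_same {s s' : Store} {x y : ℕ} (h : SameSearch s s') :
    Settled s' x y ↔ Settled s x y := by
  obtain ⟨h1, h2, h3⟩ := h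
  simp only [Settled, h1, h2, h3]

theorem remaining_of_same {s s' : Store} (h : SameSearch s s') :
    remaining n s' = remaining n s := by
  obtain ⟨h1, h2, h3⟩ := h
  simp only [remaining, h1, h2, h3]

theorem SameSearch.trans {s s' s'' : Store} (h : SameSearch s s') (h' : SameSearch s' s'') :
    SameSearch s s'' :=
  ⟨h'.1.trans h.1, h'.2.1.trans h.2.1, h'.2.2.trans h.2.2⟩

/-- Trying an edge in both directions. -/
theorem run_scanEdge {s : Store} (hG : Encodes G n m s) (hMM : G.IsMatching M) (hMH : M ⊆ H)
    (hH : H = mask m (s SUB)) (h : SearchOK G n H M s) (he : s 36 0 ∈ H) :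
    SearchOK G n H M (scanEdge.run s) ∧
      ((Settled s (G.fst (s 36 0)) (G.snd (s 36 0)) ∧ Settled s (G.snd (s 36 0)) (G.fst (s 36 0)) ∧
        SameSearch s (scanEdge.run s)) ∨
      (¬ (Settled s (G.fst (s 36 0)) (G.snd (s 36 0)) ∧
          Settled s (G.snd (s 36 0)) (G.fst (s 36 0))) ∧
        remaining n (scanEdge.run s) < remaining n s)) := by
  have hHn : ∀ e ∈ H, G.fst e ∈ Finset.range n ∧ G.snd e ∈ Finset.range n := by
    intro e he
    rw [hH, mem_mask] at he
    exact ⟨by simpa using hG.fst_lt e he.1, by simpa using hG.snd_lt e he.1⟩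
  set e := s 36 0 with hedef
  obtain ⟨hem, hes⟩ := mem_mask.1 (hH ▸ he)
  have hfe : s EFST e = G.fst e := hG.fst e hem
  have hse : s ESND e = G.snd e := hG.snd e hem
  set s1 := (s.write XX 0 (G.fst e)).write YY 0 (G.snd e) with hs1
  have hOK1 : SearchOK G n H M s1 := by
    refine ⟨?_, ?_, ?_⟩
    · simpa [hs1] using h.isMate
    · simpa [hs1] using h.forest
    · simpa [hs1] using h.larger
  have hsame1 : SameSearch s s1 := by simp [SameSearch, hs1]
  have hn1 : s1 0 0 = n := by simp [hs1, hG.vertices]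
  have hr1 : s1 0 2 = 2 * n + 1 := by simp [hs1, hG.rounds]
  have hX1 : s1 XX 0 = G.fst e := by simp [hs1]
  have hY1 : s1 YY 0 = G.snd e := by simp [hs1]
  obtain ⟨hOK2, hset2, hlt2⟩ := run_extend hn1 hr1 hMM hMH hHn hOK1 he
    (by rw [hX1, hY1]; exact Or.inl ⟨rfl, rfl⟩)
  rw [hX1, hY1, Settled.of_same hsame1] at hset2 hlt2
  rw [remaining_of_same hsame1] at hlt2
  have hfr2 : ∀ a ∈ [0, EFST, ESND, 36], extend.run s1 a = s1 a := by
    intro a ha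
    refine run_of_notMem ?_ s1
    revert a
    decide
  set s2 := extend.run s1 with hs2
  set s3 := (s2.write XX 0 (G.snd e)).write YY 0 (G.fst e) with hs3
  have hOK3 : SearchOK G n H M s3 := by
    refine ⟨?_, ?_, ?_⟩
    · simpa [hs3] using hOK2.isMate
    · simpa [hs3] using hOK2.forest
    · simpa [hs3] using hOK2.larger
  have hsame3 : SameSearch s2 s3 := by simp [SameSearch, hs3]
  have hn3 : s3 0 0 = n := by simp [hs3, hfr2 0, hn1]
  have hr3 : s3 0 2 = 2 * n + 1 := by simp [hs3, hfr2 0, hr1]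
  have hX3 : s3 XX 0 = G.snd e := by simp [hs3]
  have hY3 : s3 YY 0 = G.fst e := by simp [hs3]
  obtain ⟨hOK4, hset4, hlt4⟩ := run_extend hn3 hr3 hMM hMH hHn hOK3 he
    (by rw [hX3, hY3]; exact Or.inr ⟨rfl, rfl⟩)
  rw [hX3, hY3, Settled.of_same hsame3] at hset4 hlt4
  rw [remaining_of_same hsame3] at hlt4
  have hrun : scanEdge.run s = extend.run s3 := by
    have e1 : s2 36 0 = e := by rw [hfr2 36 (by decide), hs1]; simp [hedef]
    have e2 : s2 EFST = s EFST := by rw [hfr2 EFST (by decide), hs1]; simp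
    have e3 : s2 ESND = s ESND := by rw [hfr2 ESND (by decide), hs1]; simp
    have e5 : s SUB (s 36 0) ≠ 0 := hes
    simp only [scanEdge, run, Expr.eval, ne_eq, e5, not_false_eq_true, if_true]
    simp only [Store.write_of_ne, ne_eq, Nat.reduceEqDiff, not_false_eq_true, ← hedef, hfe, hse,
      ← hs1, ← hs2, e1, e2, e3, hs3]
  rw [hrun]
  refine ⟨hOK4, ?_⟩
  by_cases hA : Settled s (G.fst e) (G.snd e)
  · have hsame2 := hsame1.trans (hset2 hA)
    rw [Settled.of_same hsame2] at hset4 hlt4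
    rw [remaining_of_same hsame2] at hlt4
    by_cases hB : Settled s (G.snd e) (G.fst e)
    · exact Or.inl ⟨hA, hB, hsame2.trans (hsame3.trans (hset4 hB))⟩
    · exact Or.inr ⟨fun h' => hB h'.2, hlt4 hB⟩
  · have h1 := hlt2 hA
    refine Or.inr ⟨fun h' => hA h'.1, ?_⟩
    by_cases hB : Settled s2 (G.snd e) (G.fst e)
    · rw [← remaining_of_same (n := n) (hsame3.trans (hset4 hB))] at h1
      exact h1
    · exact (hlt4 hB).trans h1

/-- No edge allows to extend the search forest. -/
def AllSettled (G : EdgeColoredGraph ℕ ℕ k) (H : Finset ℕ) (s : Store) : Prop :=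
  ∀ e ∈ H, Settled s (G.fst e) (G.snd e) ∧ Settled s (G.snd e) (G.fst e)

/-- As long as the visible arrays are unchanged, edges found to be settled stay so. A sweep without
progress has therefore checked all edges against one and the same forest; any other sweep lowers the
potential. -/
theorem run_sweep {s : Store} (hG : Encodes G n m s) (hMM : G.IsMatching M) (hMH : M ⊆ H)
    (hH : H = mask m (s SUB)) (h : SearchOK G n H M s) :
    SearchOK G n H M (sweep.run s) ∧ (AllSettled G H s → SameSearch s (sweep.run s)) ∧
      (¬ AllSettled G H s → remaining n (sweep.run s) < remaining n s) := by
  have key := run_loop (c := 36) (b := 1) (s := s) (p := scanEdge) (fun i s' =>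
    SearchOK G n H M s' ∧
      ((SameSearch s s' ∧ ∀ e ∈ H, e < i → Settled s (G.fst e) (G.snd e) ∧
        Settled s (G.snd e) (G.fst e)) ∨
      (¬ AllSettled G H s ∧ remaining n s' < remaining n s))) ?_ ?_
  · obtain ⟨h1, h2⟩ := key
    refine ⟨h1, fun hs => ?_, fun hs => ?_⟩
    · rcases h2 with h2 | h2
      · exact h2.1
      · exact absurd hs h2.1
    · rcases h2 with h2 | h2
      · refine absurd (fun e he => h2.2 e he ?_) hs
        rw [hG.edges]
        rw [hH, mem_mask] at he
        exact he.1
      · exact h2.2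
  · refine ⟨⟨?_, ?_, ?_⟩, Or.inl ⟨?_, by simp⟩⟩
    · simpa using h.isMate
    · simpa using h.forest
    · simpa using h.larger
    · simp [SameSearch]
  · rintro i s' hi hc hfr ⟨hOK, hI⟩
    rw [hG.edges] at hi
    have hGs' : Encodes G n m s' := hG.of_eq (hfr _ (by decide)) (hfr _ (by decide))
      (hfr _ (by decide))
    have hSUB : s' SUB = s SUB := hfr _ (by decide)
    suffices hsuff : SearchOK G n H M (scanEdge.run s') ∧
        ((SameSearch s (scanEdge.run s') ∧ ∀ e ∈ H, e < i + 1 →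
          Settled s (G.fst e) (G.snd e) ∧ Settled s (G.snd e) (G.fst e)) ∨
        (¬ AllSettled G H s ∧ remaining n (scanEdge.run s') < remaining n s)) by
      refine ⟨⟨?_, ?_, ?_⟩, ?_⟩
      · simpa using hsuff.1.isMate
      · simpa using hsuff.1.forest
      · simpa using hsuff.1.larger
      · simpa [SameSearch, remaining] using hsuff.2
    by_cases hiH : i ∈ H
    · obtain ⟨h1, h2⟩ := run_scanEdge hGs' hMM hMH (by rw [hSUB, hH]) hOK (by rw [hc]; exact hiH)
      rw [hc] at h2
      refine ⟨h1, ?_⟩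
      rcases hI with ⟨hI1, hI2⟩ | ⟨hI1, hI2⟩
      · rw [Settled.of_same hI1, Settled.of_same hI1, remaining_of_same hI1] at h2
        rcases h2 with ⟨h2, h3, h4⟩ | ⟨h2, h3⟩
        · refine Or.inl ⟨hI1.trans h4, fun e he hei => ?_⟩
          rcases Nat.lt_succ_iff_lt_or_eq.1 hei with hei | rfl
          · exact hI2 e he hei
          · exact ⟨h2, h3⟩
        · exact Or.inr ⟨fun hall => h2 (hall i hiH), h3⟩
      · refine Or.inr ⟨hI1, ?_⟩
        rcases h2 with ⟨h2, h3, h4⟩ | ⟨h2, h3⟩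
        · rw [remaining_of_same h4]
          exact hI2
        · exact h3.trans hI2
    · have hrun : scanEdge.run s' = s' := by
        have : s SUB i = 0 := by
          rw [hH, mem_mask] at hiH
          tauto
        simp [scanEdge, run, hc, hSUB, this]
      rw [hrun]
      refine ⟨hOK, hI.imp (fun hI => ⟨hI.1, fun e he hei => hI.2 e he ?_⟩) id⟩
      rcases Nat.lt_succ_iff_lt_or_eq.1 hei with hei | rfl
      · exact hei
      · exact absurd he hiH

/-- The potential starts at no more than 2n + 1, and every sweep lowers it unless all edges are
settled, so 2n + 1 sweeps suffice. A raised flag is backed by a larger matching; a settled forest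
without the flag excludes one. -/
theorem run_search {s : Store} (hG : Encodes G n m s) (hMM : G.IsMatching (mask m (s MAT)))
    (hMH : mask m (s MAT) ⊆ mask m (s SUB)) :
    search.run s AUG 0 ≠ 0 ↔
      ∃ N ⊆ mask m (s SUB), G.IsMatching N ∧ (mask m (s MAT)).card < N.card := by
  set H := mask m (s SUB) with hH
  set M := mask m (s MAT) with hM
  have hOK0 := run_initMate (H := H) hG hMM
  have hfr0 : ∀ a ∈ [0, EFST, ESND, SUB], initMate.run s a = s a := by
    intro a ha
    refine run_of_notMem ?_ s
    revert a
    decide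
  have hG0 : Encodes G n m (initMate.run s) :=
    hG.of_eq (hfr0 _ (by decide)) (hfr0 _ (by decide)) (hfr0 _ (by decide))
  have key := run_loop (c := 37) (b := 2) (s := initMate.run s) (p := sweep) (fun i s' =>
    SearchOK G n H M s' ∧ (AllSettled G H s' ∨ remaining n s' + i ≤ 2 * n + 1)) ?_ ?_
  · rw [hG0.rounds] at key
    obtain ⟨hOK, hset⟩ := key
    have hrun : search.run s = (Cmd.loop 37 2 sweep).run (initMate.run s) := rfl
    rw [hrun]
    set s' := (Cmd.loop 37 2 sweep).run (initMate.run s)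
    refine ⟨hOK.larger, ?_⟩
    rintro ⟨N, hNH, hN, hlt⟩ hA
    have hset : AllSettled G H s' := by
      -- While `AUG` is 0 the potential is at least 1, so it cannot have dropped 2n + 1 times.
      refine hset.resolve_right fun hr => ?_
      simp only [remaining, hA, if_true] at hr
      omega
    have hHn : ∀ e ∈ H, G.fst e ∈ Finset.range n ∧ G.snd e ∈ Finset.range n := by
      intro e he
      rw [hH, mem_mask] at he
      exact ⟨by simpa using hG.fst_lt e he.1, by simpa using hG.snd_lt e he.1⟩
    have := hOK.forest.card_le hOK.isMate hMM hMH hHn (fun e he x y hj hsx => ?_) hN hNH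
    · omega
    · obtain ⟨h1, h2⟩ := hset e he
      rcases hj with ⟨rfl, rfl⟩ | ⟨rfl, rfl⟩
      · exact (h1.resolve_left (not_not.2 hA)) hsx
      · exact (h2.resolve_left (not_not.2 hA)) hsx
  · refine ⟨⟨?_, ?_, ?_⟩, Or.inr ?_⟩
    · simpa using hOK0.isMate
    · simpa using hOK0.forest
    · simpa using hOK0.larger
    · have := potential_le (vs := Finset.range n) (base := initMate.run s BASE)
        (st := initMate.run s STAT)
      rw [Finset.card_range] at this
      simp only [remaining, Store.write_of_ne, ne_eq, Nat.reduceEqDiff, not_false_eq_true]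
      split_ifs <;> omega
  · rintro i s' hi hc hfr ⟨hOK, hI⟩
    have hGs' : Encodes G n m s' := hG0.of_eq (hfr _ (by decide)) (hfr _ (by decide))
      (hfr _ (by decide))
    have hSUB : s' SUB = s SUB := by rw [hfr _ (by decide), hfr0 _ (by decide)]
    obtain ⟨h1, h2, h3⟩ := run_sweep hGs' hMM hMH (by rw [hSUB]) hOK
    refine ⟨⟨?_, ?_, ?_⟩, ?_⟩
    · simpa using h1.isMate
    · simpa using h1.forest
    · simpa using h1.larger
    · have hsame : SameSearch (sweep.run s') ((sweep.run s').write 37 0 (i + 1)) := by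
        simp [SameSearch]
      rw [remaining_of_same hsame]
      by_cases hall : AllSettled G H s'
      · left
        intro e he
        rw [Settled.of_same ((h2 hall).trans hsame), Settled.of_same ((h2 hall).trans hsame)]
        exact hall e he
      · right
        have := h3 hall
        have := hI.resolve_left hall
        omega

end Cmd

end Ram

/-! ### From the decision procedure to a larger matching -/

namespace EdgeColoredGraph

/-- If every edge of `H` outside of the matching `M` is indispensable for matchings in `H` larger
than `M`, then these edges and the edges of `M` disjoint from them form a larger matching. -/
theorem isMatching_exchange {V E : Type*} [DecidableEq V] [DecidableEq E] {k : ℕ}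
    {G : EdgeColoredGraph V E k} {H M R : Finset E} (hM : G.IsMatching M)
    (hex : ∃ N ⊆ H, G.IsMatching N ∧ M.card < N.card)
    (hmin : ∀ e ∈ H, e ∉ M → ¬ ∃ N ⊆ H.erase e, G.IsMatching N ∧ M.card < N.card)
    (hR : ∀ e, e ∈ R ↔ e ∈ H ∧ (e ∈ M → ∀ f ∈ H, f ∉ M → ∀ v, G.Incident e v →
      ¬ G.Incident f v)) :
    G.IsMatching R ∧ M.card < R.card := by
  obtain ⟨N, hNH, hN, hlt⟩ := hex
  -- Every edge of H outside M lies in N, for otherwise N would be a larger matching avoiding it. In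
  -- particular these edges are pairwise disjoint.
  have hsub : ∀ e ∈ H, e ∉ M → e ∈ N := by
    intro e he heM
    by_contra heN
    refine hmin e he heM ⟨N, fun f hf => Finset.mem_erase.2 ⟨?_, hNH hf⟩, hN, hlt⟩
    rintro rfl
    exact heN hf
  -- An edge of M belonging to N cannot touch an edge of H outside M, as the latter belongs to N
  -- too.
  have hNR : N ⊆ R := by
    intro e he
    refine (hR e).2 ⟨hNH he, fun heM f hf hfM v hev hfv => hfM ?_⟩
    have := hN v e he f (hsub f hf hfM) hev hfv
    exact this ▸ heM
  refine ⟨?_, hlt.trans_le (Finset.card_le_card hNR)⟩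
  intro v e he f hf hev hfv
  obtain ⟨heH, he'⟩ := (hR e).1 he
  obtain ⟨hfH, hf'⟩ := (hR f).1 hf
  by_cases heM : e ∈ M
  · by_cases hfM : f ∈ M
    · exact hM v e heM f hfM hev hfv
    · exact absurd hfv (he' heM f hfH hfM v hev)
  · by_cases hfM : f ∈ M
    · exact absurd hev (hf' hfM e heH heM v hfv)
    · exact hN v e (hsub e heH heM) f (hsub f hfH hfM) hev hfv

end EdgeColoredGraph

namespace Ram.Cmd

open EdgeColoredGraph

/-- Copy the first cells of array `a` to array `b`. -/
def copy (c a b : ℕ) : Cmd := .loop c 1 (.write b (.var c) (.read a (.var c)))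

/-- Delete edges from `SUB` as long as the matching `MAT` is not maximum. -/
def prune : Cmd :=
  .loop 38 1 (.ite (.and (.read SUB (.var 38)) (.not (.read MAT (.var 38))))
    (.seq (.write SUB (.var 38) (.const 0))
    (.seq search (.ite (.var AUG) .skip (.write SUB (.var 38) (.const 1))))) .skip)

/-- The edges in the scalars `c` and `d` share an endpoint. -/
def adjacent (c d : ℕ) : Expr :=
  .add (.add (.eq (.read EFST (.var c)) (.read EFST (.var d)))
      (.eq (.read EFST (.var c)) (.read ESND (.var d))))
    (.add (.eq (.read ESND (.var c)) (.read EFST (.var d)))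
      (.eq (.read ESND (.var c)) (.read ESND (.var d))))

/-- Compute the edges of `SUB` that are not in `MAT` or are disjoint from all edges of `SUB`
that are not in `MAT`. -/
def exchange : Cmd :=
  .seq (copy 40 SUB NEW)
  (.loop 41 1 (.loop 42 1 (.ite (.and (.read MAT (.var 41)) (.and (.and (.read SUB (.var 42))
    (.not (.read MAT (.var 42)))) (adjacent 41 42)))
    (.write NEW (.var 41) (.const 0)) .skip)))

/-- Replace the matching `MAT` by a larger one within `ACT` if there is one. -/
def improve : Cmd :=
  .seq (copy 39 ACT SUB)
  (.seq search (.ite (.var AUG) (.seq prune (.seq exchange (copy 43 NEW MAT))) .skip))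

/-- Compute a maximum matching within `ACT`. -/
def maximize : Cmd :=
  .seq (.loop 44 1 (.write MAT (.var 44) (.const 0))) (.loop 45 1 improve)

def sameColor : Cmd :=
  .loop 47 1 (.write ACT (.var 47) (.eq (.read ECOL (.var 47)) (.read ECOL (.var 46))))

/-- Compute a maximum matching for the color of one edge. -/
def colorPass : Cmd :=
  .seq sameColor
  (.seq maximize
  (.loop 48 1 (.ite (.read ACT (.var 48)) (.write UNION (.var 48) (.read MAT (.var 48))) .skip)))

/-- Compute the union of maximum matchings for all colors. -/
def collect : Cmd := .loop 46 1 colorPass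

variable {k : ℕ} {G : EdgeColoredGraph ℕ ℕ k} {n m : ℕ}

theorem run_copy {c a b : ℕ} {s : Store} (hac : a ≠ c) (hbc : b ≠ c) (hab : a ≠ b)
    {v : ℕ} (hv : v < s 0 1) : (copy c a b).run s b v = s a v := by
  refine run_loop (c := c) (b := 1) (s := s) (p := .write b (.var c) (.read a (.var c)))
    (fun i s' => ∀ v < i, s' b v = s a v) (by simp) ?_ v hv
  intro i s' hi hc hfr hI v hv
  have ha : s' a = s a := hfr a (by simp [writes, hac, hab])
  have := hI v
  simp only [run, Expr.eval, hc, ha, Store.write_self, Store.write_of_ne, hbc, ne_eq,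
    not_false_eq_true, Function.update_apply]
  grind

theorem mask_congr {m : ℕ} {a b : ℕ → ℕ} (h : ∀ e < m, a e ≠ 0 ↔ b e ≠ 0) :
    mask m a = mask m b := by
  ext e
  rw [mem_mask, mem_mask]
  exact and_congr_right (h e)

theorem mask_update_zero {m i : ℕ} {a : ℕ → ℕ} :
    mask m (Function.update a i 0) = (mask m a).erase i := by
  ext e
  simp only [mem_mask, Finset.mem_erase, Function.update_apply]
  grind

/-- A single pass suffices: an edge that was indispensable when tested remains so when `SUB` shrinks
further. Edges of the current matching are never deleted. -/
theorem run_prune {s : Store} (hG : Encodes G n m s) (hMM : G.IsMatching (mask m (s MAT)))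
    (hMH : mask m (s MAT) ⊆ mask m (s SUB))
    (hex : ∃ N ⊆ mask m (s SUB), G.IsMatching N ∧ (mask m (s MAT)).card < N.card) :
    mask m (s MAT) ⊆ mask m (prune.run s SUB) ∧ mask m (prune.run s SUB) ⊆ mask m (s SUB) ∧
      (∃ N ⊆ mask m (prune.run s SUB), G.IsMatching N ∧ (mask m (s MAT)).card < N.card) ∧
      ∀ e ∈ mask m (prune.run s SUB), e ∉ mask m (s MAT) →
        ¬ ∃ N ⊆ (mask m (prune.run s SUB)).erase e,
          G.IsMatching N ∧ (mask m (s MAT)).card < N.card := by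
  set M := mask m (s MAT) with hM
  have key := run_loop (c := 38) (b := 1) (s := s)
    (p := .ite (.and (.read SUB (.var 38)) (.not (.read MAT (.var 38))))
    (.seq (.write SUB (.var 38) (.const 0))
    (.seq search (.ite (.var AUG) .skip (.write SUB (.var 38) (.const 1))))) .skip)
    (fun i s' => M ⊆ mask m (s' SUB) ∧ mask m (s' SUB) ⊆ mask m (s SUB) ∧
      (∃ N ⊆ mask m (s' SUB), G.IsMatching N ∧ M.card < N.card) ∧
      ∀ e ∈ mask m (s' SUB), e < i → e ∉ M → ¬ ∃ N ⊆ (mask m (s' SUB)).erase e,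
          G.IsMatching N ∧ M.card < N.card) ?_ ?_
  · rw [hG.edges] at key
    exact ⟨key.1, key.2.1, key.2.2.1, fun e he => key.2.2.2 e he (mem_mask.1 he).1⟩
  · simpa using ⟨hMH, hex⟩
  · rintro i s' hi hc hfr ⟨h1, h2, h3, h4⟩
    rw [hG.edges] at hi
    have hMAT : s' MAT = s MAT := hfr _ (by decide)
    by_cases hcond : s' SUB i ≠ 0 ∧ s MAT i = 0
    · have hiM : i ∉ M := by simp [hM, mem_mask, hcond.2]
      set s1 := s'.write SUB i 0 with hs1
      have hG1 : Encodes G n m s1 := hG.of_eq (by simpa [hs1] using hfr 0 (by decide))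
        (by simpa [hs1] using hfr EFST (by decide)) (by simpa [hs1] using hfr ESND (by decide))
      have hS1 : mask m (s1 SUB) = (mask m (s' SUB)).erase i := by
        simp only [hs1, Store.write_self, mask_update_zero]
      have hM1 : mask m (s1 MAT) = M := by simp [hs1, hMAT, hM]
      have hMS1 : M ⊆ (mask m (s' SUB)).erase i := by
        intro e he
        exact Finset.mem_erase.2 ⟨fun h' => hiM (h' ▸ he), h1 he⟩
      have hsearch := run_search hG1 (hM1 ▸ hMM) (by rw [hM1, hS1]; exact hMS1)
      rw [hS1, hM1] at hsearch
      have hfr2 : ∀ a ∈ [SUB, 38], search.run s1 a = s1 a := by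
        intro a ha
        refine run_of_notMem ?_ s1
        revert a
        decide
      have hc1 : s1 38 0 = i := by simpa [hs1] using hc
      set s2 := search.run s1 with hs2
      have hc2 : s2 38 0 = i := by rw [hfr2 38 (by decide), hc1]
      have hS2 : s2 SUB = s1 SUB := hfr2 _ (by decide)
      by_cases hA : s2 AUG 0 = 0
      -- The flag is down, so no larger matching survives the deletion of edge i, and the edge is
      -- restored.
      · have hrun : (Cmd.ite (.and (.read SUB (.var 38)) (.not (.read MAT (.var 38))))
            (.seq (.write SUB (.var 38) (.const 0)) (.seq search (.ite (.var AUG) .skip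
              (.write SUB (.var 38) (.const 1))))) .skip).run s' = s2.write SUB i 1 := by
          simp [run, hc, hMAT, hcond, ← hs1, ← hs2, hA, hc2]
        rw [hrun]
        have hmask : mask m (((s2.write SUB i 1).write 38 0 (i + 1)) SUB) = mask m (s' SUB) := by
          refine mask_congr fun e he => ?_
          simp only [hS2, hs1, Store.write_self, Store.write_of_ne, ne_eq, Nat.reduceEqDiff,
            not_false_eq_true, Function.update_apply]
          split_ifs with h
          · simp [h, hcond.1]
          · simp
        rw [hmask]
        refine ⟨h1, h2, h3, fun e he hei heM => ?_⟩
        rcases Nat.lt_succ_iff_lt_or_eq.1 hei with hei | rfl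
        · exact h4 e he hei heM
        · exact fun h' => hsearch.2 h' hA
      · have hrun : (Cmd.ite (.and (.read SUB (.var 38)) (.not (.read MAT (.var 38))))
            (.seq (.write SUB (.var 38) (.const 0)) (.seq search (.ite (.var AUG) .skip
              (.write SUB (.var 38) (.const 1))))) .skip).run s' = s2 := by
          simp [run, hc, hMAT, hcond, ← hs1, ← hs2, hA]
        rw [hrun]
        simp only [Store.write_of_ne, ne_eq, Nat.reduceEqDiff, not_false_eq_true, hS2, hS1]
        refine ⟨hMS1, (Finset.erase_subset _ _).trans h2, hsearch.1 hA, ?_⟩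
        intro e he hei heM hN
        obtain ⟨he1, he2⟩ := Finset.mem_erase.1 he
        obtain ⟨N, hN1, hN2⟩ := hN
        exact h4 e he2 (by omega) heM
          ⟨N, hN1.trans (Finset.erase_subset_erase _ (Finset.erase_subset _ _)), hN2⟩
    · have hrun : (Cmd.ite (.and (.read SUB (.var 38)) (.not (.read MAT (.var 38))))
          (.seq (.write SUB (.var 38) (.const 0)) (.seq search (.ite (.var AUG) .skip
            (.write SUB (.var 38) (.const 1))))) .skip).run s' = s' := by
        have : ¬ (s' SUB i ≠ 0 ∧ (if s MAT i = 0 then 1 else 0) ≠ 0) := by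
          intro h'
          exact hcond ⟨h'.1, by simpa using h'.2⟩
        simp only [run, Expr.eval_and, Expr.eval_not, Expr.eval, hc, hMAT, this, if_false, ne_eq,
          not_true_eq_false]
      rw [hrun]
      simp only [Store.write_of_ne, ne_eq, Nat.reduceEqDiff, not_false_eq_true]
      refine ⟨h1, h2, h3, fun e he hei heM => ?_⟩
      rcases Nat.lt_succ_iff_lt_or_eq.1 hei with hei | rfl
      · exact h4 e he hei heM
      · refine absurd ⟨(mem_mask.1 he).2, ?_⟩ hcond
        by_contra h'
        exact heM (mem_mask.2 ⟨hi, h'⟩)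

theorem run_exchange {s : Store} (hG : Encodes G n m s) {e : ℕ} :
    e ∈ mask m (exchange.run s NEW) ↔ e ∈ mask m (s SUB) ∧ (e ∈ mask m (s MAT) →
      ∀ f ∈ mask m (s SUB), f ∉ mask m (s MAT) → ∀ v, G.Incident e v → ¬ G.Incident f v) := by
  set s1 := (copy 40 SUB NEW).run s with hs1
  have hN1 : ∀ e < m, s1 NEW e = s SUB e := by
    intro e he
    exact run_copy (by decide) (by decide) (by decide) (by rwa [hG.edges])
  have hfr1 : ∀ a ∉ [40, NEW], s1 a = s a := fun a ha => run_of_notMem ha s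
  have hG1 : Encodes G n m s1 := hG.of_eq (hfr1 _ (by decide)) (hfr1 _ (by decide))
    (hfr1 _ (by decide))
  have hrun : exchange.run s = (Cmd.loop 41 1 (.loop 42 1 (.ite (.and (.read MAT (.var 41))
    (.and (.and (.read SUB (.var 42)) (.not (.read MAT (.var 42)))) (adjacent 41 42)))
    (.write NEW (.var 41) (.const 0)) .skip))).run s1 := rfl
  rw [hrun]
  have key := run_loop (c := 41) (b := 1) (s := s1) (p := .loop 42 1 (.ite
    (.and (.read MAT (.var 41))
    (.and (.and (.read SUB (.var 42)) (.not (.read MAT (.var 42)))) (adjacent 41 42)))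
    (.write NEW (.var 41) (.const 0)) .skip)) (fun i s' => ∀ e < m, s' NEW e ≠ 0 ↔ s SUB e ≠ 0 ∧
      (e < i → e ∈ mask m (s MAT) → ∀ f < m, f ∈ mask m (s SUB) → f ∉ mask m (s MAT) →
        ∀ v, G.Incident e v → ¬ G.Incident f v)) ?_ ?_
  · rw [hG1.edges] at key
    rw [mem_mask, mem_mask]
    constructor
    · rintro ⟨h1, h2⟩
      obtain ⟨h3, h4⟩ := (key e h1).1 h2
      exact ⟨⟨h1, h3⟩, fun h5 f hf => h4 h1 h5 f (mem_mask.1 hf).1 hf⟩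
    · rintro ⟨⟨h1, h2⟩, h3⟩
      exact ⟨h1, (key e h1).2 ⟨h2, fun _ h5 f _ hf => h3 h5 f hf⟩⟩
  · intro e he
    simp [hN1 e he]
  · intro i s' hi hc hfr hI
    rw [hG1.edges] at hi
    have key2 := run_loop (c := 42) (b := 1) (s := s') (p := .ite (.and (.read MAT (.var 41))
      (.and (.and (.read SUB (.var 42)) (.not (.read MAT (.var 42)))) (adjacent 41 42)))
      (.write NEW (.var 41) (.const 0)) .skip) (fun j s'' => ∀ e < m, s'' NEW e ≠ 0 ↔
        s' NEW e ≠ 0 ∧ (e = i → e ∈ mask m (s MAT) → ∀ f < j, f ∈ mask m (s SUB) →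
          f ∉ mask m (s MAT) → ∀ v, G.Incident e v → ¬ G.Incident f v)) ?_ ?_
    · rw [hfr 0 (by decide), hG1.edges] at key2
      intro e he
      rw [Store.write_of_ne _ _ _ (by decide), key2 e he, hI e he, and_assoc]
      refine and_congr_right fun _ => ⟨?_, ?_⟩
      · rintro ⟨h1, h2⟩ hei
        rcases Nat.lt_succ_iff_lt_or_eq.1 hei with hei | hei
        · exact h1 hei
        · exact h2 hei
      · exact fun h => ⟨fun h' => h (by omega), fun h' => h (by omega)⟩
    · intro e he
      simp
    · intro j s'' hj hc2 hfr2 hI2 e he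
      have hc1 : s'' 41 0 = i := by rw [hfr2 41 (by decide), hc]
      have hMAT : s'' MAT = s MAT := by
        rw [hfr2 _ (by decide), hfr _ (by decide), hfr1 _ (by decide)]
      have hSUB : s'' SUB = s SUB := by
        rw [hfr2 _ (by decide), hfr _ (by decide), hfr1 _ (by decide)]
      have hF : s'' EFST = s EFST := by
        rw [hfr2 _ (by decide), hfr _ (by decide), hfr1 _ (by decide)]
      have hS : s'' ESND = s ESND := by
        rw [hfr2 _ (by decide), hfr _ (by decide), hfr1 _ (by decide)]
      rw [hfr 0 (by decide), hG1.edges] at hj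
      have hadj : (adjacent 41 42).eval s'' ≠ 0 ↔ ∃ v, G.Incident i v ∧ G.Incident j v := by
        simp only [adjacent, Expr.eval, Expr.eval_eq, hc1, hc2, hF, hS, hG.fst i hi, hG.snd i hi,
          hG.fst j hj, hG.snd j hj, Incident]
        constructor
        · intro h
          by_contra! hcon
          have h1 := hcon (G.fst i)
          have h2 := hcon (G.snd i)
          simp only [true_or, or_true, forall_const] at h1 h2
          simp [Ne.symm h1.1, Ne.symm h1.2, Ne.symm h2.1, Ne.symm h2.2] at h
        · rintro ⟨v, rfl | rfl, h | h⟩ <;> simp [h]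
      have hcond : (Expr.and (.read MAT (.var 41)) (.and (.and (.read SUB (.var 42))
          (.not (.read MAT (.var 42)))) (adjacent 41 42))).eval s'' ≠ 0 ↔
          i ∈ mask m (s MAT) ∧ j ∈ mask m (s SUB) ∧ j ∉ mask m (s MAT) ∧
            ∃ v, G.Incident i v ∧ G.Incident j v := by
        rw [← hadj]
        simp only [Expr.eval_and, Expr.eval_not, Expr.eval, hc1, hc2, hMAT, hSUB, mem_mask, hi,
          hj, true_and]
        grind
      rw [Store.write_of_ne _ _ _ (by decide)]
      simp only [run]
      have hIe := hI2 e he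
      split_ifs with h
      · have h := hcond.1 h
        simp only [Expr.eval, hc1, Store.write_self, Function.update_apply]
        by_cases hei : e = i
        · subst hei
          simp only [if_true, ne_eq, not_true_eq_false, false_iff, not_and]
          intro _ h'
          obtain ⟨v, h1, h2⟩ := h.2.2.2
          exact h' trivial h.1 j (by omega) h.2.1 h.2.2.1 v h1 h2
        · simpa [hei] using hIe
      · have h := mt hcond.2 h
        rw [hIe]
        refine and_congr_right fun _ => ?_
        constructor
        · intro h1 hei heM f hf hfS hfM v hev hfv
          rcases Nat.lt_succ_iff_lt_or_eq.1 hf with hf | rfl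
          · exact h1 hei heM f hf hfS hfM v hev hfv
          · subst hei
            exact h ⟨heM, hfS, hfM, v, hev, hfv⟩
        · exact fun h1 hei heM f hf => h1 hei heM f (by omega)

end Ram.Cmd

/-! ### Maximum matchings in all color classes -/

namespace Ram.Cmd

open EdgeColoredGraph

variable {k : ℕ} {G : EdgeColoredGraph ℕ ℕ k} {n m : ℕ}

/-- If the search reports a larger matching, pruning makes all surviving edges outside `MAT`
indispensable, and `isMatching_exchange` turns the survivors into one. Otherwise the present
matching is optimal within `ACT`. -/
theorem run_improve {s : Store} (hG : Encodes G n m s) (hMM : G.IsMatching (mask m (s MAT)))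
    (hMA : mask m (s MAT) ⊆ mask m (s ACT)) :
    G.IsMatching (mask m (improve.run s MAT)) ∧
      mask m (improve.run s MAT) ⊆ mask m (s ACT) ∧
      ((mask m (s MAT)).card < (mask m (improve.run s MAT)).card ∨
        mask m (improve.run s MAT) = mask m (s MAT) ∧
        ∀ N ⊆ mask m (s ACT), G.IsMatching N → N.card ≤ (mask m (s MAT)).card) := by
  set s1 := (copy 39 ACT SUB).run s with hs1
  have hS1 : mask m (s1 SUB) = mask m (s ACT) := by
    refine mask_congr fun e he => ?_
    rw [hs1, run_copy (by decide) (by decide) (by decide) (by rwa [hG.edges])]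
  have hfr1 : ∀ a ∉ [39, SUB], s1 a = s a := fun a ha => run_of_notMem ha s
  have hG1 : Encodes G n m s1 := hG.of_eq (hfr1 _ (by decide)) (hfr1 _ (by decide))
    (hfr1 _ (by decide))
  have hM1 : s1 MAT = s MAT := hfr1 _ (by decide)
  have hsearch := run_search hG1 (by rwa [hM1]) (by rwa [hM1, hS1])
  set s2 := search.run s1 with hs2
  have hfr2 : ∀ a ∈ [0, EFST, ESND, ACT, SUB, MAT], s2 a = s1 a := by
    intro a ha
    refine run_of_notMem ?_ s1
    revert a
    decide
  have hM2 : s2 MAT = s MAT := by rw [hfr2 _ (by decide), hM1]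
  have hS2 : mask m (s2 SUB) = mask m (s ACT) := by rw [hfr2 _ (by decide), hS1]
  have hG2 : Encodes G n m s2 := hG1.of_eq (hfr2 _ (by decide)) (hfr2 _ (by decide))
    (hfr2 _ (by decide))
  rw [hS1, hM1] at hsearch
  by_cases hA : s2 AUG 0 = 0
  · have hrun : improve.run s = s2 := by
      simp [improve, run, ← hs1, ← hs2, hA]
    rw [hrun, hM2]
    refine ⟨hMM, hMA, Or.inr ⟨rfl, fun N hN hNM => ?_⟩⟩
    by_contra hlt
    exact hsearch.2 ⟨N, hN, hNM, by omega⟩ hA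
  · have hrun : improve.run s = (copy 43 NEW MAT).run (exchange.run (prune.run s2)) := by
      simp [improve, run, ← hs1, ← hs2, hA]
    obtain ⟨h1, h2, h3, h4⟩ := run_prune hG2 (by rwa [hM2]) (by rwa [hM2, hS2])
      (by rw [hM2, hS2]; exact hsearch.1 hA)
    rw [hM2] at h1 h3 h4
    rw [hS2] at h2
    set s3 := prune.run s2 with hs3
    have hfr3 : ∀ a ∈ [0, EFST, ESND, MAT], s3 a = s2 a := by
      intro a ha
      refine run_of_notMem ?_ s2
      revert a
      decide
    have hG3 : Encodes G n m s3 := hG2.of_eq (hfr3 _ (by decide)) (hfr3 _ (by decide))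
      (hfr3 _ (by decide))
    have hR : ∀ e, e ∈ mask m (exchange.run s3 NEW) ↔ _ := fun e => run_exchange hG3
    rw [hfr3 MAT (by decide), hM2] at hR
    obtain ⟨h5, h6⟩ := isMatching_exchange hMM h3 h4 hR
    have hfinal : mask m (improve.run s MAT) = mask m (exchange.run s3 NEW) := by
      rw [hrun]
      refine mask_congr fun e he => ?_
      rw [run_copy (by decide) (by decide) (by decide)]
      rw [run_of_notMem (by decide), hG3.edges]
      exact he
    rw [hfinal]
    exact ⟨h5, fun e he => h2 ((hR e).1 he).1, Or.inl h6⟩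

/-- After i rounds the matching is optimal or has at least i edges. As no matching has more than m
edges, m rounds are enough. -/
theorem run_maximize {s : Store} (hG : Encodes G n m s) :
    G.IsMaximumMatchingIn (mask m (s ACT)) (mask m (maximize.run s MAT)) := by
  have h1 := run_loop (c := 44) (b := 1) (s := s) (p := .write MAT (.var 44) (.const 0))
    (fun i s' => ∀ e < i, s' MAT e = 0) (by simp) (by
      intro i s' hi hc hfr hI e he
      have := hI e
      simp only [run, Expr.eval, hc, Store.write_self, Store.write_of_ne, ne_eq,
        Nat.reduceEqDiff, not_false_eq_true, Function.update_apply]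
      grind)
  rw [hG.edges] at h1
  have hrun : maximize.run s = (Cmd.loop 45 1 improve).run
    ((Cmd.loop 44 1 (.write MAT (.var 44) (.const 0))).run s) := rfl
  rw [hrun]
  set s1 := (Cmd.loop 44 1 (.write MAT (.var 44) (.const 0))).run s with hs1
  have hfr1 : ∀ a ∉ [44, MAT], s1 a = s a := fun a ha => run_of_notMem ha s
  have hG1 : Encodes G n m s1 := hG.of_eq (hfr1 _ (by decide)) (hfr1 _ (by decide))
    (hfr1 _ (by decide))
  have hA1 : s1 ACT = s ACT := hfr1 _ (by decide)
  have hM1 : mask m (s1 MAT) = ∅ := by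
    ext e
    simp only [mem_mask, Finset.notMem_empty, iff_false, not_and, not_not]
    exact h1 e
  have key := run_loop (c := 45) (b := 1) (s := s1) (p := improve) (fun i s' =>
    G.IsMatching (mask m (s' MAT)) ∧ mask m (s' MAT) ⊆ mask m (s ACT) ∧
      (i ≤ (mask m (s' MAT)).card ∨
        ∀ N ⊆ mask m (s ACT), G.IsMatching N → N.card ≤ (mask m (s' MAT)).card)) ?_ ?_
  · rw [hG1.edges] at key
    refine ⟨key.2.1, key.1, ?_⟩
    rcases key.2.2 with h | h
    · intro N hN _
      refine le_trans ?_ h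
      have := Finset.card_le_card (hN.trans (Finset.filter_subset _ _))
      rwa [Finset.card_range] at this
    · exact h
  · refine ⟨?_, ?_, Or.inl (Nat.zero_le _)⟩
    · rw [Store.write_of_ne _ _ _ (by decide), hM1]
      simp [IsMatching]
    · rw [Store.write_of_ne _ _ _ (by decide), hM1]
      simp
  · rintro i s' hi hc hfr ⟨hI1, hI2, hI3⟩
    have hG' : Encodes G n m s' := hG1.of_eq (hfr _ (by decide)) (hfr _ (by decide))
      (hfr _ (by decide))
    have hA' : s' ACT = s ACT := by rw [hfr _ (by decide), hA1]
    obtain ⟨h2, h3, h4⟩ := run_improve hG' hI1 (by rwa [hA'])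
    rw [hA'] at h3 h4
    rw [Store.write_of_ne _ _ _ (by decide)]
    refine ⟨h2, h3, ?_⟩
    rcases h4 with h4 | ⟨h4, h5⟩
    · rcases hI3 with hI3 | hI3
      · exact Or.inl (by omega)
      · exact Or.inr fun N hN hNM => (hI3 N hN hNM).trans h4.le
    · exact Or.inr (by rwa [h4])

/-- The edges with the same color as edge `j`. -/
def colorMask (m : ℕ) (col : ℕ → ℕ) (j : ℕ) : Finset ℕ :=
  (Finset.range m).filter (col · = col j)

theorem run_colorPass {s : Store} (hG : Encodes G n m s) {j : ℕ} (hj : s 46 0 = j) :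
    G.IsMaximumMatchingIn (colorMask m (s ECOL) j)
        ((mask m (colorPass.run s UNION)).filter (s ECOL · = s ECOL j)) ∧
      ∀ e, s ECOL e ≠ s ECOL j → colorPass.run s UNION e = s UNION e := by
  have h1 := run_loop (c := 47) (b := 1) (s := s)
    (p := .write ACT (.var 47) (.eq (.read ECOL (.var 47)) (.read ECOL (.var 46))))
    (fun i s' => ∀ e < i, s' ACT e = if s ECOL e = s ECOL j then 1 else 0) (by simp) (by
      intro i s' hi hc hfr hI e he
      have hE : s' ECOL = s ECOL := hfr _ (by decide)
      have hj' : s' 46 0 = j := by rw [hfr _ (by decide), hj]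
      have := hI e
      simp only [run, Expr.eval, Expr.eval_eq, hc, hE, hj', Store.write_self, Store.write_of_ne,
        ne_eq, Nat.reduceEqDiff, not_false_eq_true, Function.update_apply]
      grind)
  rw [hG.edges] at h1
  have hrun : colorPass.run s = (Cmd.loop 48 1 (.ite (.read ACT (.var 48))
      (.write UNION (.var 48) (.read MAT (.var 48))) .skip)).run
      (maximize.run (sameColor.run s)) := rfl
  rw [hrun]
  change ∀ e < m, sameColor.run s ACT e = _ at h1
  set s1 := sameColor.run s with hs1
  have hfr1 : ∀ a ∉ [47, ACT], s1 a = s a := fun a ha => run_of_notMem ha s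
  have hG1 : Encodes G n m s1 := hG.of_eq (hfr1 _ (by decide)) (hfr1 _ (by decide))
    (hfr1 _ (by decide))
  have hmask : mask m (s1 ACT) = colorMask m (s ECOL) j := by
    ext e
    simp only [mem_mask, colorMask, Finset.mem_filter, Finset.mem_range]
    refine and_congr_right fun he => ?_
    rw [h1 e he]
    simp
  have hmax := run_maximize hG1
  rw [hmask] at hmax
  set s2 := maximize.run s1 with hs2
  have hfr2 : ∀ a ∈ [0, ECOL, ACT, UNION], s2 a = s1 a := by
    intro a ha
    refine run_of_notMem ?_ s1
    revert a
    decide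
  have hact : ∀ e < m, s2 ACT e = if s ECOL e = s ECOL j then 1 else 0 := by
    rw [hfr2 _ (by decide)]
    exact h1
  have key := run_loop (c := 48) (b := 1) (s := s2) (p := .ite (.read ACT (.var 48))
      (.write UNION (.var 48) (.read MAT (.var 48))) .skip) (fun i s' => ∀ e, s' UNION e =
        if e < i ∧ s ECOL e = s ECOL j then s2 MAT e else s UNION e) (by
      intro e
      simp only [Store.write_of_ne, ne_eq, Nat.reduceEqDiff, not_false_eq_true, Nat.not_lt_zero,
        false_and, if_false]
      rw [hfr2 _ (by decide), hfr1 _ (by decide)]) (by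
      intro i s' hi hc hfr hI e
      rw [hfr2 0 (by decide), hG1.edges] at hi
      have hA' : s' ACT i = if s ECOL i = s ECOL j then 1 else 0 := by
        rw [hfr _ (by decide), hact i hi]
      have hM' : s' MAT = s2 MAT := hfr _ (by decide)
      have := hI e
      simp only [run, Expr.eval, hc, hA', hM']
      by_cases hi : s ECOL i = s ECOL j
      · simp only [hi, if_true, ne_eq, one_ne_zero, not_false_eq_true, Store.write_self,
          Store.write_of_ne, Nat.reduceEqDiff, Function.update_apply]
        grind
      · simp only [hi, if_false, ne_eq, not_true_eq_false,
          Store.write_of_ne, Nat.reduceEqDiff, not_false_eq_true]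
        grind)
  rw [hfr2 0 (by decide), hG1.edges] at key
  constructor
  · convert hmax using 1
    ext e
    simp only [Finset.mem_filter, mem_mask]
    constructor
    · rintro ⟨⟨he, h2⟩, h3⟩
      rw [key, if_pos ⟨he, h3⟩] at h2
      exact ⟨he, h2⟩
    · rintro ⟨he, h2⟩
      have h3 := hmax.1 (mem_mask.2 ⟨he, h2⟩)
      simp only [colorMask, Finset.mem_filter] at h3
      refine ⟨⟨he, ?_⟩, h3.2⟩
      rwa [key, if_pos ⟨he, h3.2⟩]
  · intro e he
    rw [key, if_neg fun h' => he h'.2]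

/-- There is one pass per edge, not per color, so k does not enter the running time. Passes for the
same color repeat work but again leave a maximum matching of that color, and passes for other colors
do not touch it. -/
theorem run_collect {s : Store} (hG : Encodes G n m s) {j : ℕ} (hj : j < m) :
    G.IsMaximumMatchingIn (colorMask m (s ECOL) j)
        ((mask m (collect.run s UNION)).filter (s ECOL · = s ECOL j)) := by
  have key := run_loop (c := 46) (b := 1) (s := s) (p := colorPass) (fun i s' => ∀ j < i,
    G.IsMaximumMatchingIn (colorMask m (s ECOL) j)
        ((mask m (s' UNION)).filter (s ECOL · = s ECOL j))) (by simp) ?_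
  · rw [hG.edges] at key
    exact key j hj
  · intro i s' hi hc hfr hI j hj
    have hG' : Encodes G n m s' := hG.of_eq (hfr _ (by decide)) (hfr _ (by decide))
      (hfr _ (by decide))
    have hE : s' ECOL = s ECOL := hfr _ (by decide)
    obtain ⟨h1, h2⟩ := run_colorPass hG' hc
    rw [hE] at h1 h2
    rw [Store.write_of_ne _ _ _ (by decide)]
    by_cases hji : s ECOL j = s ECOL i
    · simpa only [colorMask, hji] using h1
    · have hset : (mask m (colorPass.run s' UNION)).filter (s ECOL · = s ECOL j) =
          (mask m (s' UNION)).filter (s ECOL · = s ECOL j) := by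
        ext e
        simp only [Finset.mem_filter, mem_mask]
        refine and_congr_left fun he => ?_
        rw [h2 e (by rw [he]; exact hji)]
      rw [hset]
      refine hI j ?_
      rcases Nat.lt_succ_iff_lt_or_eq.1 hj with hj | rfl
      · exact hj
      · exact absurd rfl hji

end Ram.Cmd

/-! ### Counting edges of forests by components -/

namespace SimpleGraph

variable {V : Type*} [Fintype V]

open Classical in
theorem card_edgeFinset_eq_sum_component (T : SimpleGraph V) :
    T.edgeFinset.card = ∑ c : T.ConnectedComponent,
      (T.edgeFinset.filter fun e => e.toFinset ⊆ c.supp.toFinset).card := by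
  rw [Finset.card_eq_sum_card_fiberwise (f := fun e => T.connectedComponentMk e.out.1)
    (t := Finset.univ) (by simp)]
  refine Finset.sum_congr rfl fun c _ => congrArg _ (Finset.filter_congr fun e he => ?_)
  have hmk : ∀ v ∈ e, ∀ w ∈ e, T.connectedComponentMk v = T.connectedComponentMk w := by
    intro v hv w hw
    by_cases hvw : v = w
    · rw [hvw]
    · rw [ConnectedComponent.eq]
      refine Adj.reachable ?_
      rw [mem_edgeFinset] at he
      rwa [(Sym2.mem_and_mem_iff hvw).1 ⟨hv, hw⟩, mem_edgeSet] at he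
  have hout := Sym2.out_fst_mem e
  constructor
  · rintro rfl v hv
    rw [Sym2.mem_toFinset] at hv
    simpa using hmk v hv _ hout
  · intro h
    simpa using h (Sym2.mem_toFinset.2 hout)

open Classical in
theorem card_eq_sum_component (T : SimpleGraph V) :
    Fintype.card V = ∑ c : T.ConnectedComponent, c.supp.toFinset.card := by
  rw [← Finset.card_univ, Finset.card_eq_sum_card_fiberwise (f := T.connectedComponentMk)
    (t := Finset.univ) (by simp)]
  refine Finset.sum_congr rfl fun c _ => congrArg _ ?_
  ext v
  simp

open Classical in
theorem card_filter_edgeFinset_component (T : SimpleGraph V) (c : T.ConnectedComponent) :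
    (T.edgeFinset.filter fun e => e.toFinset ⊆ c.supp.toFinset).card =
      Nat.card c.toSimpleGraph.edgeSet := by
  have key : ∀ s : Set V, s = c.supp →
      Nat.card (T.induce s).edgeSet = Nat.card c.toSimpleGraph.edgeSet := by
    rintro _ rfl
    rfl
  rw [card_filter_edgeFinset_toFinset_subset, ← key _ (Set.coe_toFinset c.supp),
    Nat.card_eq_fintype_card, edgeFinset_card]

open Classical in
theorem card_toFinset_supp (T : SimpleGraph V) (c : T.ConnectedComponent) :
    c.supp.toFinset.card = Nat.card c := by
  rw [Set.toFinset_card, ← Nat.card_eq_fintype_card]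
  rfl

open Classical in
theorem card_component_le (T : SimpleGraph V) (c : T.ConnectedComponent) :
    c.supp.toFinset.card ≤
      (T.edgeFinset.filter fun e => e.toFinset ⊆ c.supp.toFinset).card + 1 := by
  rw [card_filter_edgeFinset_component, card_toFinset_supp]
  exact c.connected_toSimpleGraph.card_vert_le_card_edgeSet_add_one

open Classical in
-- Each component is a tree, with one edge fewer than vertices; sum over the components.
theorem IsAcyclic.card_edgeFinset_add {T : SimpleGraph V} (hT : T.IsAcyclic) :
    T.edgeFinset.card + Fintype.card T.ConnectedComponent = Fintype.card V := by
  rw [card_edgeFinset_eq_sum_component, card_eq_sum_component T, Fintype.card_eq_sum_ones,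
    ← Finset.sum_add_distrib]
  refine Finset.sum_congr rfl fun c _ => ?_
  have h := (hT.isTree_connectedComponent c).card_edgeFinset
  rw [card_filter_edgeFinset_component, card_toFinset_supp, Nat.card_eq_fintype_card,
    Nat.card_eq_fintype_card, ← h, edgeFinset_card]

theorem Reachable.eq_of_adj {α : Type*} {V : Type*} {T : SimpleGraph V} {f : V → α}
    (hf : ∀ u v, T.Adj u v → f u = f v) {u v : V} (h : T.Reachable u v) : f u = f v := by
  obtain ⟨p⟩ := h
  induction p with
  | nil => rfl
  | cons h _ ih => exact (hf _ _ h).trans ih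

open Classical in
-- Every component of T lies in a component of T', so T' has at most as many components; for forests
-- on the same vertices, fewer components mean more edges. This is the rank inequality of the
-- graphic matroid needed for the greedy algorithm.
theorem IsAcyclic.card_edgeFinset_le {T T' : SimpleGraph V} (hT : T.IsAcyclic)
    (hT' : T'.IsAcyclic) (h : ∀ u v, T.Adj u v → T'.Reachable u v) :
    T.edgeFinset.card ≤ T'.edgeFinset.card := by
  have hr : ∀ u v, T.Reachable u v →
      T'.connectedComponentMk u = T'.connectedComponentMk v := fun u v huv =>
    huv.eq_of_adj fun u v huv => ConnectedComponent.sound (h u v huv)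
  have hle : Fintype.card T'.ConnectedComponent ≤ Fintype.card T.ConnectedComponent := by
    refine Fintype.card_le_of_surjective
      (ConnectedComponent.lift T'.connectedComponentMk fun u v p _ => hr u v ⟨p⟩) ?_
    refine ConnectedComponent.ind fun v => ⟨T.connectedComponentMk v, rfl⟩
  have h1 := hT.card_edgeFinset_add
  have h2 := hT'.card_edgeFinset_add
  omega

end SimpleGraph

/-! ### Greedy forests of bundles and their optimality -/

namespace EdgeColoredGraph

open SimpleGraph

section Forest

variable {V E : Type*} {k : ℕ} {G : EdgeColoredGraph V E k}

theorem joins_self (e : E) : G.Joins e (G.fst e) (G.snd e) := Or.inl ⟨rfl, rfl⟩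

theorem supp_adj {F : Finset E} {u v : V} : (G.supp F).Adj u v ↔ ∃ e ∈ F, G.Joins e u v := by
  simp only [supp, fromRel_adj]
  constructor
  · rintro ⟨-, ⟨e, he, h⟩ | ⟨e, he, h⟩⟩
    exacts [⟨e, he, h⟩, ⟨e, he, h.symm⟩]
  · rintro ⟨e, he, h⟩
    refine ⟨?_, Or.inl ⟨e, he, h⟩⟩
    rintro rfl
    rcases h with ⟨h1, h2⟩ | ⟨h1, h2⟩ <;> exact G.fst_ne_snd e (h1.trans h2.symm)

theorem supp_mono {F F' : Finset E} (h : F ⊆ F') : G.supp F ≤ G.supp F' := by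
  intro u v huv
  obtain ⟨e, he, hj⟩ := supp_adj.1 huv
  exact supp_adj.2 ⟨e, h he, hj⟩

theorem reachable_of_mem {F : Finset E} {e : E} (he : e ∈ F) :
    (G.supp F).Reachable (G.fst e) (G.snd e) :=
  (supp_adj.2 ⟨e, he, joins_self e⟩).reachable

variable (G) in
/-- The edges `e` and `f` are parallel or equal. -/
def Parallel (e f : E) : Prop := G.Joins f (G.fst e) (G.snd e)

theorem Parallel.joins_iff {e f : E} (h : G.Parallel e f) (u v : V) :
    G.Joins e u v ↔ G.Joins f u v := by
  unfold Parallel Joins at *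
  grind

theorem supp_union_eq_sup [DecidableEq E] {F F' : Finset E} {e : E} (he : e ∈ F')
    (hF' : ∀ f ∈ F', G.Parallel e f) :
    G.supp (F ∪ F') = G.supp F ⊔ edge (G.fst e) (G.snd e) := by
  ext u v
  rw [sup_adj, supp_adj, supp_adj, edge_adj]
  have hne := G.fst_ne_snd e
  constructor
  · rintro ⟨f, hf, hj⟩
    rcases Finset.mem_union.1 hf with hf | hf
    · exact Or.inl ⟨f, hf, hj⟩
    · right
      rw [← (hF' f hf).joins_iff] at hj
      unfold Joins at hj
      grind
  · rintro (⟨f, hf, hj⟩ | ⟨h, -⟩)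
    · exact ⟨f, Finset.mem_union_left _ hf, hj⟩
    · refine ⟨e, Finset.mem_union_right _ he, ?_⟩
      unfold Joins
      grind

theorem parallel_refl (e : E) : G.Parallel e e := joins_self e

/-- The bundle of an edge. -/
def bundle (G : EdgeColoredGraph V E k) (e : E) : Sym2 V := s(G.fst e, G.snd e)

theorem bundle_eq_iff {e f : E} : G.bundle f = G.bundle e ↔ G.Parallel e f := by
  simp [bundle, Parallel, Joins]

theorem bundle_eq_mk {e : E} {u v : V} : G.bundle e = s(u, v) ↔ G.Joins e u v := by
  simp [bundle, Joins]

variable [Fintype V]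

open Classical in
theorem edgeFinset_supp (F : Finset E) : (G.supp F).edgeFinset = F.image G.bundle := by
  ext b
  induction b with
  | _ u v =>
    rw [mem_edgeFinset, mem_edgeSet, supp_adj]
    simp [bundle_eq_mk]

section Greedy

variable {A F : Finset E}

open Classical in
/-- The number of edges of `A` parallel to `e`, including `e`. -/
noncomputable def multiplicity (G : EdgeColoredGraph V E k) (A : Finset E) (e : E) : ℕ :=
  (A.filter (G.Parallel e ·)).card

open Classical in
/-- The endpoints of `e` are connected by edges of at least the same multiplicity. -/
def Spanned (G : EdgeColoredGraph V E k) (A F : Finset E) (e : E) : Prop :=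
  (G.supp (F.filter (G.multiplicity A e ≤ G.multiplicity A ·))).Reachable (G.fst e) (G.snd e)

theorem Spanned.mono {F' : Finset E} {e : E} (h : G.Spanned A F e) (hF : F ⊆ F') :
    G.Spanned A F' e := by
  classical
  exact Reachable.mono (supp_mono (Finset.filter_subset_filter _ hF)) h

open Classical in
-- Layer-cake summation: b is counted once for each threshold w from 1 to μ b.
theorem card_eq_sum_threshold {N : ℕ} {F : Finset (Sym2 V)} {μ : Sym2 V → ℕ}
    (hN : ∀ b, μ b ≤ N) :
    ∑ b ∈ F, μ b = ∑ w ∈ Finset.Icc 1 N, (F.filter (w ≤ μ ·)).card := by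
  simp_rw [Finset.card_filter]
  rw [Finset.sum_comm]
  refine Finset.sum_congr rfl fun b _ => ?_
  rw [← Finset.card_filter]
  have : (Finset.Icc 1 N).filter (· ≤ μ b) = Finset.Icc 1 (μ b) := by
    ext w
    simp only [Finset.mem_filter, Finset.mem_Icc]
    have := hN b
    omega
  rw [this]
  simp

/-- A forest that consists of whole bundles and spans every bundle by bundles of at least the same
multiplicity is a maximum-size forest with bundles. -/
theorem isMaximumForestWithBundlesIn_of_spanned (hFA : F ⊆ A) (hF : G.IsForestWithBundles F)
    (hclosed : ∀ e ∈ F, ∀ f ∈ A, G.Parallel e f → f ∈ F) (hspan : ∀ e ∈ A, G.Spanned A F e) :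
    G.IsMaximumForestWithBundlesIn A F := by
  classical
  refine ⟨hFA, hF, fun H hHA hH => ?_⟩
  set μ : Sym2 V → ℕ := fun b => (A.filter (G.bundle · = b)).card with hμ
  have hμe : ∀ e, μ (G.bundle e) = G.multiplicity A e := by
    intro e
    rw [hμ, multiplicity]
    refine congrArg _ (Finset.filter_congr fun f _ => bundle_eq_iff)
  have hμN : ∀ b, μ b ≤ A.card := fun b => Finset.card_filter_le _ _
  have hFsum : F.card = ∑ b ∈ F.image G.bundle, μ b := by
    rw [Finset.card_eq_sum_card_image G.bundle F]
    refine Finset.sum_congr rfl fun b hb => ?_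
    obtain ⟨e, he, rfl⟩ := Finset.mem_image.1 hb
    refine congrArg _ ?_
    ext f
    simp only [Finset.mem_filter]
    refine ⟨fun h => ⟨hFA h.1, h.2⟩, fun h => ⟨hclosed e he f h.1 (bundle_eq_iff.1 h.2), h.2⟩⟩
  -- Only an inequality, since H may contain bundles partially; F consists of whole bundles.
  have hHsum : H.card ≤ ∑ b ∈ H.image G.bundle, μ b := by
    rw [Finset.card_eq_sum_card_image G.bundle H]
    exact Finset.sum_le_sum fun b _ =>
      Finset.card_le_card (Finset.filter_subset_filter _ hHA)
  rw [hFsum]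
  refine hHsum.trans ?_
  rw [card_eq_sum_threshold hμN, card_eq_sum_threshold hμN]
  refine Finset.sum_le_sum fun w _ => ?_
  -- For a fixed threshold w, the bundles of multiplicity at least w form a subforest on either
  -- side. Those of F span those of H by `hspan`, so the rank inequality applies.
  have hset : ∀ X : Finset E, (X.image G.bundle).filter (w ≤ μ ·) =
      (G.supp (X.filter (w ≤ G.multiplicity A ·))).edgeFinset := by
    intro X
    rw [edgeFinset_supp, Finset.filter_image]
    simp only [hμe]
  rw [hset, hset]
  refine IsAcyclic.card_edgeFinset_le (hH.anti (supp_mono (Finset.filter_subset _ _)))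
    (hF.anti (supp_mono (Finset.filter_subset _ _))) fun u v huv => ?_
  obtain ⟨e, he, hj⟩ := supp_adj.1 huv
  obtain ⟨heH, hwe⟩ := Finset.mem_filter.1 he
  have hs : (G.supp (F.filter (w ≤ G.multiplicity A ·))).Reachable (G.fst e) (G.snd e) := by
    refine Reachable.mono (supp_mono ?_) (hspan e (hHA heH))
    exact Finset.monotone_filter_right _ fun f _ hf => hwe.trans hf
  rcases hj with ⟨rfl, rfl⟩ | ⟨rfl, rfl⟩
  · exact hs
  · exact hs.symm

/-- The invariant of the greedy algorithm: a forest of bundles of multiplicity at least `w`,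
with a labelling of its connected components. -/
structure GreedyForest {L : Type*} (G : EdgeColoredGraph V E k) (A F : Finset E) (comp : V → L)
    (w : ℕ) : Prop where
  subset : F ⊆ A
  acyclic : G.IsForestWithBundles F
  closed : ∀ e ∈ F, ∀ f ∈ A, G.Parallel e f → f ∈ F
  label : ∀ u v, comp u = comp v ↔ (G.supp F).Reachable u v
  level : ∀ e ∈ F, w ≤ G.multiplicity A e

variable {L : Type*} {comp comp' : V → L} {w : ℕ}

theorem greedyForest_empty (hcomp : Function.Injective comp) :
    GreedyForest G A ∅ comp w := by
  have hbot : G.supp ∅ = ⊥ := by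
    ext u v
    rw [supp_adj]
    simp
  refine ⟨by simp, ?_, by simp, fun u v => ?_, by simp⟩
  · rw [IsForestWithBundles, hbot]
    exact isAcyclic_bot
  · rw [hbot, reachable_bot, hcomp.eq_iff]

/-- By `level` the whole forest has multiplicity at least w, so the filter in `Spanned` removes
nothing and equality of labels is the required connection. -/
theorem GreedyForest.spanned (h : GreedyForest G A F comp w) {e : E}
    (he : G.multiplicity A e = w) (hcomp : comp (G.fst e) = comp (G.snd e)) :
    G.Spanned A F e := by
  classical
  rw [Spanned, Finset.filter_true_of_mem fun f hf => by rw [he]; exact h.level f hf]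
  exact (h.label _ _).1 hcomp

theorem GreedyForest.mono {w' : ℕ} (h : GreedyForest G A F comp w) (hw : w' ≤ w) :
    GreedyForest G A F comp w' :=
  ⟨h.subset, h.acyclic, h.closed, h.label, fun e he => hw.trans (h.level e he)⟩

/-- A whole bundle adds a single edge to the support, and this edge joins two different components;
acyclicity persists, and relabelling the first component by the label of the second reflects the
union. -/
theorem GreedyForest.add [DecidableEq E] [DecidableEq L] (h : GreedyForest G A F comp w)
    {F' : Finset E} {e : E}
    (heA : e ∈ A) (he : G.multiplicity A e = w) (hcomp : comp (G.fst e) ≠ comp (G.snd e))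
    (hF' : ∀ f, f ∈ F' ↔ f ∈ F ∨ f ∈ A ∧ G.Parallel e f)
    (hcomp' : ∀ v, comp' v = if comp v = comp (G.fst e) then comp (G.snd e) else comp v) :
    GreedyForest G A F' comp' w := by
  classical
  have hF'eq : F' = F ∪ A.filter (G.Parallel e ·) := by
    ext f
    rw [hF', Finset.mem_union, Finset.mem_filter]
  have hsupp : G.supp F' = G.supp F ⊔ edge (G.fst e) (G.snd e) := by
    rw [hF'eq]
    exact supp_union_eq_sup (Finset.mem_filter.2 ⟨heA, parallel_refl e⟩)
      fun f hf => (Finset.mem_filter.1 hf).2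
  refine ⟨?_, ?_, ?_, ?_, ?_⟩
  · rw [hF'eq]
    exact Finset.union_subset h.subset (Finset.filter_subset _ _)
  · rw [IsForestWithBundles, hsupp]
    exact h.acyclic.sup_edge_of_not_reachable fun hr => hcomp ((h.label _ _).2 hr)
  · intro f hf g hg hfg
    rw [hF'] at hf ⊢
    rcases hf with hf | ⟨-, hf⟩
    · exact Or.inl (h.closed f hf g hg hfg)
    · exact Or.inr ⟨hg, bundle_eq_iff.1 ((bundle_eq_iff.2 hfg).trans (bundle_eq_iff.2 hf))⟩
  · have hmono : ∀ u v, (G.supp F).Reachable u v → (G.supp F').Reachable u v := by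
      intro u v huv
      rw [hsupp]
      exact huv.mono le_sup_left
    have heF' : (G.supp F').Reachable (G.fst e) (G.snd e) :=
      reachable_of_mem ((hF' e).2 (Or.inr ⟨heA, parallel_refl e⟩))
    intro u v
    constructor
    · intro huv
      rw [hcomp' u, hcomp' v] at huv
      split_ifs at huv with hu hv hv
      · exact hmono _ _ ((h.label _ _).1 (hu.trans hv.symm))
      · exact (hmono _ _ ((h.label _ _).1 hu)).trans
          (heF'.trans (hmono _ _ ((h.label _ _).1 huv)))
      · exact (hmono _ _ ((h.label _ _).1 huv)).trans
          (heF'.symm.trans (hmono _ _ ((h.label _ _).1 hv.symm)))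
      · exact hmono _ _ ((h.label _ _).1 huv)
    · refine Reachable.eq_of_adj fun x y hxy => ?_
      rw [hsupp, sup_adj, edge_adj] at hxy
      rw [hcomp' x, hcomp' y]
      rcases hxy with hxy | ⟨⟨rfl, rfl⟩ | ⟨rfl, rfl⟩, -⟩
      · rw [(h.label x y).2 hxy.reachable]
      · simp
      · simp
  · intro f hf
    rcases (hF' f).1 hf with hf | ⟨-, hf⟩
    · exact h.level f hf
    · rw [← he, multiplicity, multiplicity]
      refine Finset.card_le_card fun g hg => ?_
      simp only [Finset.mem_filter, ← bundle_eq_iff] at hg hf ⊢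
      exact ⟨hg.1, hg.2.trans hf.symm⟩

end Greedy

end Forest

end EdgeColoredGraph

/-! ### The approximation guarantees -/

namespace EdgeColoredGraph

open SimpleGraph

section Approximation

variable {V E : Type*} {k : ℕ} {G : EdgeColoredGraph V E k}

section Maximum

variable [DecidableEq E] {A F : Finset E}

/-- Adding an edge of `A` to a maximum-size forest with bundles destroys the forest. -/
theorem IsMaximumForestWithBundlesIn.mem_of_insert (h : G.IsMaximumForestWithBundlesIn A F)
    {e : E} (he : e ∈ A) (hins : G.IsForestWithBundles (insert e F)) : e ∈ F := by
  by_contra heF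
  have := h.2.2 (insert e F) (Finset.insert_subset he h.1) hins
  rw [Finset.card_insert_of_notMem heF] at this
  omega

theorem supp_insert (e : E) : G.supp (insert e F) = G.supp F ⊔ edge (G.fst e) (G.snd e) := by
  rw [Finset.insert_eq, Finset.union_comm]
  exact supp_union_eq_sup (by simp) (by simp [parallel_refl])

/-- An edge of A between different components of F could be added without closing a cycle. -/
theorem IsMaximumForestWithBundlesIn.reachable (h : G.IsMaximumForestWithBundlesIn A F)
    {e : E} (he : e ∈ A) : (G.supp F).Reachable (G.fst e) (G.snd e) := by
  by_contra hr
  refine hr (reachable_of_mem (h.mem_of_insert he ?_))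
  rw [IsForestWithBundles, supp_insert]
  exact IsAcyclic.sup_edge_of_not_reachable hr h.2.1

end Maximum

open Classical in
/-- The edges of `X` whose first endpoint lies in the given component. -/
noncomputable def edgesAt (G : EdgeColoredGraph V E k) (X : Finset E) {T : SimpleGraph V}
    (c : T.ConnectedComponent) : Finset E :=
  X.filter fun e => T.connectedComponentMk (G.fst e) = c

variable [Fintype V]

open Classical in
theorem card_eq_sum_edgesAt (X : Finset E) (T : SimpleGraph V) :
    X.card = ∑ c : T.ConnectedComponent, (G.edgesAt X c).card := by
  rw [Finset.card_eq_sum_card_fiberwise (f := fun e => T.connectedComponentMk (G.fst e))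
    (t := Finset.univ) (by simp)]
  rfl

open Classical in
-- A connected graph on c vertices has at least c - 1 edges, and each support edge comes from at
-- least one edge of F.
theorem card_component_le_edgesAt (F : Finset E) (c : (G.supp F).ConnectedComponent) :
    c.supp.toFinset.card ≤ (G.edgesAt F c).card + 1 := by
  refine (card_component_le _ c).trans (Nat.add_le_add_right ?_ 1)
  refine le_trans (Finset.card_le_card ?_) (Finset.card_image_le (f := G.bundle))
  intro b hb
  obtain ⟨hb, hbc⟩ := Finset.mem_filter.1 hb
  rw [edgeFinset_supp] at hb
  obtain ⟨e, he, rfl⟩ := Finset.mem_image.1 hb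
  refine Finset.mem_image.2 ⟨e, Finset.mem_filter.2 ⟨he, ?_⟩, rfl⟩
  have : G.fst e ∈ c.supp.toFinset := hbc (by simp [bundle])
  simpa using this

open Classical in
-- Edges of M do not leave components of T, so the ones at c cover pairwise disjoint pairs of
-- vertices of c.
theorem IsMatching.two_mul_card_edgesAt_le {M : Finset E} (hM : G.IsMatching M)
    {T : SimpleGraph V} (hT : ∀ e ∈ M, T.Reachable (G.fst e) (G.snd e))
    (c : T.ConnectedComponent) : 2 * (G.edgesAt M c).card ≤ c.supp.toFinset.card := by
  have hsub : G.IsMatching (G.edgesAt M c) := hM.subset (Finset.filter_subset _ _)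
  rw [← hsub.card_cover]
  refine Finset.card_le_card fun v hv => ?_
  obtain ⟨e, he, hev⟩ := (mem_cover G).1 hv
  obtain ⟨heM, hec⟩ := Finset.mem_filter.1 he
  simp only [Set.mem_toFinset, ConnectedComponent.mem_supp_iff]
  rcases hev with rfl | rfl
  · exact hec
  · rw [← hec]
    exact (ConnectedComponent.sound (hT e heM)).symm

open Classical in
/-- In a component with two vertices, a maximum-size forest with bundles takes all edges. -/
theorem IsMaximumForestWithBundlesIn.edgesAt_eq {A F : Finset E}
    (h : G.IsMaximumForestWithBundlesIn A F) (c : (G.supp F).ConnectedComponent)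
    (hc : c.supp.toFinset.card = 2) : G.edgesAt A c = G.edgesAt F c := by
  refine (Finset.filter_subset_filter _ h.1).antisymm' fun e he => ?_
  obtain ⟨heA, hec⟩ := Finset.mem_filter.1 he
  refine Finset.mem_filter.2 ⟨h.mem_of_insert heA ?_, hec⟩
  have hpos := card_component_le_edgesAt F c
  obtain ⟨f, hf⟩ := Finset.card_pos.1 (show 0 < (G.edgesAt F c).card by omega)
  obtain ⟨hfF, hfc⟩ := Finset.mem_filter.1 hf
  obtain ⟨u, v, huv, hcuv⟩ := Finset.card_eq_two.1 hc
  have hmem : ∀ w, (G.supp F).connectedComponentMk w = c → w = u ∨ w = v := by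
    intro w hw
    have : w ∈ c.supp.toFinset := by simpa using hw
    rw [hcuv] at this
    simpa using this
  have he1 := hmem _ hec
  have he2 := hmem _ ((ConnectedComponent.sound (h.reachable heA)).symm.trans hec)
  have hf1 := hmem _ hfc
  have hf2 := hmem _ ((ConnectedComponent.sound (reachable_of_mem hfF)).symm.trans hfc)
  have hne := G.fst_ne_snd e
  have hnf := G.fst_ne_snd f
  -- Both e and the edge f of F join the only two vertices of the component. So e is parallel to f,
  -- and adding e leaves the support unchanged.
  have hadj : (G.supp F).Adj (G.fst e) (G.snd e) := by
    refine supp_adj.2 ⟨f, hfF, ?_⟩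
    unfold Joins
    grind
  rw [IsForestWithBundles, supp_insert, sup_eq_left.2]
  · exact h.2.1
  · rwa [edge_le_iff, or_iff_right hne]

/-- In every component, a maximum-size forest with bundles in the union of `k` matchings takes at
least the stated part of the edges. -/
theorem IsMaximumForestWithBundlesIn.mul_card_le [DecidableEq E] {M : Fin k → Finset E}
    {F : Finset E} (hM : ∀ i, G.IsMatching (M i))
    (h : G.IsMaximumForestWithBundlesIn (Finset.univ.biUnion M) F) {a b : ℕ} (hab : a ≤ b)
    (hk : ∀ c ≥ 3, a * (k * (c / 2)) ≤ b * (c - 1)) :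
    a * (Finset.univ.biUnion M).card ≤ b * F.card := by
  classical
  rw [card_eq_sum_edgesAt (G := G) _ (G.supp F), card_eq_sum_edgesAt (G := G) F (G.supp F),
    Finset.mul_sum, Finset.mul_sum]
  refine Finset.sum_le_sum fun c _ => ?_
  have h1 := card_component_le_edgesAt F c
  have h2 : (G.edgesAt (Finset.univ.biUnion M) c).card ≤ k * (c.supp.toFinset.card / 2) := by
    have hsub : G.edgesAt (Finset.univ.biUnion M) c ⊆
        Finset.univ.biUnion fun i => G.edgesAt (M i) c := by
      intro e he
      simp only [edgesAt, Finset.mem_filter, Finset.mem_biUnion] at he ⊢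
      obtain ⟨⟨i, hi, hei⟩, hec⟩ := he
      exact ⟨i, hi, hei, hec⟩
    refine (Finset.card_le_card hsub).trans (Finset.card_biUnion_le.trans ?_)
    refine (Finset.sum_le_card_nsmul _ _ (c.supp.toFinset.card / 2) fun i _ => ?_).trans
      (by simp)
    have := (hM i).two_mul_card_edgesAt_le (T := G.supp F)
      (fun e he => h.reachable (Finset.mem_biUnion.2 ⟨i, Finset.mem_univ _, he⟩)) c
    omega
  have h3 := h.edgesAt_eq c
  rcases lt_or_ge c.supp.toFinset.card 3 with hc | hc
  -- With fewer than two vertices there are no edges at all. Two vertices must be treated separately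
  -- because the bound in `hk` fails there in both applications.
  · interval_cases hcc : c.supp.toFinset.card
    · simp only [Nat.zero_div, mul_zero, Nat.le_zero] at h2
      simp [h2]
    · simp only [Nat.reduceDiv, mul_zero, Nat.le_zero] at h2
      simp [h2]
    · rw [h3 rfl]
      exact Nat.mul_le_mul_right _ hab
  · exact (Nat.mul_le_mul_left a h2).trans ((hk _ hc).trans (Nat.mul_le_mul_left b (by omega)))

/-- The edges of O with color i form a matching in that color class, so M i is at least as large;
the matchings M i are disjoint since their colors differ. Acyclicity of O plays no role. -/
theorem IsProperlyColored.card_le [Fintype E] [DecidableEq E] {M : Fin k → Finset E}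
    (hM : ∀ i, G.IsMaximumMatchingIn (G.colorClass i) (M i)) {O : Finset E}
    (hO : G.IsProperlyColored O) : O.card ≤ (Finset.univ.biUnion M).card := by
  rw [Finset.card_biUnion, Finset.card_eq_sum_card_fiberwise (f := G.color) (t := Finset.univ)
    (by simp)]
  · refine Finset.sum_le_sum fun i _ => (hM i).2.2 _ ?_ ?_
    · intro e he
      simpa [colorClass] using (Finset.mem_filter.1 he).2
    · intro v e he f hf hev hfv
      obtain ⟨he, hei⟩ := Finset.mem_filter.1 he
      obtain ⟨hf, hfi⟩ := Finset.mem_filter.1 hf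
      by_contra hne
      exact hO e he f hf hne ⟨v, hev, hfv⟩ (hei.trans hfi.symm)
  · intro i _ j _ hij
    change Disjoint _ _
    rw [Finset.disjoint_left]
    intro e hei hej
    have h1 := (hM i).1 hei
    have h2 := (hM j).1 hej
    simp only [colorClass, Finset.mem_filter, Finset.mem_univ, true_and] at h1 h2
    exact hij (h1.symm.trans h2)

theorem isProperlyColored_of_subset [Fintype E] [DecidableEq E] {M : Fin k → Finset E}
    (hM : ∀ i, G.IsMaximumMatchingIn (G.colorClass i) (M i)) {F : Finset E}
    (hF : F ⊆ Finset.univ.biUnion M) : G.IsProperlyColored F := by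
  have hcol : ∀ i, ∀ e ∈ M i, G.color e = i := by
    intro i e he
    simpa [colorClass] using (hM i).1 he
  rintro e he f hf hne ⟨v, hev, hfv⟩ hc
  obtain ⟨i, -, hei⟩ := Finset.mem_biUnion.1 (hF he)
  obtain ⟨j, -, hfj⟩ := Finset.mem_biUnion.1 (hF hf)
  obtain rfl : i = j := by rw [← hcol i e hei, ← hcol j f hfj, hc]
  exact hne ((hM i).2.1 v e hei f hfj hev hfv)

theorem IsMatchingUnionOutput.isApproxSolution [Fintype E] [DecidableEq E] {F : Finset E}
    (h : G.IsMatchingUnionOutput F) {a b : ℕ} (hab : a ≤ b) (hb : 0 < b)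
    (hk : ∀ c ≥ 3, a * (k * (c / 2)) ≤ b * (c - 1)) : G.IsApproxSolution (a / b) F := by
  obtain ⟨M, hM, hF⟩ := h
  refine ⟨⟨isProperlyColored_of_subset hM hF.1, hF.2.1⟩, fun O hO _ => ?_⟩
  have h1 := hF.mul_card_le (fun i => (hM i).2.1) hab hk
  have h2 := (Nat.mul_le_mul_left a (hO.card_le hM)).trans h1
  have hb' : (0 : ℚ) < b := by exact_mod_cast hb
  rw [div_mul_eq_mul_div, div_le_iff₀ hb', mul_comm (F.card : ℚ)]
  exact_mod_cast h2

/-- The numerical condition is 6⌊c/2⌋ ≤ 4(c - 1) for c ≥ 3, with equality at c = 4. -/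
theorem isApproxSolution_two [Fintype E] [DecidableEq E] {G : EdgeColoredGraph V E 2}
    {F : Finset E} (h : G.IsMatchingUnionOutput F) : G.IsApproxSolution (3 / 4) F := by
  have := h.isApproxSolution (a := 3) (b := 4) (by omega) (by omega) (fun c hc => by omega)
  exact_mod_cast this

/-- The numerical condition is 3⌊c/2⌋ ≤ 2(c - 1) for c ≥ 3, with equality at c = 4. -/
theorem isApproxSolution_three [Fintype E] [DecidableEq E] {G : EdgeColoredGraph V E 3}
    {F : Finset E} (h : G.IsMatchingUnionOutput F) : G.IsApproxSolution (1 / 2) F := by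
  have := h.isApproxSolution (a := 1) (b := 2) (by omega) (by omega) (fun c hc => by omega)
  exact_mod_cast this

end Approximation

end EdgeColoredGraph

/-! ### The greedy program -/

namespace Ram.Cmd

open EdgeColoredGraph

/-- The edges in the scalars `c` and `d` are parallel or equal. -/
def parallel (c d : ℕ) : Expr :=
  .add (.and (.eq (.read EFST (.var c)) (.read EFST (.var d)))
      (.eq (.read ESND (.var c)) (.read ESND (.var d))))
    (.and (.eq (.read EFST (.var c)) (.read ESND (.var d)))
      (.eq (.read ESND (.var c)) (.read EFST (.var d))))

def initForest : Cmd :=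
  .seq (.loop 50 0 (.write COMP (.var 50) (.var 50)))
  (.loop 51 1 (.seq (.write OUT (.var 51) (.const 0)) (.write MULT (.var 51) (.const 0))))

/-- Compute the multiplicities of all edges in `UNION`. -/
def countParallel : Cmd :=
  .loop 52 1 (.loop 53 1 (.ite (.and (.read UNION (.var 53)) (parallel 52 53))
    (.write MULT (.var 52) (.add (.read MULT (.var 52)) (.const 1))) .skip))

/-- Add the bundle of one edge to the forest `OUT`. -/
def addBundle : Cmd :=
  .seq (.write XX (.const 0) (.read COMP (.read EFST (.var 55))))
  (.seq (.write YY (.const 0) (.read COMP (.read ESND (.var 55))))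
  (.seq (.loop 56 0 (.ite (.eq (.read COMP (.var 56)) (.var XX))
    (.write COMP (.var 56) (.var YY)) .skip))
  (.loop 57 1 (.ite (.and (.read UNION (.var 57)) (parallel 55 57))
    (.write OUT (.var 57) (.const 1)) .skip))))

/-- Add the bundle of one edge if it has the current multiplicity and keeps the forest acyclic. -/
def tryBundle : Cmd :=
  .ite (.and (.read UNION (.var 55))
    (.and (.eq (.read MULT (.var 55)) (.sub (.read 0 (.const 1)) (.var 54)))
      (.not (.eq (.read COMP (.read EFST (.var 55))) (.read COMP (.read ESND (.var 55)))))))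
    addBundle .skip

/-- Compute a maximum-size forest with bundles in `UNION` by the greedy algorithm. -/
def greedy : Cmd :=
  .seq initForest (.seq countParallel (.loop 54 1 (.loop 55 1 tryBundle)))

end Ram.Cmd

namespace EdgeColoredGraph

/-- The set with the given indicator vector. -/
def marked {m : ℕ} (a : ℕ → ℕ) : Finset (Fin m) := Finset.univ.filter (a · ≠ 0)

theorem mem_marked {m : ℕ} {a : ℕ → ℕ} {e : Fin m} : e ∈ marked a ↔ a e ≠ 0 := by
  simp [marked]

/-- The store contains the graph, up to the colors. -/
structure Stored {n m k : ℕ} (G : EdgeColoredGraph (Fin n) (Fin m) k) (s : Ram.Store) : Prop where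
  vertices : s 0 0 = n
  edges : s 0 1 = m
  fst : ∀ e : Fin m, s EFST e = G.fst e
  snd : ∀ e : Fin m, s ESND e = G.snd e

theorem Stored.of_eq {n m k : ℕ} {G : EdgeColoredGraph (Fin n) (Fin m) k} {s s' : Ram.Store}
    (h : Stored G s) (h0 : s' 0 = s 0) (h1 : s' EFST = s EFST) (h2 : s' ESND = s ESND) :
    Stored G s' :=
  ⟨by rw [h0, h.vertices], by rw [h0, h.edges], by rw [h1]; exact h.fst, by rw [h2]; exact h.snd⟩

end EdgeColoredGraph

namespace Ram.Cmd

open EdgeColoredGraph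

variable {n m k : ℕ} {G : EdgeColoredGraph (Fin n) (Fin m) k}

theorem eval_parallel {s : Store} (hG : Stored G s) {c d : ℕ} {e f : Fin m} (hc : s c 0 = e)
    (hd : s d 0 = f) : (parallel c d).eval s ≠ 0 ↔ G.Parallel e f := by
  simp only [parallel, Expr.eval, Expr.eval_eq, Expr.eval_and, hc, hd, hG.fst, hG.snd, Parallel,
    Joins, Fin.val_inj]
  grind

theorem run_initForest {s : Store} (hG : Stored G s) :
    (∀ v < n, initForest.run s COMP v = v) ∧
      ∀ e < m, initForest.run s OUT e = 0 ∧ initForest.run s MULT e = 0 := by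
  have h1 := run_loop (c := 50) (b := 0) (s := s) (p := .write COMP (.var 50) (.var 50))
    (fun i s' => ∀ v < i, s' COMP v = v) (by simp) (by
      intro i s' hi hc _ hI v hv
      have := hI v
      simp [run, hc, Function.update_apply]
      grind)
  rw [hG.vertices] at h1
  set s1 := (Cmd.loop 50 0 (.write COMP (.var 50) (.var 50))).run s with hs1
  have h2 := run_loop (c := 51) (b := 1) (s := s1)
    (p := .seq (.write OUT (.var 51) (.const 0)) (.write MULT (.var 51) (.const 0)))
    (fun i s' => ∀ v < i, s' OUT v = 0 ∧ s' MULT v = 0) (by simp) (by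
      intro i s' hi hc _ hI v hv
      have := hI v
      simp [run, hc, Function.update_apply]
      grind)
  rw [show s1 0 = s 0 from run_of_notMem (by decide) s, hG.edges] at h2
  refine ⟨?_, h2⟩
  rw [show initForest.run s COMP = s1 COMP from run_of_notMem (by decide) s1]
  exact h1

theorem run_countParallel {s : Store} (hG : Stored G s) (h0 : ∀ e < m, s MULT e = 0)
    (e : Fin m) : countParallel.run s MULT e = G.multiplicity (marked (s UNION)) e := by
  classical
  have key := run_loop (c := 52) (b := 1) (s := s) (p := .loop 53 1 (.ite
    (.and (.read UNION (.var 53)) (parallel 52 53))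
    (.write MULT (.var 52) (.add (.read MULT (.var 52)) (.const 1))) .skip))
    (fun i s' => ∀ e : Fin m, s' MULT e =
      if (e : ℕ) < i then G.multiplicity (marked (s UNION)) e else 0) ?_ ?_
  · rw [hG.edges] at key
    exact (key e).trans (if_pos e.2)
  · intro e
    simp [h0 e e.2]
  · intro i s' hi hc hfr hI
    rw [hG.edges] at hi
    have key2 := run_loop (c := 53) (b := 1) (s := s') (p := .ite
      (.and (.read UNION (.var 53)) (parallel 52 53))
      (.write MULT (.var 52) (.add (.read MULT (.var 52)) (.const 1))) .skip)
      (fun j s'' => ∀ e : Fin m, s'' MULT e = if (e : ℕ) = i then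
        (((marked (s UNION)).filter (G.Parallel e ·)).filter (fun f : Fin m => (f : ℕ) < j)).card
        else s' MULT e) ?_ ?_
    · rw [hfr 0 (by decide), hG.edges] at key2
      intro e
      rw [Store.write_of_ne _ _ _ (by decide), key2 e, hI e]
      rcases lt_trichotomy (e : ℕ) i with h | h | h
      · rw [if_neg h.ne, if_pos h, if_pos (by omega)]
      · rw [if_pos h, if_pos (by omega), Finset.filter_true_of_mem fun f _ => f.2,
          EdgeColoredGraph.multiplicity]
      · rw [if_neg h.ne', if_neg (by omega), if_neg (by omega)]
    · intro e
      rw [Store.write_of_ne _ _ _ (by decide)]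
      split_ifs with h
      · rw [hI e, if_neg (by omega)]
        simp
      · rfl
    · intro j s'' hj hc2 hfr2 hI2 e
      rw [hfr 0 (by decide), hG.edges] at hj
      have hG2 : Stored G s'' := (hG.of_eq (hfr _ (by decide)) (hfr _ (by decide))
        (hfr _ (by decide))).of_eq (hfr2 _ (by decide)) (hfr2 _ (by decide)) (hfr2 _ (by decide))
      have hc1 : s'' 52 0 = i := by rw [hfr2 52 (by decide), hc]
      have hU : s'' UNION = s UNION := by rw [hfr2 _ (by decide), hfr _ (by decide)]
      have hpar := eval_parallel hG2 (e := ⟨i, hi⟩) (f := ⟨j, hj⟩) hc1 hc2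
      have hcond : (Expr.and (.read UNION (.var 53)) (parallel 52 53)).eval s'' ≠ 0 ↔
          (⟨j, hj⟩ : Fin m) ∈ (marked (s UNION)).filter (G.Parallel ⟨i, hi⟩ ·) := by
        rw [Finset.mem_filter, mem_marked, ← hpar, Expr.eval_and]
        simp [hc2, hU]
      have hIe := hI2 e
      rw [Store.write_of_ne _ _ _ (by decide)]
      by_cases hei : (e : ℕ) = i
      · subst hei
        rw [if_pos rfl] at hIe ⊢
        simp only [run]
        set B := (marked (s UNION)).filter (G.Parallel e ·) with hB
        by_cases h : (⟨j, hj⟩ : Fin m) ∈ B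
        · rw [if_pos (hcond.2 h)]
          have hset : B.filter (fun f : Fin m => (f : ℕ) < j + 1) =
              insert ⟨j, hj⟩ (B.filter (fun f : Fin m => (f : ℕ) < j)) := by
            ext f
            simp only [Finset.mem_filter, Finset.mem_insert, Fin.ext_iff]
            constructor
            · rintro ⟨h1, h2⟩
              rcases Nat.lt_succ_iff_lt_or_eq.1 h2 with h2 | h2
              exacts [Or.inr ⟨h1, h2⟩, Or.inl h2]
            · rintro (h1 | ⟨h1, h2⟩)
              · obtain rfl : f = ⟨j, hj⟩ := Fin.ext h1
                exact ⟨h, Nat.lt_succ_self j⟩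
              · exact ⟨h1, by omega⟩
          rw [hset, Finset.card_insert_of_notMem (by simp), ← hIe]
          simp [hc1]
        · rw [if_neg (mt hcond.1 h), hIe]
          refine congrArg _ (Finset.filter_congr fun f hf => ?_)
          constructor
          · exact fun h' => by omega
          · intro h'
            refine (Nat.lt_succ_iff_lt_or_eq.1 h').resolve_right fun h'' => h ?_
            rwa [← show f = ⟨j, hj⟩ from Fin.ext h'']
      · rw [if_neg hei] at hIe ⊢
        simp only [run]
        split_ifs
        · simp [hc1, hei, hIe]
        · exact hIe

theorem run_addBundle {s : Store} (hG : Stored G s) {e : Fin m} (he : s 55 0 = e) :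
    (∀ v : Fin n, addBundle.run s COMP v =
      if s COMP v = s COMP (G.fst e) then s COMP (G.snd e) else s COMP v) ∧
    ∀ f : Fin m, (addBundle.run s OUT f = s OUT f ∨ addBundle.run s OUT f = 1) ∧
      (addBundle.run s OUT f ≠ 0 ↔ s OUT f ≠ 0 ∨ s UNION f ≠ 0 ∧ G.Parallel e f) := by
  set s1 := (s.write XX 0 (s COMP (G.fst e))).write YY 0 (s COMP (G.snd e)) with hs1
  set p : Cmd := .loop 56 0 (.ite (.eq (.read COMP (.var 56)) (.var XX))
    (.write COMP (.var 56) (.var YY)) .skip) with hp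
  have hfr1 : ∀ a ∉ [XX, YY], s1 a = s a := by
    intro a ha
    simp only [List.mem_cons, List.not_mem_nil, or_false, not_or] at ha
    simp [hs1, ha]
  have hrun : addBundle.run s = (Cmd.loop 57 1 (.ite (.and (.read UNION (.var 57))
      (parallel 55 57)) (.write OUT (.var 57) (.const 1)) .skip)).run (p.run s1) := by
    simp only [addBundle, run, Expr.eval, he, hG.fst, hG.snd, Store.write_of_ne, ne_eq,
      Nat.reduceEqDiff, not_false_eq_true, hs1, hp]
  have h1 := run_loop (c := 56) (b := 0) (s := s1)
    (p := .ite (.eq (.read COMP (.var 56)) (.var XX)) (.write COMP (.var 56) (.var YY)) .skip)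
    (fun i s' => ∀ v, s' COMP v = if v < i ∧ s COMP v = s COMP (G.fst e) then s COMP (G.snd e)
      else s COMP v) (by simp [hs1]) (by
      intro i s' hi hc hfr hI v
      have hX : s' XX 0 = s COMP (G.fst e) := by rw [hfr _ (by decide)]; simp [hs1]
      have hY : s' YY 0 = s COMP (G.snd e) := by rw [hfr _ (by decide)]; simp [hs1]
      have h1 := hI v
      have h2 := hI i
      simp only [Nat.lt_irrefl, false_and, if_false] at h2
      simp only [run, Expr.eval_eq, Expr.eval, hc, hX, hY, h2]
      rw [Store.write_of_ne _ _ _ (by decide)]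
      by_cases h3 : s COMP i = s COMP (G.fst e)
      · simp only [h3, if_true, ne_eq, one_ne_zero, not_false_eq_true, Store.write_self,
          Function.update_apply]
        grind
      · simp only [h3, if_false, ne_eq, not_true_eq_false]
        grind)
  rw [hfr1 0 (by decide), hG.vertices, ← hp] at h1
  have hfr2 : ∀ a ∉ [XX, YY, 56, COMP], p.run s1 a = s a := by
    intro a ha
    simp only [List.mem_cons, List.not_mem_nil, or_false, not_or] at ha
    rw [← hfr1 a (by simp [ha])]
    exact run_of_notMem (by simp [hp, writes, ha]) s1
  set s2 := p.run s1 with hs2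
  have hG2 : Stored G s2 := hG.of_eq (hfr2 _ (by decide)) (hfr2 _ (by decide)) (hfr2 _ (by decide))
  rw [hrun]
  constructor
  · intro v
    rw [run_of_notMem (by decide), h1]
    simp
  have h3 := run_loop (c := 57) (b := 1) (s := s2) (p := .ite (.and (.read UNION (.var 57))
      (parallel 55 57)) (.write OUT (.var 57) (.const 1)) .skip)
    (fun i s' => ∀ f : Fin m, (s' OUT f = s OUT f ∨ s' OUT f = 1) ∧
      (s' OUT f ≠ 0 ↔ s OUT f ≠ 0 ∨ (f : ℕ) < i ∧ s UNION f ≠ 0 ∧ G.Parallel e f)) ?_ ?_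
  · rw [hfr2 0 (by decide), hG.edges] at h3
    intro f
    simpa using h3 f
  · intro f
    simp [hfr2]
  · intro i s' hi hc hfr hI f
    rw [hfr2 0 (by decide), hG.edges] at hi
    have hG' : Stored G s' := hG2.of_eq (hfr _ (by decide)) (hfr _ (by decide)) (hfr _ (by decide))
    have he' : s' 55 0 = e := by rw [hfr _ (by decide), hfr2 _ (by decide), he]
    have hU : s' UNION = s UNION := by rw [hfr _ (by decide), hfr2 _ (by decide)]
    have hpar := eval_parallel hG' (f := ⟨i, hi⟩) he' hc
    have hIf := hI f
    have hcond : (Expr.and (.read UNION (.var 57)) (parallel 55 57)).eval s' ≠ 0 ↔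
        s UNION i ≠ 0 ∧ G.Parallel e ⟨i, hi⟩ := by
      rw [← hpar, Expr.eval_and]
      simp [hc, hU]
    rw [Store.write_of_ne _ _ _ (by decide)]
    simp only [run]
    by_cases hfi : (f : ℕ) = i
    · obtain rfl : f = ⟨i, hi⟩ := Fin.ext hfi
      simp only [Nat.lt_irrefl, false_and, or_false] at hIf
      split_ifs with h
      · simp [hc, hcond.1 h]
      · simpa only [Nat.lt_succ_self, true_and, mt hcond.2 h, or_false] using hIf
    · have hlt : (f : ℕ) < i + 1 ↔ (f : ℕ) < i := by omega
      rw [hlt]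
      split_ifs
      · simpa [hc, hfi] using hIf
      · exact hIf

/-- The invariant of the greedy algorithm: all edges of multiplicity greater than `w` and the
first `j` edges of multiplicity `w` have been treated. -/
structure GreedyOK (G : EdgeColoredGraph (Fin n) (Fin m) k) (A : Finset (Fin m)) (w j : ℕ)
    (s : Store) : Prop where
  forest : GreedyForest G A (marked (s OUT)) (fun v : Fin n => s COMP v) w
  out_le : ∀ e : Fin m, s OUT e ≤ 1
  spanned : ∀ e ∈ A, (w < G.multiplicity A e ∨ G.multiplicity A e = w ∧ (e : ℕ) < j) →
    G.Spanned A (marked (s OUT)) e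

theorem GreedyOK.of_eq {A : Finset (Fin m)} {w j : ℕ} {s s' : Store} (h : GreedyOK G A w j s)
    (h1 : s' OUT = s OUT) (h2 : s' COMP = s COMP) : GreedyOK G A w j s' :=
  ⟨by rw [h1, h2]; exact h.forest, by rw [h1]; exact h.out_le, by rw [h1]; exact h.spanned⟩

/-- An edge of A with the current multiplicity is rejected only if its endpoints carry the same
label, that is, if they are already connected by bundles of at least this multiplicity. So it is
spanned after the step in either case. -/
theorem run_tryBundle {s : Store} {A : Finset (Fin m)} {w : ℕ} (hG : Stored G s)
    (hA : marked (s UNION) = A) (hmult : ∀ e : Fin m, s MULT e = G.multiplicity A e)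
    (hw : m - s 54 0 = w) {e : Fin m} (he : s 55 0 = e) (h : GreedyOK G A w e s) :
    GreedyOK G A w (e + 1) (tryBundle.run s) := by
  have hcond : (Expr.and (.read UNION (.var 55))
      (.and (.eq (.read MULT (.var 55)) (.sub (.read 0 (.const 1)) (.var 54)))
      (.not (.eq (.read COMP (.read EFST (.var 55))) (.read COMP (.read ESND (.var 55))))))).eval s
      ≠ 0 ↔ e ∈ A ∧ G.multiplicity A e = w ∧ s COMP (G.fst e) ≠ s COMP (G.snd e) := by
    rw [← hA, mem_marked, hA]
    simp [he, hmult, hG.fst, hG.snd, hG.edges, hw]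
  have hstep : ∀ f : Fin m, (f : ℕ) < e + 1 ↔ (f : ℕ) < e ∨ f = e := by
    intro f
    rw [Fin.ext_iff]
    omega
  simp only [tryBundle, run]
  split_ifs with hc
  · obtain ⟨heA, hew, hcomp⟩ := hcond.1 hc
    obtain ⟨h1, h2⟩ := run_addBundle hG he
    have hmem : ∀ f, f ∈ marked (addBundle.run s OUT) ↔
        f ∈ marked (s OUT) ∨ f ∈ A ∧ G.Parallel e f := by
      intro f
      rw [← hA, mem_marked, mem_marked, mem_marked, (h2 f).2]
    refine ⟨h.forest.add heA hew hcomp hmem h1, ?_, ?_⟩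
    · intro f
      rcases (h2 f).1 with h3 | h3
      · exact h3 ▸ h.out_le f
      · omega
    · intro f hf hfw
      rw [hstep] at hfw
      by_cases hfe : f = e
      · subst hfe
        exact (h.forest.add heA hew hcomp hmem h1).spanned hew (by simp [h1])
      · refine (h.spanned f hf (by tauto)).mono fun g hg => (hmem g).2 (Or.inl hg)
  · refine ⟨h.forest, h.out_le, fun f hf hfw => ?_⟩
    rw [hstep] at hfw
    by_cases hfe : f = e
    · subst hfe
      rcases hfw with hfw | hfw
      · exact h.spanned f hf (Or.inl hfw)
      · refine h.forest.spanned hfw.1 ?_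
        by_contra hcomp
        exact hc (hcond.2 ⟨hf, hfw.1, hcomp⟩)
    · exact h.spanned f hf (by tauto)

/-- The outer counter i stands for multiplicity m - i. Multiplicities of edges in A lie between 1
and m, so initially no edge has to be spanned yet, and at level 0 every edge has been treated. -/
theorem run_greedy {s : Store} (hG : Stored G s) :
    G.IsMaximumForestWithBundlesIn (marked (s UNION)) (marked (greedy.run s OUT)) ∧
      ∀ e : Fin m, greedy.run s OUT e ≤ 1 := by
  classical
  set A : Finset (Fin m) := marked (s UNION) with hA
  obtain ⟨h1, h2⟩ := run_initForest hG
  have hfr1 : ∀ a ∉ [50, COMP, 51, OUT, MULT], initForest.run s a = s a :=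
    fun a ha => run_of_notMem ha s
  have hrun : greedy.run s = (Cmd.loop 54 1 (.loop 55 1 tryBundle)).run
    (countParallel.run (initForest.run s)) := rfl
  rw [hrun]
  set s1 := initForest.run s with hs1
  have hG1 : Stored G s1 := hG.of_eq (hfr1 _ (by decide)) (hfr1 _ (by decide)) (hfr1 _ (by decide))
  have h3 := run_countParallel hG1 fun e he => (h2 e he).2
  rw [hfr1 UNION (by decide), ← hA] at h3
  have hfr2 : ∀ a ∉ [52, 53, MULT], countParallel.run s1 a = s1 a :=
    fun a ha => run_of_notMem ha s1
  set s2 := countParallel.run s1 with hs2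
  have hG2 : Stored G s2 := hG1.of_eq (hfr2 _ (by decide)) (hfr2 _ (by decide)) (hfr2 _ (by decide))
  have hU2 : s2 UNION = s UNION := by rw [hfr2 _ (by decide), hfr1 _ (by decide)]
  have hmul : ∀ e ∈ A, 1 ≤ G.multiplicity A e ∧ G.multiplicity A e ≤ m := by
    intro e he
    refine ⟨Finset.card_pos.2 ⟨e, Finset.mem_filter.2 ⟨he, parallel_refl e⟩⟩, ?_⟩
    exact (Finset.card_le_univ _).trans (by simp)
  have key := run_loop (c := 54) (b := 1) (s := s2) (p := .loop 55 1 tryBundle)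
    (fun i s' => GreedyOK G A (m - i) 0 s') ?_ ?_
  · rw [hG2.edges, Nat.sub_self] at key
    exact ⟨isMaximumForestWithBundlesIn_of_spanned key.forest.subset key.forest.acyclic
      key.forest.closed fun e he => key.spanned e he (Or.inl (hmul e he).1), key.out_le⟩
  · have hO : ∀ e : Fin m, s2 OUT e = 0 := by
      intro e
      rw [hfr2 _ (by decide), (h2 e e.2).1]
    have hM : (marked (s2 OUT) : Finset (Fin m)) = ∅ := by
      ext e
      simp [mem_marked, hO]
    refine GreedyOK.of_eq (s := s2) ⟨?_, fun e => by simp [hO], fun e he hew => ?_⟩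
      (Store.write_of_ne _ _ _ (by decide)) (Store.write_of_ne _ _ _ (by decide))
    · rw [hM]
      refine greedyForest_empty fun u v huv => ?_
      simp only [hfr2 COMP (by decide), h1 _ u.2, h1 _ v.2] at huv
      exact Fin.ext huv
    · have := (hmul e he).2
      omega
  · intro i s3 hi hc hfr3 hI
    rw [hG2.edges] at hi
    have hG3 : Stored G s3 := hG2.of_eq (hfr3 _ (by decide)) (hfr3 _ (by decide))
      (hfr3 _ (by decide))
    have key2 := run_loop (c := 55) (b := 1) (s := s3) (p := tryBundle)
      (fun j s' => GreedyOK G A (m - i) j s') (hI.of_eq (Store.write_of_ne _ _ _ (by decide))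
      (Store.write_of_ne _ _ _ (by decide))) (by
        intro j s4 hj hc4 hfr4 hI4
        rw [hG3.edges] at hj
        have hG4 : Stored G s4 := hG3.of_eq (hfr4 _ (by decide)) (hfr4 _ (by decide))
          (hfr4 _ (by decide))
        refine (run_tryBundle (e := ⟨j, hj⟩) hG4 ?_ ?_ ?_ hc4 hI4).of_eq
          (Store.write_of_ne _ _ _ (by decide)) (Store.write_of_ne _ _ _ (by decide))
        · rw [hfr4 _ (by decide), hfr3 _ (by decide), hU2]
        · rw [hfr4 _ (by decide), hfr3 _ (by decide)]
          exact h3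
        · rw [hfr4 54 (by decide), hc])
    rw [hG3.edges] at key2
    refine GreedyOK.of_eq ⟨key2.forest.mono (by omega), key2.out_le, fun e he hew => ?_⟩
      (Store.write_of_ne _ _ _ (by decide)) (Store.write_of_ne _ _ _ (by decide))
    exact key2.spanned e he (by omega)

end Ram.Cmd

/-! ### Transfer to the input graph and the main theorem -/

namespace EdgeColoredGraph

variable {n m k : ℕ}

/-- The graph on the natural numbers with the given graph on `Fin n`, up to the colors. -/
def extend (G : EdgeColoredGraph (Fin n) (Fin m) k) : EdgeColoredGraph ℕ ℕ 1 where
  -- Indices from m on get the dummy endpoints 0 and 1, merely to satisfy looplessness; only edges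
  -- below m are ever considered.
  fst e := if h : e < m then G.fst ⟨e, h⟩ else 0
  snd e := if h : e < m then G.snd ⟨e, h⟩ else 1
  fst_ne_snd e := by
    split_ifs with h
    · exact fun h' => G.fst_ne_snd ⟨e, h⟩ (Fin.ext h')
    · exact zero_ne_one
  color _ := 0

variable {G : EdgeColoredGraph (Fin n) (Fin m) k}

theorem incident_extend {e : Fin m} {v : ℕ} :
    G.extend.Incident e v ↔ ∃ u : Fin n, v = u ∧ G.Incident e u := by
  simp only [Incident, extend, e.2, dif_pos]
  constructor
  · rintro (h | h)
    exacts [⟨_, h.symm, Or.inl rfl⟩, ⟨_, h.symm, Or.inr rfl⟩]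
  · rintro ⟨u, rfl, rfl | rfl⟩ <;> simp

theorem isMatching_extend {F : Finset (Fin m)} :
    G.extend.IsMatching (F.map Fin.valEmbedding) ↔ G.IsMatching F := by
  constructor
  · intro h v e he f hf hev hfv
    exact Fin.ext (h v e (Finset.mem_map_of_mem Fin.valEmbedding he) f
      (Finset.mem_map_of_mem Fin.valEmbedding hf) (incident_extend.2 ⟨v, rfl, hev⟩)
      (incident_extend.2 ⟨v, rfl, hfv⟩))
  · intro h v e he f hf hev hfv
    obtain ⟨e, heF, rfl⟩ := Finset.mem_map.1 he
    obtain ⟨f, hfF, rfl⟩ := Finset.mem_map.1 hf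
    obtain ⟨u, rfl, hu⟩ := incident_extend.1 hev
    obtain ⟨w, hw, hfw⟩ := incident_extend.1 hfv
    obtain rfl := Fin.ext hw
    rw [h _ e heF f hfF hu hfw]

theorem isMaximumMatchingIn_of_extend {A M : Finset (Fin m)}
    (h : G.extend.IsMaximumMatchingIn (A.map Fin.valEmbedding) (M.map Fin.valEmbedding)) :
    G.IsMaximumMatchingIn A M := by
  refine ⟨Finset.map_subset_map.1 h.1, isMatching_extend.1 h.2.1, fun N hNA hN => ?_⟩
  simpa using h.2.2 _ (Finset.map_subset_map.2 hNA) (isMatching_extend.2 hN)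

theorem map_filter_val {p : ℕ → Prop} [DecidablePred p] :
    ((Finset.univ : Finset (Fin m)).filter fun e : Fin m => p e).map Fin.valEmbedding =
      (Finset.range m).filter p := by
  ext e
  simp only [Finset.mem_map, Finset.mem_filter, Finset.mem_univ, true_and, Finset.mem_range,
    Fin.valEmbedding_apply]
  constructor
  · rintro ⟨f, hf, rfl⟩
    exact ⟨f.2, hf⟩
  · rintro ⟨he, hp⟩
    exact ⟨⟨e, he⟩, hp, rfl⟩

end EdgeColoredGraph

namespace Ram

open EdgeColoredGraph

instance Cmd.decidableWF : ∀ p : Cmd, Decidable p.WF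
  | .skip => isTrue trivial
  | .write a _ _ => inferInstanceAs (Decidable (a ≠ 0))
  | .seq p q => @instDecidableAnd _ _ (decidableWF p) (decidableWF q)
  | .ite _ p q => @instDecidableAnd _ _ (decidableWF p) (decidableWF q)
  | .loop c _ p => @instDecidableAnd _ _ (inferInstanceAs (Decidable (c ≠ 0)))
      (@instDecidableAnd _ _ (inferInstanceAs (Decidable (c ∉ p.writes))) (decidableWF p))

/-- The number of rounds of the inner loops is stored in place of the number of colors. -/
def setRounds : Program :=
  .write 0 (.const 2) (.add (.add (.read 0 (.const 0)) (.read 0 (.const 0))) (.const 1))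

/-- The algorithm: maximum matchings in all color classes, then a greedy forest of bundles. -/
def matchingUnion : Program := .seq setRounds (Cmd.compile (.seq .collect .greedy))

/-- The 9 is the cost of `setRounds`, and 2X + 1 at X = n + m bounds array 0 afterwards. -/
noncomputable def matchingUnionTime : Polynomial ℕ :=
  9 + (Cmd.time (.seq .collect .greedy)).comp (2 * .X + 1)

variable {n m k : ℕ}

theorem exists_returnsWithin (G : EdgeColoredGraph (Fin n) (Fin m) k) :
    ∃ F : Finset (Fin m), G.ReturnsWithin matchingUnion (matchingUnionTime.eval (n + m)) F ∧
      G.IsMatchingUnionOutput F := by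
  set s : Store := G.inputStore.write 0 2 (n + n + 1) with hs
  have hfst : ∀ e : Fin m, s EFST e = G.fst e := by
    intro e
    simp [hs, inputStore]
  have hsnd : ∀ e : Fin m, s ESND e = G.snd e := by
    intro e
    simp [hs, inputStore]
  have hcol : ∀ e : Fin m, s ECOL e = G.color e := by
    intro e
    simp [hs, inputStore]
  have h00 : s 0 0 = n := by simp [hs, inputStore]
  have h01 : s 0 1 = m := by simp [hs, inputStore]
  have h02 : s 0 2 = n + n + 1 := by simp [hs]
  have hG : Encodes G.extend n m s := by
    refine ⟨h00, h01, by rw [h02]; omega, ?_, ?_, ?_, ?_⟩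
    · intro e he
      simpa [EdgeColoredGraph.extend, he] using hfst ⟨e, he⟩
    · intro e he
      simpa [EdgeColoredGraph.extend, he] using hsnd ⟨e, he⟩
    · intro e he
      simp [EdgeColoredGraph.extend, he]
    · intro e he
      simp [EdgeColoredGraph.extend, he]
  -- Overwriting the cell of k by 2n + 1 matters here: k may be arbitrarily large compared with n +
  -- m.
  have hK : ∀ b, s 0 b ≤ 2 * (n + m) + 1 := by
    intro b
    simp only [hs, Store.write_self, Function.update_apply, inputStore]
    split_ifs <;> omega
  have hfr : ∀ a ∈ [0, EFST, ESND], Cmd.collect.run s a = s a := by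
    intro a ha
    refine Cmd.run_of_notMem ?_ s
    revert a
    decide
  set s1 := Cmd.collect.run s with hs1
  have hG1 : Stored G s1 := by
    refine ⟨?_, ?_, ?_, ?_⟩ <;> rw [hfr _ (by decide)] <;> assumption
  obtain ⟨hmax, hle⟩ := Cmd.run_greedy hG1
  refine ⟨marked (Cmd.greedy.run s1 OUT), ?_, fun i => (marked (s1 UNION)).filter (G.color · = i),
    fun i => ?_, ?_⟩
  · have hwf : Cmd.WF (.seq .collect .greedy) := by decide
    obtain ⟨t, ht, hexec⟩ := Cmd.exec hwf hK
    refine ⟨_, _, ?_, .seq (.write _ _ _ _) hexec, fun e => ?_⟩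
    · simp only [Expr.cost, matchingUnionTime, Polynomial.eval_add, Polynomial.eval_comp,
        Polynomial.eval_mul, Polynomial.eval_X, Polynomial.eval_ofNat, Polynomial.eval_one]
      omega
    · have := hle e
      change Cmd.greedy.run s1 OUT e = _
      simp only [mem_marked]
      split_ifs <;> omega
  · by_cases hi : ∃ j, G.color j = i
    · obtain ⟨j, rfl⟩ := hi
      refine isMaximumMatchingIn_of_extend ?_
      have := Cmd.run_collect hG j.2
      convert this using 1
      · rw [Cmd.colorMask, ← map_filter_val, colorClass]
        simp only [hcol, Fin.val_inj]
      · simp only [mask, marked, Finset.filter_filter]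
        rw [← map_filter_val]
        simp only [hcol, Fin.val_inj, hs1]
    -- Colors without edges are never visited by `collect`; for them the empty matching is maximum.
    · have hempty : G.colorClass i = ∅ := by
        ext e
        simpa [colorClass] using fun h => hi ⟨e, h⟩
      have hempty' : (marked (s1 UNION)).filter (G.color · = i) = ∅ := by
        ext e
        simpa using fun _ h => hi ⟨e, h⟩
      simp only [hempty, hempty']
      exact ⟨subset_rfl, fun v e he => by simp at he, fun N hN _ => Finset.card_le_card hN⟩
  · have : (Finset.univ.biUnion fun i => (marked (s1 UNION)).filter (G.color · = i)) =
        marked (s1 UNION) := by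
      ext e
      simp
    rwa [this]

end Ram

/-- First part: a single polynomial-time algorithm returns, for every edge-colored graph, a
maximum-size forest with bundles in a union of maximum matchings of the color classes, and this is
a `3/4`-approximation for two colors and a `1/2`-approximation for three colors.  Second part: the
two guarantees do not depend on which maximum matchings and which forest are chosen. -/
theorem mainTheorem5 :
    (∃ (P : Ram.Program) (p : Polynomial ℕ),
      ∀ (n m k : ℕ) (G : EdgeColoredGraph (Fin n) (Fin m) k),
        ∃ F : Finset (Fin m),
          EdgeColoredGraph.ReturnsWithin P G (p.eval (n + m)) F ∧
          G.IsMatchingUnionOutput F ∧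
          (k = 2 → G.IsApproxSolution (3 / 4) F) ∧
          (k = 3 → G.IsApproxSolution (1 / 2) F)) ∧
    (∀ (V E : Type) [Fintype V] [Fintype E] [DecidableEq E],
      (∀ (G : EdgeColoredGraph V E 2) (F : Finset E),
        G.IsMatchingUnionOutput F → G.IsApproxSolution (3 / 4) F) ∧
      (∀ (G : EdgeColoredGraph V E 3) (F : Finset E),
        G.IsMatchingUnionOutput F → G.IsApproxSolution (1 / 2) F)) := by

  refine ⟨⟨Ram.matchingUnion, Ram.matchingUnionTime, fun n m k G => ?_⟩, fun V E _ _ _ =>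
    ⟨fun G F h => EdgeColoredGraph.isApproxSolution_two h,
      fun G F h => EdgeColoredGraph.isApproxSolution_three h⟩⟩
  obtain ⟨F, hF, h⟩ := Ram.exists_returnsWithin G
  refine ⟨F, hF, h, ?_, ?_⟩
  · rintro rfl
    exact EdgeColoredGraph.isApproxSolution_two h
  · rintro rfl
    exact EdgeColoredGraph.isApproxSolution_three h
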